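/- **Bicategory $\mathrm{sAlg}^{fd}$.** Objects are finite-dimensional semisimple superalgebras over $\mathbb{C}$, 1-morphisms $A\to B$ are invertible (super) $(B,A)$-bimodules composed by relative tensor product, and 2-morphisms are even bimodule isomorphisms. **Serre automorphism.** $A^*=\mathrm{Lin}(A,\mathbb{C})$ is an $(A,A)$-bimodule via $(fa)(b)=f(ab)$ and $(af)(b)=(-1)^{|a|(|f|+|b|)}f(ba)$. For an invertible $(B,A)$-bimodule $M$ choose an inverse $(A,B)$-bimodule $N$ with even bimodule isomorphisms $\epsilon:M\otimes_A N\to B$ and $\eta:N\otimes_B M\to A$ that satisfy the snake relation $m\cdot\eta(n\otimes m')=\epsilon(m\otimes n)\cdot m'$. For $n\in N$, $f\in B^*$, $m\in M$ define $nfm\in A^*$ by $(nfm)(a)=(-1)^{|n|(|f|+|m|+|a|)}f(\epsilon(ma\otimes n))$. The Serre naturality isomorphism $$S_M:B^*\otimes_B M\to M\otimes_A A^*,\qquad S_M(f\otimes m)=\sum_j m_j\otimes n_jfm,\qquad \sum_j\epsilon(m_j\otimes n_j)=1,$$ does not depend on the choices, and makes $A\mapsto A^*$ a pseudonatural automorphism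 of $\mathrm{id}_{\mathrm{sAlg}^{fd}}$. **Fermion parity.** $A_{(-1)^F}$ is $A$ with right action twisted by $a\mapsto(-1)^{|a|}a$. With naturality $b(-1)^F\otimes m\mapsto(-1)^{|m|}bm\otimes(-1)^F$ it is a pseudonatural automorphism of the identity, and $x(-1)^F\otimes y(-1)^F\mapsto(-1)^{|y|}xy$ is a modification from its square to the identity. **2-group and action.** $\mathrm{Spin}_2\rtimes B\mathbb{Z}_2^F$ has objects $\{1,c\}=\mathbb{Z}/2$. A morphism $g\to g'$ is a pair $(k,e)\in\mathbb{Z}\times\mathbb{Z}/2$ with $k+e\equiv g'-g \pmod 2$. Composition and tensor product add the labels, the tensor product of objects is the group law, and the associator and unitors are trivial. It acts on $\mathrm{sAlg}^{fd}$: both objects act by the identity functor, the generator $(1,0):1\to c$ (which generates $\mathrm{Spin}_2$) acts by $A\mapsto A^*$, and $(0,1):1\to c$ acts by $A\mapsto A_{(-1)^F}$, which squares to the identity by the above modification. **Theorem.** The bicategory of $\mathrm{Spin}_2$-TFTs satisfying spin-statistics, i.e. the bicategory of $\mathrm{Spin}_2\rtimes B\mathbb{Z}_2^F$-homotopy fixed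 points in $\mathrm{sAlg}^{fd}$, is equivalent to the bicategory $\mathsf{ungrFrob}$ of ungraded-symmetric Frobenius algebras, defined as follows. * Objects: finite-dimensional semisimple complex superalgebras $A$ together with a linear functional $\lambda:A\to\mathbb{C}$ that vanishes on odd elements, such that the pairing $(a,b)\mapsto\lambda(ab)$ is nondegenerate and $\lambda(ab)=\lambda(ba)$ for all $a,b\in A$. * 1-morphisms from $(A,\lambda)$ to $(A',\lambda')$: invertible $(A',A)$-bimodules $M$ whose Serre naturality isomorphism $S_M:A'^*\otimes_{A'}M\to M\otimes_AA^*$ satisfies $S_M(\lambda'\otimes m)=(-1)^{|m|}m\otimes\lambda$ for all homogeneous $m\in M$. * 2-morphisms: all even bimodule isomorphisms. -/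

import Mathlib

open CategoryTheory

section
open CategoryTheory TensorProduct
open scoped Bicategory

universe u

/-- Complex superalgebras. The `ℤ/2`-grading is encoded by its parity involution `par`, which is `1` on even
elements and `-1` on odd elements: every algebra involution arises from a unique grading. -/
structure SuperAlg : Type (u + 1) where
  carrier : Type u
  [ring : Ring carrier]
  [algebra : Algebra ℂ carrier]
  par : carrier →ₐ[ℂ] carrier
  par_par : ∀ a, par (par a) = a

namespace SuperAlg
instance : CoeSort SuperAlg.{u} (Type u) := ⟨carrier⟩
instance (A : SuperAlg.{u}) : Ring A := A.ring
instance (A : SuperAlg.{u}) : Algebra ℂ A := A.algebra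
attribute [simp] par_par
end SuperAlg

/-- `(B, A)`-bimodules `M` in super vector spaces: `l b m = b m`, `r a m = m a`, and `par m = (-1)^{|m|} m`. -/
structure SBimod (B A : SuperAlg.{u}) : Type (u + 1) where
  carrier : Type u
  [addCommGroup : AddCommGroup carrier]
  [module : Module ℂ carrier]
  l : B →ₗ[ℂ] carrier →ₗ[ℂ] carrier
  r : A →ₗ[ℂ] carrier →ₗ[ℂ] carrier
  par : carrier →ₗ[ℂ] carrier
  l_one : ∀ m, l 1 m = m
  l_mul : ∀ b b' m, l (b * b') m = l b (l b' m)
  r_one : ∀ m, r 1 m = m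
  r_mul : ∀ a a' m, r (a * a') m = r a' (r a m)
  l_r : ∀ b a m, l b (r a m) = r a (l b m)
  par_par : ∀ m, par (par m) = m
  par_l : ∀ b m, par (l b m) = l (B.par b) (par m)
  par_r : ∀ a m, par (r a m) = r (A.par a) (par m)

namespace SBimod
variable {A B C D : SuperAlg.{u}}
instance : CoeSort (SBimod B A) (Type u) := ⟨carrier⟩
instance (M : SBimod B A) : AddCommGroup M := M.addCommGroup
instance (M : SBimod B A) : Module ℂ M := M.module
attribute [simp] l_one r_one par_par par_l par_r

/-- Even bimodule maps; preserving the grading means commuting with the parity involutions. -/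
@[ext]
structure Hom (M M' : SBimod B A) where
  map : M →ₗ[ℂ] M'
  map_l : ∀ b m, map (M.l b m) = M'.l b (map m)
  map_r : ∀ a m, map (M.r a m) = M'.r a (map m)
  map_par : ∀ m, map (M.par m) = M'.par (map m)

attribute [simp] Hom.map_l Hom.map_r Hom.map_par

instance : Category (SBimod B A) where
  Hom := Hom
  id M := ⟨LinearMap.id, fun _ _ => rfl, fun _ _ => rfl, fun _ => rfl⟩
  comp f g := ⟨g.map ∘ₗ f.map, by simp, by simp, by simp⟩

@[ext] theorem hom_ext {M M' : SBimod B A} {f g : M ⟶ M'} (h : ∀ m, f.map m = g.map m) : f = g :=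
  Hom.ext (LinearMap.ext h)

@[simp] theorem id_map (M : SBimod B A) (m : M) : (𝟙 M : M ⟶ M).map m = m := rfl
@[simp] theorem comp_map {M M' M'' : SBimod B A} (f : M ⟶ M') (g : M' ⟶ M'') (m : M) :
    (f ≫ g).map m = g.map (f.map m) := rfl

@[simp] theorem hom_inv_map {M M' : SBimod B A} (e : M ≅ M') (m : M) : e.inv.map (e.hom.map m) = m := by
  rw [← comp_map, e.hom_inv_id, id_map]
@[simp] theorem inv_hom_map {M M' : SBimod B A} (e : M ≅ M') (m : M') : e.hom.map (e.inv.map m) = m := by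
  rw [← comp_map, e.inv_hom_id, id_map]

/-- The span of the elements `n b ⊗ m - n ⊗ b m`. -/
def balanced (N : SBimod C B) (M : SBimod B A) : Submodule ℂ (N ⊗[ℂ] M) :=
  Submodule.span ℂ {x | ∃ (n : N) (b : B) (m : M), x = N.r b n ⊗ₜ[ℂ] m - n ⊗ₜ[ℂ] M.l b m}

abbrev RelTensor (N : SBimod C B) (M : SBimod B A) : Type u := (N ⊗[ℂ] M) ⧸ balanced N M

section
variable {N : SBimod C B} {M : SBimod B A} {X : Type*} [AddCommGroup X] [Module ℂ X]

def tmul (N : SBimod C B) (M : SBimod B A) : N →ₗ[ℂ] M →ₗ[ℂ] RelTensor N M :=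
  (TensorProduct.mk ℂ N M).compr₂ (balanced N M).mkQ

theorem tmul_bal (n : N) (b : B) (m : M) : tmul N M (N.r b n) m = tmul N M n (M.l b m) :=
  (Submodule.Quotient.eq _).2 (Submodule.subset_span ⟨n, b, m, rfl⟩)

def lift (f : N →ₗ[ℂ] M →ₗ[ℂ] X) (h : ∀ n b m, f (N.r b n) m = f n (M.l b m)) :
    RelTensor N M →ₗ[ℂ] X :=
  (balanced N M).liftQ (TensorProduct.lift f) (by
    rw [balanced, Submodule.span_le]
    rintro _ ⟨n, b, m, rfl⟩
    simp [h])

@[simp] theorem lift_tmul (f : N →ₗ[ℂ] M →ₗ[ℂ] X) (h) (n : N) (m : M) :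
    lift f h (tmul N M n m) = f n m := by
  simp [lift, tmul]

@[elab_as_elim]
theorem tind {p : RelTensor N M → Prop} (x : RelTensor N M) (h0 : p 0)
    (ht : ∀ n m, p (tmul N M n m)) (ha : ∀ x y, p x → p y → p (x + y)) : p x := by
  obtain ⟨x, rfl⟩ := (balanced N M).mkQ_surjective x
  induction x using TensorProduct.induction_on with
  | zero => simpa using h0
  | tmul n m => exact ht n m
  | add x y hx hy => simpa using ha _ _ hx hy

theorem text {f g : RelTensor N M →ₗ[ℂ] X} (h : ∀ n m, f (tmul N M n m) = g (tmul N M n m)) :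
    f = g := by
  refine LinearMap.ext fun x => ?_
  induction x using tind with
  | h0 => simp
  | ht n m => exact h n m
  | ha x y hx hy => simp [hx, hy]
end


def tmap {N N' : SBimod C B} {M M' : SBimod B A} (f : N →ₗ[ℂ] N') (g : M →ₗ[ℂ] M')
    (hf : ∀ b n, f (N.r b n) = N'.r b (f n)) (hg : ∀ b m, g (M.l b m) = M'.l b (g m)) :
    RelTensor N M →ₗ[ℂ] RelTensor N' M' :=
  lift ((tmul N' M').compl₁₂ f g) (by intro n b m; simp [hf, hg, tmul_bal])

@[simp] theorem tmap_tmul {N N' : SBimod C B} {M M' : SBimod B A} (f : N →ₗ[ℂ] N')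
    (g : M →ₗ[ℂ] M') (hf hg) (n : N) (m : M) :
    tmap f g hf hg (tmul N M n m) = tmul N' M' (f n) (g m) := by
  simp [tmap]

section
variable (N : SBimod C B) (M : SBimod B A)
def tl : C →ₗ[ℂ] RelTensor N M →ₗ[ℂ] RelTensor N M where
  toFun c := tmap (N.l c) LinearMap.id (fun b n => N.l_r c b n) (fun _ _ => rfl)
  map_add' c c' := text fun n m => by simp
  map_smul' z c := text fun n m => by simp
def tr : A →ₗ[ℂ] RelTensor N M →ₗ[ℂ] RelTensor N M where
  toFun a := tmap LinearMap.id (M.r a) (fun _ _ => rfl) (fun b m => (M.l_r b a m).symm)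
  map_add' c c' := text fun n m => by simp
  map_smul' z c := text fun n m => by simp
def tp : RelTensor N M →ₗ[ℂ] RelTensor N M :=
  lift ((tmul N M).compl₁₂ N.par M.par) (by intro n b m; simp [tmul_bal])
variable {N M}
@[simp] theorem tl_tmul (c : C) (n : N) (m : M) : tl N M c (tmul N M n m) = tmul N M (N.l c n) m := by
  simp [tl]
@[simp] theorem tr_tmul (a : A) (n : N) (m : M) : tr N M a (tmul N M n m) = tmul N M n (M.r a m) := by
  simp [tr]
@[simp] theorem tp_tmul (n : N) (m : M) : tp N M (tmul N M n m) = tmul N M (N.par n) (M.par m) := by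
  simp [tp]
end

/-- The relative tensor product `N ⊗_B M`. -/
def comp (N : SBimod C B) (M : SBimod B A) : SBimod C A where
  carrier := RelTensor N M
  l := tl N M
  r := tr N M
  par := tp N M
  l_one x := by induction x using tind <;> simp_all
  l_mul b b' x := by induction x using tind <;> simp_all [l_mul]
  r_one x := by induction x using tind <;> simp_all
  r_mul b b' x := by induction x using tind <;> simp_all [r_mul]
  l_r b a x := by induction x using tind <;> simp_all
  par_par x := by induction x using tind <;> simp_all
  par_l b x := by induction x using tind <;> simp_all
  par_r b x := by induction x using tind <;> simp_all

/-- `n ⊗ m` in `N ⊗_B M`. -/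
def t (N : SBimod C B) (M : SBimod B A) : N →ₗ[ℂ] M →ₗ[ℂ] (comp N M) := tmul N M

section
variable {N : SBimod C B} {M : SBimod B A}
theorem t_bal (n : N) (b : B) (m : M) : t N M (N.r b n) m = t N M n (M.l b m) := tmul_bal n b m
@[simp] theorem comp_l (c : C) (n : N) (m : M) : (comp N M).l c (t N M n m) = t N M (N.l c n) m :=
  tl_tmul ..
@[simp] theorem comp_r (a : A) (n : N) (m : M) : (comp N M).r a (t N M n m) = t N M n (M.r a m) :=
  tr_tmul ..
@[simp] theorem comp_par (n : N) (m : M) : (comp N M).par (t N M n m) = t N M (N.par n) (M.par m) :=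
  tp_tmul ..

@[elab_as_elim]
theorem ind {p : comp N M → Prop} (x : comp N M) (h0 : p 0)
    (ht : ∀ n m, p (t N M n m)) (ha : ∀ x y, p x → p y → p (x + y)) : p x := tind x h0 ht ha

variable {X : Type*} [AddCommGroup X] [Module ℂ X]
theorem lin_ext {f g : comp N M →ₗ[ℂ] X} (h : ∀ n m, f (t N M n m) = g (t N M n m)) : f = g :=
  text h

def clift (f : N →ₗ[ℂ] M →ₗ[ℂ] X) (h : ∀ n b m, f (N.r b n) m = f n (M.l b m)) :
    comp N M →ₗ[ℂ] X := lift f h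
@[simp] theorem clift_t (f : N →ₗ[ℂ] M →ₗ[ℂ] X) (h) (n : N) (m : M) :
    clift f h (t N M n m) = f n m := lift_tmul f h n m

theorem comp_hom_ext {X : SBimod C A} {f g : comp N M ⟶ X}
    (h : ∀ n m, f.map (t N M n m) = g.map (t N M n m)) : f = g :=
  Hom.ext (lin_ext h)

/-- A bimodule map out of `N ⊗_B M` from a balanced, bilinear, equivariant, even map. -/
def homLift {X : SBimod C A} (f : N →ₗ[ℂ] M →ₗ[ℂ] X) (h : ∀ n b m, f (N.r b n) m = f n (M.l b m))
    (hl : ∀ c n m, f (N.l c n) m = X.l c (f n m)) (hr : ∀ a n m, f n (M.r a m) = X.r a (f n m))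
    (hp : ∀ n m, f (N.par n) (M.par m) = X.par (f n m)) : comp N M ⟶ X where
  map := clift f h
  map_l c x := by induction x using ind <;> simp_all
  map_r c x := by induction x using ind <;> simp_all
  map_par x := by induction x using ind <;> simp_all

@[simp] theorem homLift_t {X : SBimod C A} (f : N →ₗ[ℂ] M →ₗ[ℂ] X) (h hl hr hp) (n : N) (m : M) :
    (homLift f h hl hr hp).map (t N M n m) = f n m := clift_t f h n m
end

/-- `f ⊗ g` -/
def homMap {N N' : SBimod C B} {M M' : SBimod B A} (f : N ⟶ N') (g : M ⟶ M') :
    comp N M ⟶ comp N' M' :=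
  homLift ((t N' M').compl₁₂ f.map g.map) (by simp [t_bal]) (by simp) (by simp) (by simp)

@[simp] theorem homMap_t {N N' : SBimod C B} {M M' : SBimod B A} (f : N ⟶ N') (g : M ⟶ M') (n : N)
    (m : M) : (homMap f g).map (t N M n m) = t N' M' (f.map n) (g.map m) := by
  simp [homMap]

/-- The regular bimodule. -/
def reg (A : SuperAlg.{u}) : SBimod A A where
  carrier := A
  l := LinearMap.mul ℂ A
  r := (LinearMap.mul ℂ A).flip
  par := A.par.toLinearMap
  l_one := by simp
  l_mul := by simp [mul_assoc]
  r_one := by simp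
  r_mul := by simp [mul_assoc]
  l_r := by simp [mul_assoc]
  par_par := by simp
  par_l := by simp
  par_r := by simp

/-- The identification of the superalgebra with the underlying space of its regular bimodule. -/
def toReg (A : SuperAlg.{u}) : A ≃ₗ[ℂ] reg A := LinearEquiv.refl ℂ A

@[simp] theorem reg_l (A : SuperAlg.{u}) (a b : A) : (reg A).l a (toReg A b) = toReg A (a * b) := rfl
@[simp] theorem reg_r (A : SuperAlg.{u}) (a b : A) : (reg A).r a (toReg A b) = toReg A (b * a) := rfl
@[simp] theorem reg_par (A : SuperAlg.{u}) (a : A) :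
    (reg A).par (toReg A a) = toReg A (A.par a) := rfl

section
variable (P : SBimod D C) (N : SBimod C B) (M : SBimod B A)

def assocAux (p : P) : comp N M →ₗ[ℂ] comp (comp P N) M :=
  clift ((t (comp P N) M).comp (t P N p)) (by simp [← t_bal])
@[simp] theorem assocAux_t (p : P) (n : N) (m : M) :
    assocAux P N M p (t N M n m) = t (comp P N) M (t P N p n) m := by
  simp [assocAux]
def assocAux' (m : M) : comp P N →ₗ[ℂ] comp P (comp N M) :=
  clift ((t P (comp N M)).compl₂ ((t N M).flip m)) (by simp [t_bal])
@[simp] theorem assocAux'_t (p : P) (n : N) (m : M) :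
    assocAux' P N M m (t P N p n) = t P (comp N M) p (t N M n m) :=
  clift_t ((t P (comp N M)).compl₂ ((t N M).flip m)) (by simp [t_bal]) p n

/-- `P ⊗ (N ⊗ M) ≅ (P ⊗ N) ⊗ M`. -/
def assoc : comp P (comp N M) ≅ comp (comp P N) M where
  hom := homLift
    (LinearMap.mk₂ ℂ (fun p x => assocAux P N M p x)
      (fun p p' x => by induction x using ind <;> simp_all [add_add_add_comm])
      (fun z p x => by induction x using ind <;> simp_all)
      (by simp) (by simp))
    (fun p c x => by induction x using ind <;> simp_all [t_bal])
    (fun p c x => by induction x using ind <;> simp_all)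
    (fun p c x => by induction x using ind <;> simp_all)
    (fun p x => by induction x using ind <;> simp_all)
  inv := homLift
    (LinearMap.mk₂ ℂ (fun x m => assocAux' P N M m x)
      (by simp) (by simp)
      (fun x p p' => by induction x using ind <;> simp_all [add_add_add_comm])
      (fun z x p => by induction x using ind <;> simp_all))
    (fun x c p => by induction x using ind <;> simp_all [t_bal])
    (fun p x c => by induction x using ind <;> simp_all)
    (fun p x c => by induction x using ind <;> simp_all)
    (fun x p => by induction x using ind <;> simp_all)
  hom_inv_id := comp_hom_ext fun p x => by induction x using ind <;> simp_all
  inv_hom_id := comp_hom_ext fun x p => by induction x using ind <;> simp_all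

@[simp] theorem assoc_hom (p : P) (n : N) (m : M) :
    (assoc P N M).hom.map (t P _ p (t N M n m)) = t _ M (t P N p n) m := by simp [assoc]
@[simp] theorem assoc_inv (p : P) (n : N) (m : M) :
    (assoc P N M).inv.map (t _ M (t P N p n) m) = t P _ p (t N M n m) := by simp [assoc]

def unitRHom : comp M (reg A) ⟶ M :=
  homLift (M.r.flip.compl₂ (toReg A).symm.toLinearMap)
    (fun m a b => by obtain ⟨b, rfl⟩ := (toReg A).surjective b; simp [M.r_mul])
    (fun c n m => by simp [M.l_r])
    (fun a n m => by obtain ⟨b, rfl⟩ := (toReg A).surjective m; simp [M.r_mul])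
    (fun n m => by obtain ⟨b, rfl⟩ := (toReg A).surjective m; simp)

@[simp] theorem unitRHom_t (b : reg A) (m : M) :
    (unitRHom M).map (t M _ m b) = M.r ((toReg A).symm b) m :=
  homLift_t (X := M) (M.r.flip.compl₂ (toReg A).symm.toLinearMap) _ _ _ _ m b

/-- `M ⊗_A A ≅ M`. -/
def unitR : comp M (reg A) ≅ M where
  hom := unitRHom M
  inv :=
    { map := (t M (reg A)).flip (toReg A 1)
      map_l := by simp
      map_r := fun a m => by simp [t_bal]
      map_par := fun m => by simp }
  hom_inv_id := comp_hom_ext fun m a => by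
    obtain ⟨b, rfl⟩ := (toReg A).surjective a; simp [t_bal]
  inv_hom_id := by ext m; simp

/-- `B ⊗_B M ≅ M`. -/
def unitL : comp (reg B) M ≅ M where
  hom := homLift (M.l ∘ₗ (toReg B).symm.toLinearMap)
    (fun m a b => by obtain ⟨m, rfl⟩ := (toReg B).surjective m; simp [M.l_mul])
    (fun c n m => by obtain ⟨b, rfl⟩ := (toReg B).surjective n; simp [M.l_mul])
    (fun a n m => by simp [M.l_r])
    (fun n m => by obtain ⟨b, rfl⟩ := (toReg B).surjective n; simp)
  inv :=
    { map := t (reg B) M (toReg B 1)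
      map_r := by simp
      map_l := fun a m => by simp [← t_bal]
      map_par := fun m => by simp }
  hom_inv_id := comp_hom_ext fun b m => by
    obtain ⟨b, rfl⟩ := (toReg B).surjective b; simp [← t_bal]
  inv_hom_id := by ext m; simp

@[simp] theorem unitL_hom (b : reg B) (m : M) :
    (unitL M).hom.map (t _ M b m) = M.l ((toReg B).symm b) m := by simp [unitL]
@[simp] theorem unitR_hom (b : reg A) (m : M) :
    (unitR M).hom.map (t M _ m b) = M.r ((toReg A).symm b) m := by simp [unitR]
@[simp] theorem unitL_inv (m : M) : (unitL M).inv.map m = t (reg B) M (toReg B 1) m := rfl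
@[simp] theorem unitR_inv (m : M) : (unitR M).inv.map m = t M (reg A) m (toReg A 1) := rfl
end

/-- The bicategory of superalgebras: 1-morphisms from `A` to `B` are `(B, A)`-bimodules, composed by relative
tensor product, and 2-morphisms are even bimodule maps. The composite of `M : A ⟶ B` and `N : B ⟶ C`, written
`M ≫ N`, is `N ⊗_B M`. -/
instance : Bicategory SuperAlg.{u} where
  Hom A B := SBimod B A
  id A := reg A
  comp M N := comp N M
  whiskerLeft M N N' f := homMap f (𝟙 M)
  whiskerRight f N := homMap (𝟙 N) f
  associator M N P := assoc P N M
  leftUnitor M := unitR M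
  rightUnitor M := unitL M
  whiskerLeft_id M N := by
    apply comp_hom_ext; intro x y; simp
  whiskerLeft_comp M _ _ _ f g := by
    apply comp_hom_ext; intro x y; simp
  id_whiskerLeft f := by
    apply comp_hom_ext; intro x y; simp
  comp_whiskerLeft M N _ _ f := by
    apply comp_hom_ext; intro x y; induction y using ind <;> simp_all
  id_whiskerRight M N := by
    apply comp_hom_ext; intro x y; simp
  comp_whiskerRight f g M := by
    apply comp_hom_ext; intro x y; simp
  whiskerRight_id f := by
    apply comp_hom_ext; intro x y; simp
  whiskerRight_comp f M N := by
    apply comp_hom_ext; intro x y; induction x using ind <;> simp_all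
  whisker_assoc M _ _ f N := by
    apply comp_hom_ext; intro x y; induction y using ind <;> simp_all
  whisker_exchange f g := by
    apply comp_hom_ext; intro x y; simp
  pentagon M N P Q := by
    apply comp_hom_ext; intro x y
    induction y using ind with
    | ht x y => induction y using ind <;> simp_all
    | h0 => simp
    | ha => simp_all
  triangle M N := by
    apply comp_hom_ext; intro x y
    induction y using ind <;> simp_all [t_bal]

end SBimod
end

section
open CategoryTheory Bicategory
open scoped Pseudofunctor.StrongTrans
universe w v u

/-- Pseudonatural endotransformations of the identity, with modifications as morphisms. -/
abbrev NatEnd (𝓑 : Type u) [Bicategory.{w, v} 𝓑] := Pseudofunctor.id 𝓑 ⟶ Pseudofunctor.id 𝓑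

namespace NatEnd
variable {𝓑 : Type u} [Bicategory.{w, v} 𝓑]

/-- The component at an object. -/
def ap (σ : NatEnd 𝓑) (a : 𝓑) : a ⟶ a := σ.app a
/-- The component at a 1-morphism. -/
def nat (σ : NatEnd 𝓑) {a b : 𝓑} (f : a ⟶ b) : f ≫ σ.ap b ≅ σ.ap a ≫ f := σ.naturality f

theorem nat_nat (σ : NatEnd 𝓑) {a b : 𝓑} {f g : a ⟶ b} (η : f ⟶ g) :
    η ▷ σ.ap b ≫ (σ.nat g).hom = (σ.nat f).hom ≫ σ.ap a ◁ η := σ.naturality_naturality η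

theorem nat_nat_assoc (σ : NatEnd 𝓑) {a b : 𝓑} {f g : a ⟶ b} (η : f ⟶ g) {h : a ⟶ b} (k : σ.ap a ≫ g ⟶ h) :
    η ▷ σ.ap b ≫ (σ.nat g).hom ≫ k = (σ.nat f).hom ≫ σ.ap a ◁ η ≫ k := by
  rw [← Category.assoc, nat_nat, Category.assoc]

theorem nat_id (σ : NatEnd 𝓑) (a : 𝓑) :
    (σ.nat (𝟙 a)).hom = (λ_ (σ.ap a)).hom ≫ (ρ_ (σ.ap a)).inv := by
  have h := σ.naturality_id a
  change (σ.nat (𝟙 a)).hom ≫ σ.ap a ◁ 𝟙 (𝟙 a) = 𝟙 (𝟙 a) ▷ σ.ap a ≫ (λ_ (σ.ap a)).hom ≫ (ρ_ (σ.ap a)).inv at h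
  simpa using h

theorem nat_comp (σ : NatEnd 𝓑) {a b c : 𝓑} (f : a ⟶ b) (g : b ⟶ c) :
    (σ.nat (f ≫ g)).hom = (α_ _ _ _).hom ≫ f ◁ (σ.nat g).hom ≫ (α_ _ _ _).inv ≫
      (σ.nat f).hom ▷ g ≫ (α_ _ _ _).hom := by
  have h := σ.naturality_comp f g
  change (σ.nat (f ≫ g)).hom ≫ σ.ap a ◁ 𝟙 (f ≫ g) = 𝟙 (f ≫ g) ▷ σ.ap c ≫ (α_ _ _ _).hom ≫ f ◁ (σ.nat g).hom ≫ (α_ _ _ _).inv ≫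
      (σ.nat f).hom ▷ g ≫ (α_ _ _ _).hom at h
  simpa using h

/-- Constructor. -/
def mk (app : ∀ a : 𝓑, a ⟶ a) (nat : ∀ {a b : 𝓑} (f : a ⟶ b), f ≫ app b ≅ app a ≫ f)
    (nat_nat : ∀ {a b : 𝓑} {f g : a ⟶ b} (η : f ⟶ g),
      η ▷ app b ≫ (nat g).hom = (nat f).hom ≫ app a ◁ η)
    (nat_id : ∀ a : 𝓑, (nat (𝟙 a)).hom = (λ_ (app a)).hom ≫ (ρ_ (app a)).inv)
    (nat_comp : ∀ {a b c : 𝓑} (f : a ⟶ b) (g : b ⟶ c),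
      (nat (f ≫ g)).hom = (α_ _ _ _).hom ≫ f ◁ (nat g).hom ≫ (α_ _ _ _).inv ≫
      (nat f).hom ▷ g ≫ (α_ _ _ _).hom) : NatEnd 𝓑 where
  app := app
  naturality := nat
  naturality_naturality := nat_nat
  naturality_id a := by
    change (nat (𝟙 a)).hom ≫ app a ◁ 𝟙 (𝟙 a) = 𝟙 (𝟙 a) ▷ app a ≫ (λ_ (app a)).hom ≫ (ρ_ (app a)).inv
    simpa using nat_id a
  naturality_comp {a b c} f g := by
    change (nat (f ≫ g)).hom ≫ app a ◁ 𝟙 (f ≫ g) = 𝟙 (f ≫ g) ▷ app c ≫ (α_ _ _ _).hom ≫ f ◁ (nat g).hom ≫ (α_ _ _ _).inv ≫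
      (nat f).hom ▷ g ≫ (α_ _ _ _).hom
    simpa using nat_comp f g

/-- The component of a modification. -/
def mo {σ τ : NatEnd 𝓑} (Γ : σ ⟶ τ) (a : 𝓑) : σ.ap a ⟶ τ.ap a := Γ.as.app a

theorem mo_nat {σ τ : NatEnd 𝓑} (Γ : σ ⟶ τ) {a b : 𝓑} (f : a ⟶ b) :
    f ◁ mo Γ b ≫ (τ.nat f).hom = (σ.nat f).hom ≫ mo Γ a ▷ f := Γ.as.naturality f

theorem mo_nat_assoc {σ τ : NatEnd 𝓑} (Γ : σ ⟶ τ) {a b : 𝓑} (f : a ⟶ b) {h : a ⟶ b} (k : τ.ap a ≫ f ⟶ h) :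
    f ◁ mo Γ b ≫ (τ.nat f).hom ≫ k = (σ.nat f).hom ≫ mo Γ a ▷ f ≫ k := by
  rw [← Category.assoc, mo_nat, Category.assoc]

theorem hom_ext {σ τ : NatEnd 𝓑} {Γ Δ' : σ ⟶ τ} (h : ∀ a, mo Γ a = mo Δ' a) : Γ = Δ' :=
  Pseudofunctor.StrongTrans.homCategory.ext h

def isoMk {σ τ : NatEnd 𝓑} (app : ∀ a, σ.ap a ≅ τ.ap a)
    (h : ∀ {a b : 𝓑} (f : a ⟶ b), f ◁ (app b).hom ≫ (τ.nat f).hom = (σ.nat f).hom ≫ (app a).hom ▷ f) :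
    σ ≅ τ := Pseudofunctor.StrongTrans.isoMk app h

variable {σ τ υ ω : NatEnd 𝓑}
@[simp] theorem mo_isoMk_hom (app : ∀ a, σ.ap a ≅ τ.ap a) (h) (a : 𝓑) :
    mo (isoMk app h).hom a = (app a).hom := rfl
@[simp] theorem mo_isoMk_inv (app : ∀ a, σ.ap a ≅ τ.ap a) (h) (a : 𝓑) :
    mo (isoMk app h).inv a = (app a).inv := rfl
@[simp] theorem mo_comp (Γ : σ ⟶ τ) (Γ' : τ ⟶ υ) (a : 𝓑) : mo (Γ ≫ Γ') a = mo Γ a ≫ mo Γ' a := rfl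
@[simp] theorem mo_id (a : 𝓑) : mo (𝟙 σ) a = 𝟙 (σ.ap a) := rfl
@[simp] theorem ap_comp (a : 𝓑) : ap (σ ≫ τ) a = σ.ap a ≫ τ.ap a := rfl
@[simp] theorem ap_one (a : 𝓑) : ap (𝟙 (Pseudofunctor.id 𝓑)) a = 𝟙 a := rfl
theorem nat_tensor {a b : 𝓑} (f : a ⟶ b) : (nat (σ ≫ τ) f).hom =
   (α_ _ _ _).inv ≫ (σ.nat f).hom ▷ τ.ap b ≫ (α_ _ _ _).hom ≫ σ.ap a ◁ (τ.nat f).hom ≫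
     (α_ _ _ _).inv := rfl
theorem nat_one {a b : 𝓑} (f : a ⟶ b) :
    (nat (𝟙 (Pseudofunctor.id 𝓑)) f).hom = (ρ_ f).hom ≫ (λ_ f).inv := rfl
@[simp] theorem mo_whiskerLeft (Γ : τ ⟶ υ) (a : 𝓑) : mo (σ ◁ Γ) a = σ.ap a ◁ mo Γ a := rfl
@[simp] theorem mo_whiskerRight (Γ : σ ⟶ τ) (a : 𝓑) : mo (Γ ▷ υ) a = mo Γ a ▷ υ.ap a := rfl
@[simp] theorem mo_assoc_hom (a : 𝓑) :
    mo (α_ σ τ υ).hom a = (α_ (σ.ap a) (τ.ap a) (υ.ap a)).hom := rfl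
@[simp] theorem mo_assoc_inv (a : 𝓑) :
    mo (α_ σ τ υ).inv a = (α_ (σ.ap a) (τ.ap a) (υ.ap a)).inv := rfl
@[simp] theorem mo_lu_hom (a : 𝓑) : mo (λ_ σ).hom a = (λ_ (σ.ap a)).hom := rfl
@[simp] theorem mo_ru_hom (a : 𝓑) : mo (ρ_ σ).hom a = (ρ_ (σ.ap a)).hom := rfl

/-- `σ ⊗ τ ≅ τ ⊗ σ`, from the naturality of `τ` at the components of `σ`. -/
def braid (σ τ : NatEnd 𝓑) : σ ≫ τ ≅ τ ≫ σ :=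
  isoMk (fun a => τ.nat (σ.ap a)) fun {a b} f => by
    have h := (α_ _ _ _).inv ≫= τ.nat_nat (σ.nat f).hom =≫ (α_ _ _ _).inv
    simp only [nat_comp, Category.assoc, Iso.hom_inv_id, Category.comp_id,
      Iso.inv_hom_id_assoc] at h
    simp only [ap_comp, nat_tensor, Category.assoc, h]

instance : BraidedCategory (NatEnd 𝓑) where
  braiding σ τ := braid σ τ
  braiding_naturality_right σ τ υ f := by
    apply hom_ext; intro a
    exact mo_nat f (σ.ap a)
  braiding_naturality_left f υ := by
    apply hom_ext; intro a
    exact nat_nat _ (mo f a)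
  hexagon_forward σ τ υ := by
    apply hom_ext; intro a
    change (α_ (σ.ap a) (τ.ap a) (υ.ap a)).hom ≫ (nat (τ ≫ υ) (σ.ap a)).hom ≫
      (α_ (τ.ap a) (υ.ap a) (σ.ap a)).hom = (τ.nat (σ.ap a)).hom ▷ _ ≫
      (α_ (τ.ap a) (σ.ap a) (υ.ap a)).hom ≫ τ.ap a ◁ (υ.nat (σ.ap a)).hom
    simp [nat_tensor]
  hexagon_reverse σ τ υ := by
    apply hom_ext; intro a
    change (α_ (σ.ap a) (τ.ap a) (υ.ap a)).inv ≫ (nat υ (σ.ap a ≫ τ.ap a)).hom ≫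
      (α_ (υ.ap a) (σ.ap a) (τ.ap a)).inv = σ.ap a ◁ (υ.nat (τ.ap a)).hom ≫
      (α_ (σ.ap a) (υ.ap a) (τ.ap a)).inv ≫ (υ.nat (σ.ap a)).hom ▷ τ.ap a
    simp [nat_comp]


section inverse
variable [IsLocallyGroupoid 𝓑]

noncomputable def gi {a b : 𝓑} {f g : a ⟶ b} (η : f ⟶ g) : f ≅ g := asIso η

@[simp] theorem gi_hom {a b : 𝓑} {f g : a ⟶ b} (η : f ⟶ g) : (gi η).hom = η := rfl

variable (σ : NatEnd 𝓑) (Y : ∀ a : 𝓑, a ⟶ a) (adj : ∀ a, σ.ap a ⊣ Y a)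

noncomputable def invNat {a b : 𝓑} (f : a ⟶ b) : f ≫ Y b ≅ Y a ≫ f :=
  (gi (Bicategory.mateEquiv (adj a) (adj b) (σ.nat f).hom)).symm

theorem invNat_inv {a b : 𝓑} (f : a ⟶ b) :
    (invNat σ Y adj f).inv = Bicategory.mateEquiv (adj a) (adj b) (σ.nat f).hom := rfl

theorem invNat_eq {a b : 𝓑} (f : a ⟶ b) :
    (λ_ f).inv ≫ (adj a).unit ▷ f ≫ (α_ _ _ _).hom ≫ σ.ap a ◁ (invNat σ Y adj f).inv =
    (ρ_ f).inv ≫ f ◁ (adj b).unit ≫ (α_ _ _ _).inv ≫ (σ.nat f).hom ▷ Y b ≫ (α_ _ _ _).hom := by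
  have h := (Bicategory.mateEquiv_eq_iff (adj a) (adj b) (σ.nat f).hom _).1 rfl
  rw [← invNat_inv] at h
  simpa [Adjunction.homEquiv₁_symm_apply, Adjunction.homEquiv₂_apply] using h

theorem inj_aux {a b : 𝓑} {f : a ⟶ b} {h : a ⟶ b} {u v : Y a ≫ f ⟶ h}
    (e : (λ_ f).inv ≫ (adj a).unit ▷ f ≫ (α_ _ _ _).hom ≫ σ.ap a ◁ u =
      (λ_ f).inv ≫ (adj a).unit ▷ f ≫ (α_ _ _ _).hom ≫ σ.ap a ◁ v) : u = v := by
  apply (adj a).homEquiv₁.symm.injective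
  simpa [Adjunction.homEquiv₁_symm_apply] using e

theorem invNat_nat {a b : 𝓑} {f g : a ⟶ b} (η : f ⟶ g) :
    (invNat σ Y adj f).inv ≫ η ▷ Y b = Y a ◁ η ≫ (invNat σ Y adj g).inv := by
  apply inj_aux σ Y adj
  have h1 := invNat_eq σ Y adj f =≫ σ.ap a ◁ η ▷ Y b
  have h2 := η ≫= invNat_eq σ Y adj g
  simp only [Category.assoc] at h1
  simp only [Bicategory.whiskerLeft_comp, h1]
  have h3 := congrArg (· ▷ Y b) (σ.nat_nat η)
  simp only [comp_whiskerRight] at h3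
  rw [← associator_naturality_middle, ← reassoc_of% h3, ← associator_inv_naturality_left_assoc,
    whisker_exchange_assoc, ← rightUnitor_inv_naturality_assoc, ← h2]
  rw [leftUnitor_inv_naturality_assoc, whisker_exchange_assoc]
  simp

/-- The inverse of a pseudonatural transformation whose components are equivalences. -/
noncomputable def inverse : NatEnd 𝓑 :=
  mk Y (fun f => invNat σ Y adj f)
    (fun {a b f g} η => by
      rw [← cancel_epi (invNat σ Y adj f).inv, ← cancel_mono (invNat σ Y adj g).inv]
      simp only [Category.assoc, Iso.hom_inv_id, Category.comp_id, Iso.inv_hom_id_assoc]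
      exact invNat_nat σ Y adj η)
    (fun a => by
      rw [← cancel_epi (invNat σ Y adj _).inv, Iso.inv_hom_id, invNat_inv, nat_id,
        Bicategory.mateEquiv_leftUnitor_hom_rightUnitor_inv]
      simp)
    (fun {a b c} f g => by
      rw [← cancel_epi (invNat σ Y adj _).inv, Iso.inv_hom_id, invNat_inv, nat_comp]
      have h := Bicategory.mateEquiv_vcomp (adj a) (adj b) (adj c) (σ.nat f).hom (σ.nat g).hom
      simp only [leftAdjointSquare.vcomp, rightAdjointSquare.vcomp, ← invNat_inv] at h
      rw [h]
      simp)

noncomputable def inverseIso : σ ≫ inverse σ Y adj ≅ 𝟙 (Pseudofunctor.id 𝓑) :=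
  (isoMk (σ := 𝟙 (Pseudofunctor.id 𝓑)) (τ := σ ≫ inverse σ Y adj) (fun a => gi (adj a).unit) fun {a b} f => by
    rw [nat_tensor, nat_one]
    have h := (ρ_ _).hom ≫= invNat_eq σ Y adj f =≫ σ.ap a ◁ (invNat σ Y adj f).hom
    change f ◁ (adj b).unit ≫ (α_ _ _ _).inv ≫ (σ.nat f).hom ▷ Y b ≫ (α_ _ _ _).hom ≫
      σ.ap a ◁ (invNat σ Y adj f).hom ≫ (α_ _ _ _).inv = _
    simp only [Category.assoc, Iso.hom_inv_id_assoc] at h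
    rw [← reassoc_of% h]
    simp [gi_hom]; rfl).symm
end inverse
end NatEnd
end

section
open CategoryTheory
open scoped MonoidalCategory
universe w v u

namespace ZPow
variable {C : Type u} [Category.{v} C] [MonoidalCategory C] (X : C)

/-- A sequence of objects indexed by `ℤ` with isomorphisms `X ⊗ P n ≅ P (n + 1)`. -/
structure Fam where
  P : ℤ → C
  s : ∀ m n : ℤ, n = m + 1 → (X ⊗ P m ≅ P n)

variable {X} (A B D : Fam X)

def IsFam (f : ∀ n, A.P n ⟶ B.P n) : Prop :=
  ∀ m n h, (A.s m n h).hom ≫ f n = X ◁ f m ≫ (B.s m n h).hom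

variable {A B D}

theorem IsFam.comp {f : ∀ n, A.P n ⟶ B.P n} {g : ∀ n, B.P n ⟶ D.P n}
    (hf : IsFam A B f) (hg : IsFam B D g) : IsFam A D (fun n => f n ≫ g n) := by
  intro m n h
  rw [reassoc_of% hf m n h, hg m n h]
  simp

theorem IsFam.id : IsFam A A (fun _ => 𝟙 _) := by
  intro m n h; simp

/-- Transport along an equality of indices. -/
def Fam.cast (A : Fam X) {m n : ℤ} (h : m = n) : A.P m ≅ A.P n := eqToIso (by rw [h])

theorem Fam.cast_s (A : Fam X) {m n m' n' : ℤ} (h : n = m + 1) (h' : n' = m' + 1) (hm : m = m')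
  (hn : n = n') : (A.s m n h).hom ≫ (A.cast hn).hom = X ◁ (A.cast hm).hom ≫ (A.s m' n' h').hom := by
  subst hm hn
  simp [cast]

def rightFam (A : Fam X) (U : C) : Fam X where
  P n := A.P n ⊗ U
  s m n h := (α_ _ _ _).symm ≪≫ MonoidalCategory.whiskerRightIso (A.s m n h) U

def shiftFam (A : Fam X) (k : ℤ) : Fam X where
  P n := A.P (n + k)
  s m n h := A.s (m + k) (n + k) (by rw [h]; ring)

theorem isFam_whiskerRight {f : ∀ n, A.P n ⟶ B.P n} (hf : IsFam A B f) (U : C) :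
    IsFam (rightFam A U) (rightFam B U) (fun n => f n ▷ U) := by
  intro m n h
  have := congrArg (· ▷ U) (hf m n h)
  simp only [MonoidalCategory.comp_whiskerRight] at this
  simp [rightFam, this]

theorem isFam_whiskerLeft (A : Fam X) {U V : C} (g : U ⟶ V) :
    IsFam (rightFam A U) (rightFam A V) (fun n => A.P n ◁ g) := by
  intro m n h
  simp [rightFam, ← MonoidalCategory.whisker_exchange]

theorem isFam_assoc (A : Fam X) {U V : C} :
    IsFam (rightFam (rightFam A U) V) (rightFam A (U ⊗ V)) (fun n => (α_ (A.P n) U V).hom) := by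
  intro m n h
  simp [rightFam]

theorem isFam_rightUnitor (A : Fam X) :
    IsFam (rightFam A (𝟙_ C)) A (fun n => (ρ_ (A.P n)).hom) := by
  intro m n h
  simp [rightFam]

theorem isFam_shift {f : ∀ n, A.P n ⟶ B.P n} (hf : IsFam A B f) (k : ℤ) :
    IsFam (shiftFam A k) (shiftFam B k) (fun n => f (n + k)) := fun m n h => hf _ _ _

theorem isFam_cast (A : Fam X) (k l j : ℤ) (h : ∀ n, n + k + l = n + j) :
    IsFam (shiftFam (shiftFam A l) k) (shiftFam A j) (fun n => (A.cast (h n)).hom) :=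
  fun m n e => A.cast_s _ _ _ _

theorem isFam_cast_zero (A : Fam X) :
    IsFam (shiftFam A 0) A (fun n => (A.cast (add_zero n)).hom) :=
  fun m n e => A.cast_s _ _ _ _

variable [(MonoidalCategory.tensorLeft X).IsEquivalence]

theorem whisker_inj {U V : C} {f g : U ⟶ V} (h : X ◁ f = X ◁ g) : f = g :=
  (MonoidalCategory.tensorLeft X).map_injective h

theorem IsFam.ext {f g : ∀ n, A.P n ⟶ B.P n}
    (hf : IsFam A B f) (hg : IsFam A B g) (h0 : f 0 = g 0) (n : ℤ) : f n = g n := by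
  induction n using Int.induction_on with
  | zero => exact h0
  | succ i ih =>
    rw [← cancel_epi (A.s i (i + 1) rfl).hom, hf, hg, ih]
  | pred i ih =>
    apply whisker_inj (X := X)
    rw [← cancel_mono (B.s (-i - 1) (-i) (by ring)).hom, ← hf, ← hg, ih]

noncomputable def up (f : A.P 0 ⟶ B.P 0) : ∀ n : ℕ, A.P n ⟶ B.P n
  | 0 => f
  | n + 1 => (A.s n (n + 1 : ℕ) (by simp)).inv ≫ X ◁ up f n ≫ (B.s n (n + 1 : ℕ) (by simp)).hom

noncomputable def back {m n : ℤ} (h : n = m + 1) (f : A.P n ⟶ B.P n) : A.P m ⟶ B.P m :=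
  (MonoidalCategory.tensorLeft X).preimage ((A.s m n h).hom ≫ f ≫ (B.s m n h).inv)

theorem whisker_back {m n : ℤ} (h : n = m + 1) (f : A.P n ⟶ B.P n) :
    X ◁ back h f = (A.s m n h).hom ≫ f ≫ (B.s m n h).inv :=
  (MonoidalCategory.tensorLeft X).map_preimage _

noncomputable def down (f : A.P 0 ⟶ B.P 0) : ∀ n : ℕ, A.P (Int.negSucc n) ⟶ B.P (Int.negSucc n)
  | 0 => back (by simp) f
  | n + 1 => back (by rw [Int.negSucc_eq, Int.negSucc_eq]; push_cast; ring) (down f n)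

/-- The extension to all `n` of a morphism at `0`. -/
noncomputable def extend (f : A.P 0 ⟶ B.P 0) : ∀ n : ℤ, A.P n ⟶ B.P n
  | .ofNat n => up f n
  | .negSucc n => down f n

theorem extend_zero (f : A.P 0 ⟶ B.P 0) : extend f 0 = f := rfl

theorem extend_isFam (f : A.P 0 ⟶ B.P 0) : IsFam A B (extend f) := by
  rintro (m | m) n h
  · obtain rfl : n = Int.ofNat (m + 1) := by simpa using h
    change _ ≫ ((A.s m (m + 1 : ℕ) (by simp)).inv ≫ X ◁ up f m ≫
      (B.s m (m + 1 : ℕ) (by simp)).hom) = _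
    exact Iso.hom_inv_id_assoc (A.s m (m + 1 : ℕ) (by simp)) _
  · cases m with
    | zero =>
      obtain rfl : n = 0 := by simpa using h
      change _ ≫ f = X ◁ back _ f ≫ _
      rw [whisker_back]; simp
    | succ m =>
      obtain rfl : n = Int.negSucc m := by
        rw [h, Int.negSucc_eq, Int.negSucc_eq]; push_cast; ring
      change _ ≫ down f m = X ◁ back _ (down f m) ≫ _
      rw [whisker_back]; simp

noncomputable def extendIso (f : A.P 0 ≅ B.P 0) (n : ℤ) : A.P n ≅ B.P n where
  hom := extend f.hom n
  inv := extend f.inv n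
  hom_inv_id := ((extend_isFam f.hom).comp (extend_isFam f.inv)).ext .id (by simp [extend_zero]) n
  inv_hom_id := ((extend_isFam f.inv).comp (extend_isFam f.hom)).ext .id (by simp [extend_zero]) n

variable (X)

noncomputable def posPow : ℕ → C
  | 0 => 𝟙_ C
  | n + 1 => X ⊗ posPow n

noncomputable def negPow : ℕ → C
  | 0 => (MonoidalCategory.tensorLeft X).objPreimage (𝟙_ C)
  | n + 1 => (MonoidalCategory.tensorLeft X).objPreimage (negPow n)

/-- The integral powers of an invertible object. -/
noncomputable def pow : ℤ → C
  | .ofNat n => posPow X n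
  | .negSucc n => negPow X n

theorem pow_zero : pow X 0 = 𝟙_ C := rfl

noncomputable def powStep : ∀ n : ℤ, X ⊗ pow X n ≅ pow X (n + 1)
  | .ofNat n => Iso.refl _
  | .negSucc 0 => (MonoidalCategory.tensorLeft X).objObjPreimageIso (𝟙_ C)
  | .negSucc (n + 1) => (MonoidalCategory.tensorLeft X).objObjPreimageIso (negPow X n)

noncomputable def powFam : Fam X where
  P := pow X
  s m n h := powStep X m ≪≫ eqToIso (by rw [h])

noncomputable def pcast {m n : ℤ} (h : m = n) : pow X m ≅ pow X n := (powFam X).cast h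

theorem pcast_rfl (m : ℤ) : pcast X (rfl : m = m) = Iso.refl _ := rfl

noncomputable def mul (m n : ℤ) : pow X m ⊗ pow X n ≅ pow X (m + n) :=
  extendIso (A := rightFam (powFam X) (pow X n)) (B := shiftFam (powFam X) n)
    (λ_ (pow X n) ≪≫ pcast X (zero_add n).symm) m

theorem isFam_mul (n : ℤ) : IsFam (rightFam (powFam X) (pow X n)) (shiftFam (powFam X) n)
    (fun m => (mul X m n).hom) := extend_isFam _

theorem pcast_trans {i j k : ℤ} (e : i = j) (e' : j = k) :
    (pcast X e).hom ≫ (pcast X e').hom = (pcast X (e.trans e')).hom := by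
  subst e e'; exact Category.id_comp _

theorem mul_zero (n : ℤ) : (mul X 0 n).hom = (λ_ (pow X n)).hom ≫
    (pcast X (zero_add n).symm).hom := rfl

theorem cast_mul {m m' n : ℤ} (h : m = m') : (pcast X h).hom ▷ pow X n ≫ (mul X m' n).hom =
   (mul X m n).hom ≫ (pcast X (by rw [h])).hom := by
  subst h
  simp [pcast_rfl]

theorem mul_assoc (l m n : ℤ) : (mul X l m).hom ▷ pow X n ≫ (mul X (l + m) n).hom ≫
    (pcast X (add_assoc l m n)).hom =
    (α_ _ _ _).hom ≫ pow X l ◁ (mul X m n).hom ≫ (mul X l (m + n)).hom := by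
  refine IsFam.ext (A := rightFam (rightFam (powFam X) (pow X m)) (pow X n))
    (B := shiftFam (powFam X) (m + n))
    (f := fun l => (mul X l m).hom ▷ pow X n ≫ (mul X (l + m) n).hom ≫
    (pcast X (add_assoc l m n)).hom)
    (g := fun l => (α_ _ _ _).hom ≫ pow X l ◁ (mul X m n).hom ≫ (mul X l (m + n)).hom)
    ((isFam_whiskerRight (isFam_mul X m) _).comp
     ((isFam_shift (isFam_mul X n) m).comp (isFam_cast _ _ _ _ fun k => add_assoc k m n)))
    ((isFam_assoc _).comp ((isFam_whiskerLeft _ _).comp (isFam_mul X _))) ?_ l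
  change (mul X 0 m).hom ▷ pow X n ≫ (mul X (0 + m) n).hom ≫
    (pcast X (add_assoc 0 m n)).hom =
    (α_ _ _ _).hom ≫ pow X 0 ◁ (mul X m n).hom ≫ (mul X 0 (m + n)).hom
  have h := cast_mul X (n := n) (zero_add m).symm
  rw [mul_zero, mul_zero]
  change ((λ_ (pow X m)).hom ≫ (pcast X (zero_add m).symm).hom) ▷ pow X n ≫ _ = _
  rw [MonoidalCategory.comp_whiskerRight, Category.assoc, reassoc_of% h]
  rw [pcast_trans]
  change _ = (α_ (𝟙_ C) _ _).hom ≫ 𝟙_ C ◁ (mul X m n).hom ≫ (λ_ _).hom ≫ _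
  rw [MonoidalCategory.leftUnitor_naturality_assoc, MonoidalCategory.leftUnitor_whiskerRight,
    Category.assoc]

theorem mul_unit (n : ℤ) : (ρ_ (pow X n)).hom =
    (mul X n 0).hom ≫ (pcast X (add_zero n)).hom := by
  refine IsFam.ext (A := rightFam (powFam X) (𝟙_ C)) (B := powFam X)
    (f := fun n => (ρ_ (pow X n)).hom)
    (g := fun n => (mul X n 0).hom ≫ (pcast X (add_zero n)).hom)
    (isFam_rightUnitor _) ((isFam_mul X 0).comp (isFam_cast_zero _)) ?_ n
  change (ρ_ (𝟙_ C)).hom = _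
  rw [mul_zero]
  change _ = ((λ_ (𝟙_ C)).hom ≫ 𝟙 _) ≫ 𝟙 _
  simp [MonoidalCategory.unitors_equal]

/-- The monoidal functor `n ↦ X ^ n` given by a tensor-invertible object `X`. -/
noncomputable def functor : Discrete ℤ ⥤ C := Discrete.functor (pow X)

noncomputable instance : (functor X).Monoidal :=
  Functor.CoreMonoidal.toMonoidal
    { εIso := Iso.refl _
      μIso := fun m n => mul X m.as n.as
      μIso_hom_natural_left := by
        rintro ⟨m⟩ ⟨m'⟩ f ⟨n⟩
        obtain rfl := Discrete.eq_of_hom f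
        obtain rfl : f = 𝟙 _ := Subsingleton.elim _ _
        change 𝟙 (pow X m) ▷ _ ≫ (mul X m n).hom = (mul X m n).hom ≫ 𝟙 _
        simp
      μIso_hom_natural_right := by
        rintro ⟨m⟩ ⟨m'⟩ ⟨n⟩ f
        obtain rfl := Discrete.eq_of_hom f
        obtain rfl : f = 𝟙 _ := Subsingleton.elim _ _
        change _ ◁ 𝟙 (pow X m) ≫ (mul X n m).hom = (mul X n m).hom ≫ 𝟙 _
        simp
      associativity := fun l m n => mul_assoc X l.as m.as n.as
      left_unitality := fun n => by
        change (λ_ (pow X n.as)).hom = 𝟙 (𝟙_ C) ▷ pow X n.as ≫ (mul X 0 n.as).hom ≫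
          (pcast X (zero_add n.as)).hom
        rw [mul_zero]
        change _ = _ ≫ ((λ_ (pow X n.as)).hom ≫ _) ≫ _
        rw [Category.assoc, pcast_trans, pcast_rfl, MonoidalCategory.id_whiskerRight]
        simp
      right_unitality := fun n => by
        change (ρ_ (pow X n.as)).hom = pow X n.as ◁ 𝟙 (𝟙_ C) ≫ (mul X n.as 0).hom ≫
          (pcast X (add_zero n.as)).hom
        rw [mul_unit, MonoidalCategory.whiskerLeft_id]
        exact (Category.id_comp _).symm }
end ZPow
end

section
open CategoryTheory
open scoped MonoidalCategory
universe w v u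

namespace SqPow
variable {C : Type u} [Category.{v} C] [MonoidalCategory C] (F : C) (e : F ⊗ F ≅ 𝟙_ C)

/-- `𝟙` and `F`, indexed by `ZMod 2`. -/
def pow : ZMod 2 → C
  | (0 : Fin 2) => 𝟙_ C
  | (1 : Fin 2) => F

def mul : ∀ m n : ZMod 2, pow F m ⊗ pow F n ≅ pow F (m + n)
  | (0 : Fin 2), (0 : Fin 2) => λ_ (𝟙_ C)
  | (0 : Fin 2), (1 : Fin 2) => λ_ F
  | (1 : Fin 2), (0 : Fin 2) => ρ_ F
  | (1 : Fin 2), (1 : Fin 2) => e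

def functor : Discrete (ZMod 2) ⥤ C := Discrete.functor (pow F)

/-- The monoidal structure given by a trivialization of `F ⊗ F`. -/
@[reducible]
def monoidal (he : e.hom ▷ F ≫ (λ_ F).hom = (α_ F F F).hom ≫ F ◁ e.hom ≫ (ρ_ F).hom) :
    (functor F).Monoidal :=
  Functor.CoreMonoidal.toMonoidal
    { εIso := Iso.refl _
      μIso := fun m n => mul F e m.as n.as
      μIso_hom_natural_left := by
        rintro ⟨m⟩ ⟨m'⟩ f ⟨n⟩
        obtain rfl := Discrete.eq_of_hom f
        obtain rfl : f = 𝟙 _ := Subsingleton.elim _ _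
        change 𝟙 (pow F m) ▷ _ ≫ (mul F e m n).hom = (mul F e m n).hom ≫ 𝟙 _
        simp
      μIso_hom_natural_right := by
        rintro ⟨m⟩ ⟨m'⟩ ⟨n⟩ f
        obtain rfl := Discrete.eq_of_hom f
        obtain rfl : f = 𝟙 _ := Subsingleton.elim _ _
        change _ ◁ 𝟙 (pow F m) ≫ (mul F e n m).hom = (mul F e n m).hom ≫ 𝟙 _
        simp
      associativity := by
        rintro ⟨(l : Fin 2)⟩ ⟨(m : Fin 2)⟩ ⟨(n : Fin 2)⟩
        fin_cases l <;> fin_cases m <;> fin_cases n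
        · change (λ_ (𝟙_ C)).hom ▷ 𝟙_ C ≫ (λ_ (𝟙_ C)).hom ≫ 𝟙 _ =
            (α_ _ _ _).hom ≫ 𝟙_ C ◁ (λ_ (𝟙_ C)).hom ≫ (λ_ _).hom
          rw [MonoidalCategory.leftUnitor_whiskerRight, MonoidalCategory.leftUnitor_naturality]
          simp
        · change (λ_ (𝟙_ C)).hom ▷ F ≫ (λ_ F).hom ≫ 𝟙 _ =
            (α_ _ _ _).hom ≫ 𝟙_ C ◁ (λ_ F).hom ≫ (λ_ _).hom
          simp
        · change (λ_ F).hom ▷ 𝟙_ C ≫ (ρ_ F).hom ≫ 𝟙 _ =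
            (α_ _ _ _).hom ≫ 𝟙_ C ◁ (ρ_ F).hom ≫ (λ_ _).hom
          simp
        · change (λ_ F).hom ▷ F ≫ e.hom ≫ 𝟙 _ =
            (α_ _ _ _).hom ≫ 𝟙_ C ◁ e.hom ≫ (λ_ _).hom
          simp
        · change (ρ_ F).hom ▷ 𝟙_ C ≫ (ρ_ F).hom ≫ 𝟙 _ =
            (α_ _ _ _).hom ≫ F ◁ (λ_ (𝟙_ C)).hom ≫ (ρ_ _).hom
          simp
        · change (ρ_ F).hom ▷ F ≫ e.hom ≫ 𝟙 _ =
            (α_ _ _ _).hom ≫ F ◁ (λ_ F).hom ≫ e.hom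
          simp
        · change e.hom ▷ 𝟙_ C ≫ (λ_ (𝟙_ C)).hom ≫ 𝟙 _ =
            (α_ _ _ _).hom ≫ F ◁ (ρ_ F).hom ≫ e.hom
          simp [MonoidalCategory.unitors_equal]
        · change e.hom ▷ F ≫ (λ_ F).hom ≫ 𝟙 _ =
            (α_ _ _ _).hom ≫ F ◁ e.hom ≫ (ρ_ F).hom
          simpa using he
      left_unitality := by
        rintro ⟨(n : Fin 2)⟩
        fin_cases n
        · change (λ_ (𝟙_ C)).hom = 𝟙 (𝟙_ C) ▷ _ ≫ (λ_ _).hom ≫ 𝟙 _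
          simp
        · change (λ_ F).hom = 𝟙 (𝟙_ C) ▷ _ ≫ (λ_ _).hom ≫ 𝟙 _
          simp
      right_unitality := by
        rintro ⟨(n : Fin 2)⟩
        fin_cases n
        · change (ρ_ (𝟙_ C)).hom = _ ◁ 𝟙 (𝟙_ C) ≫ (λ_ _).hom ≫ 𝟙 _
          simp [MonoidalCategory.unitors_equal]
        · change (ρ_ F).hom = _ ◁ 𝟙 (𝟙_ C) ≫ (ρ_ _).hom ≫ 𝟙 _
          simp }
end SqPow
end

section
open CategoryTheory
open scoped Bicategory Pseudofunctor.StrongTrans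
universe w v u w' v' u'

/-! ### The 2-group `Spin₂ ⋊ Bℤ₂^F`

It has two objects `1` and `c`. The morphisms are generated by `ν : 1 ⟶ c`, which generates `Spin₂`, and by
`(-1)^F : 1 ⟶ c`, which squares to one; the two commute. The tensor product is the group law of `ℤ/2` on objects
and adds the labels of morphisms, and all structure isomorphisms are trivial. -/

/-- The objects: `1` and `c` are given by `0` and `1` in `ℤ/2`. -/
structure SpinStat where
  val : ZMod 2

namespace SpinStat

/-- Morphisms `g ⟶ h` are pairs `(k, e)`, standing for `ν ^ k ∘ ((-1)^F) ^ e`, where both `ν` and `(-1)^F`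
change the object. -/
@[ext]
structure Mor (g h : SpinStat) where
  k : ℤ
  e : ZMod 2
  prop : (k : ZMod 2) + e = h.val - g.val

instance : Category SpinStat where
  Hom := Mor
  id g := ⟨0, 0, by simp⟩
  comp f f' := ⟨f.k + f'.k, f.e + f'.e, by
    have h := f.prop
    have h' := f'.prop
    push_cast
    linear_combination h + h'⟩
  id_comp f := by apply Mor.ext <;> simp
  comp_id f := by apply Mor.ext <;> simp
  assoc f f' f'' := by apply Mor.ext <;> simp [add_assoc]

@[ext] theorem hom_ext {g h : SpinStat} {f f' : g ⟶ h} (hk : f.k = f'.k) (he : f.e = f'.e) : f = f' :=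
  Mor.ext hk he
@[simp] theorem id_k (g : SpinStat) : Mor.k (𝟙 g) = 0 := rfl
@[simp] theorem id_e (g : SpinStat) : Mor.e (𝟙 g) = 0 := rfl
@[simp] theorem comp_k {g h l : SpinStat} (f : g ⟶ h) (f' : h ⟶ l) : (f ≫ f').k = f.k + f'.k := rfl
@[simp] theorem comp_e {g h l : SpinStat} (f : g ⟶ h) (f' : h ⟶ l) : (f ≫ f').e = f.e + f'.e := rfl

/-- The isomorphism `(0, 0)` between equal objects. -/
def isoZero {g h : SpinStat} (e : g.val = h.val) : g ≅ h where
  hom := ⟨0, 0, by simp [e]⟩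
  inv := ⟨0, 0, by simp [e]⟩
  hom_inv_id := by ext <;> rfl
  inv_hom_id := by ext <;> rfl

instance : MonoidalCategory SpinStat where
  tensorObj g h := ⟨g.val + h.val⟩
  tensorUnit := ⟨0⟩
  whiskerLeft g _ _ f := ⟨f.k, f.e, by rw [f.prop]; ring⟩
  whiskerRight f g := ⟨f.k, f.e, by rw [f.prop]; ring⟩
  tensorHom f f' := ⟨f.k + f'.k, f.e + f'.e, by
    have h := f.prop
    have h' := f'.prop
    push_cast
    linear_combination h + h'⟩
  associator g h l := isoZero (add_assoc _ _ _)
  leftUnitor g := isoZero (zero_add _)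
  rightUnitor g := isoZero (add_zero _)
  tensorHom_def f f' := rfl
  id_tensorHom_id f f' := by apply hom_ext <;> simp
  tensorHom_comp_tensorHom f f' g g' := by
    apply hom_ext <;> (simp; abel)
  whiskerLeft_id f f' := rfl
  id_whiskerRight f f' := rfl
  associator_naturality f f' g := by apply hom_ext <;> simp [isoZero, add_assoc]
  leftUnitor_naturality f := by apply hom_ext <;> simp [isoZero]
  rightUnitor_naturality f := by apply hom_ext <;> simp [isoZero]
  pentagon f f' g h := rfl
  triangle f g := rfl

/-- The group `ℤ × ℤ/2` of labels of morphisms, as a discrete monoidal category. An action on a bicategory in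
which all objects of the 2-group act by the identity functor is given by a monoidal functor from it to the
pseudonatural endotransformations of the identity, with `ν` acting by the image of `(1, 0)` and `(-1)^F` by the
image of `(0, 1)`. -/
abbrev Lab := Discrete ℤ × Discrete (ZMod 2)

/-- The label of a morphism. -/
def lab {g h : SpinStat} (f : g ⟶ h) : Lab := (⟨f.k⟩, ⟨f.e⟩)

end SpinStat

namespace SpinStat
open MonoidalCategory

section action
variable {𝓑 : Type u} [Bicategory.{w, v} 𝓑] (T : Lab ⥤ NatEnd 𝓑) [T.Monoidal]

/-- The pseudonatural transformation by which a morphism of the 2-group acts. -/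
def act {g h : SpinStat} (γ : g ⟶ h) : NatEnd 𝓑 := T.obj (lab γ)

/-- Morphisms labelled by `(0, 0)` act trivially. -/
def actZero {g h : SpinStat} (γ : g ⟶ h) (e : lab γ = 𝟙_ Lab) :
    act T γ ≅ 𝟙 (Pseudofunctor.id 𝓑) :=
  T.mapIso (eqToIso e) ≪≫ (Functor.Monoidal.εIso T).symm

/-- Composition of morphisms acts by composition. -/
def actComp {g h l : SpinStat} (γ : g ⟶ h) (γ' : h ⟶ l) :
    act T γ ≫ act T γ' ≅ act T (γ ≫ γ') :=
  Functor.Monoidal.μIso T (lab γ) (lab γ')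

end action
end SpinStat

namespace NatEnd
variable {𝓑 : Type u} [Bicategory.{w, v} 𝓑]
/-- The components of an isomorphism. -/
def isoAp {σ τ : NatEnd 𝓑} (Γ : σ ≅ τ) (a : 𝓑) : σ.ap a ≅ τ.ap a where
  hom := mo Γ.hom a
  inv := mo Γ.inv a
  hom_inv_id := by rw [← mo_comp, Γ.hom_inv_id, mo_id]
  inv_hom_id := by rw [← mo_comp, Γ.inv_hom_id, mo_id]
end NatEnd

open Bicategory

section HFP
variable {𝓑 : Type u} [Bicategory.{w, v} 𝓑]

/-- Homotopy fixed points for an action in which the objects of the 2-group act by the identity functor.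
A fixed point is an object `pt` with 1-isomorphisms `E g : pt ⟶ g · pt = pt`, 2-isomorphisms `φ` and `ι` comparing
them with the tensor product and the unit, and for every morphism `γ : g ⟶ g'` a 2-isomorphism filling the
triangle formed by `E g`, `E g'` and the transformation by which `γ` acts. These are compatible with identities,
composition, the unit, the associator and the tensor product of morphisms. Compatibility with the tensor product is
stated for the two whiskerings, which generate it. -/
structure HFP (T : SpinStat.Lab ⥤ NatEnd 𝓑) [T.Monoidal] where
  pt : 𝓑
  E : SpinStat → (pt ⟶ pt)
  φ : ∀ g' g, E g ≫ E g' ≅ E (MonoidalCategoryStruct.tensorObj g' g)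
  ι : 𝟙 pt ≅ E (MonoidalCategoryStruct.tensorUnit SpinStat)
  F : ∀ {g g'} (γ : g ⟶ g'), E g ≅ (SpinStat.act T γ).ap pt ≫ E g'
  F_id : ∀ g, (F (𝟙 g)).hom = (λ_ (E g)).inv ≫ (NatEnd.isoAp (SpinStat.actZero T (𝟙 g) rfl) pt).inv ▷ E g
  F_comp : ∀ {g g' g''} (γ : g ⟶ g') (γ' : g' ⟶ g''), (F (γ ≫ γ')).hom =
    (F γ).hom ≫ (SpinStat.act T γ).ap pt ◁ (F γ').hom ≫ (α_ _ _ _).inv ≫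
      (NatEnd.isoAp (SpinStat.actComp T γ γ') pt).hom ▷ E g''
  unit_left : ∀ g, E g ◁ ι.hom ≫ (φ _ g).hom ≫ (F (MonoidalCategoryStruct.leftUnitor g).hom).hom ≫
    (NatEnd.isoAp (SpinStat.actZero T _ rfl) pt).hom ▷ E g ≫ (λ_ (E g)).hom = (ρ_ (E g)).hom
  unit_right : ∀ g, ι.hom ▷ E g ≫ (φ g _).hom ≫ (F (MonoidalCategoryStruct.rightUnitor g).hom).hom ≫
    (NatEnd.isoAp (SpinStat.actZero T _ rfl) pt).hom ▷ E g ≫ (λ_ (E g)).hom = (λ_ (E g)).hom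
  assoc : ∀ g'' g' g, E g ◁ (φ g'' g').hom ≫ (φ (MonoidalCategoryStruct.tensorObj g'' g') g).hom =
    (α_ _ _ _).inv ≫ (φ g' g).hom ▷ E g'' ≫ (φ g'' (MonoidalCategoryStruct.tensorObj g' g)).hom ≫
      (F (MonoidalCategoryStruct.associator g'' g' g).inv).hom ≫
      (NatEnd.isoAp (SpinStat.actZero T _ rfl) pt).hom ▷ _ ≫ (λ_ _).hom
  tensor_right : ∀ (g₂ : SpinStat) {g₁ g₁' : SpinStat} (γ : g₁ ⟶ g₁'),
    (φ g₂ g₁).hom ≫ (F (MonoidalCategoryStruct.whiskerLeft g₂ γ)).hom =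
      (F γ).hom ▷ E g₂ ≫ (α_ _ _ _).hom ≫ (SpinStat.act T γ).ap pt ◁ (φ g₂ g₁').hom
  tensor_left : ∀ {g₂ g₂' : SpinStat} (γ : g₂ ⟶ g₂') (g₁ : SpinStat),
    (φ g₂ g₁).hom ≫ (F (MonoidalCategoryStruct.whiskerRight γ g₁)).hom =
      E g₁ ◁ (F γ).hom ≫ (α_ _ _ _).inv ≫ ((SpinStat.act T γ).nat (E g₁)).hom ▷ E g₂' ≫ (α_ _ _ _).hom ≫
        (SpinStat.act T γ).ap pt ◁ (φ g₂' g₁).hom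

namespace HFP
variable {T : SpinStat.Lab ⥤ NatEnd 𝓑} [T.Monoidal]

/-- 1-morphisms of homotopy fixed points: a 1-morphism of the underlying objects with 2-isomorphisms `s g`,
compatible with all the structure. -/
structure Hom (X Y : HFP T) where
  f : X.pt ⟶ Y.pt
  s : ∀ g, X.E g ≫ f ≅ f ≫ Y.E g
  s_unit : X.ι.hom ▷ f ≫ (s _).hom = (λ_ f).hom ≫ (ρ_ f).inv ≫ f ◁ Y.ι.hom
  s_φ : ∀ g' g, (X.φ g' g).hom ▷ f ≫ (s _).hom =
    (α_ _ _ _).hom ≫ X.E g ◁ (s g').hom ≫ (α_ _ _ _).inv ≫ (s g).hom ▷ Y.E g' ≫ (α_ _ _ _).hom ≫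
      f ◁ (Y.φ g' g).hom
  s_F : ∀ {g g'} (γ : g ⟶ g'), (X.F γ).hom ▷ f ≫ (α_ _ _ _).hom ≫ (SpinStat.act T γ).ap X.pt ◁ (s g').hom =
    (s g).hom ≫ f ◁ (Y.F γ).hom ≫ (α_ _ _ _).inv ≫ ((SpinStat.act T γ).nat f).hom ▷ Y.E g' ≫ (α_ _ _ _).hom

/-- 2-morphisms of homotopy fixed points: 2-morphisms that commute with the `s g`. -/
@[ext]
structure Hom₂ {X Y : HFP T} (a b : Hom X Y) where
  m : a.f ⟶ b.f
  comm : ∀ g, X.E g ◁ m ≫ (b.s g).hom = (a.s g).hom ≫ m ▷ Y.E g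

theorem Hom₂.comm_assoc {X Y : HFP T} {a b : Hom X Y} (p : Hom₂ a b) (g : SpinStat) {h : X.pt ⟶ Y.pt}
    (k : b.f ≫ Y.E g ⟶ h) : X.E g ◁ p.m ≫ (b.s g).hom ≫ k = (a.s g).hom ≫ p.m ▷ Y.E g ≫ k := by
  rw [← Category.assoc, p.comm, Category.assoc]

def Hom.id (X : HFP T) : Hom X X where
  f := 𝟙 X.pt
  s g := ρ_ (X.E g) ≪≫ (λ_ (X.E g)).symm
  s_unit := by simp
  s_φ g' g := by
    simp
  s_F {g g'} γ := by
    rw [NatEnd.nat_id]; simp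

def compS {X Y Z : HFP T} (a : Hom X Y) (b : Hom Y Z) (g : SpinStat) :
    X.E g ≫ a.f ≫ b.f ≅ (a.f ≫ b.f) ≫ Z.E g :=
  (α_ _ _ _).symm ≪≫ whiskerRightIso (a.s g) b.f ≪≫ α_ _ _ _ ≪≫ whiskerLeftIso a.f (b.s g) ≪≫
    (α_ _ _ _).symm

theorem compS_hom {X Y Z : HFP T} (a : Hom X Y) (b : Hom Y Z) (g : SpinStat) :
    (compS a b g).hom = (α_ _ _ _).inv ≫ (a.s g).hom ▷ b.f ≫ (α_ _ _ _).hom ≫ a.f ◁ (b.s g).hom ≫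
      (α_ _ _ _).inv := rfl

def Hom.comp {X Y Z : HFP T} (a : Hom X Y) (b : Hom Y Z) : Hom X Z where
  f := a.f ≫ b.f
  s g := compS a b g
  s_unit := by
    rw [compS_hom]
    calc
      _ = 𝟙 _ ⊗≫ (X.ι.hom ▷ a.f ≫ (a.s (MonoidalCategoryStruct.tensorUnit SpinStat)).hom) ▷ b.f ⊗≫ a.f ◁ (b.s (MonoidalCategoryStruct.tensorUnit SpinStat)).hom ⊗≫ 𝟙 _ := by bicategory
      _ = 𝟙 _ ⊗≫ a.f ◁ (Y.ι.hom ▷ b.f ≫ (b.s (MonoidalCategoryStruct.tensorUnit SpinStat)).hom) ⊗≫ 𝟙 _ := by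
        rw [a.s_unit]; bicategory
      _ = _ := by rw [b.s_unit]; bicategory
  s_φ g' g := by
    simp only [compS_hom]
    calc
      _ = 𝟙 _ ⊗≫ ((X.φ g' g).hom ▷ a.f ≫ (a.s (MonoidalCategoryStruct.tensorObj g' g)).hom) ▷ b.f ⊗≫ a.f ◁ (b.s (MonoidalCategoryStruct.tensorObj g' g)).hom ⊗≫ 𝟙 _ := by
        bicategory
      _ = 𝟙 _ ⊗≫ X.E g ◁ (a.s g').hom ▷ b.f ⊗≫ (a.s g).hom ▷ Y.E g' ▷ b.f ⊗≫
          a.f ◁ ((Y.φ g' g).hom ▷ b.f ≫ (b.s (MonoidalCategoryStruct.tensorObj g' g)).hom) ⊗≫ 𝟙 _ := by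
        rw [a.s_φ]; bicategory
      _ = 𝟙 _ ⊗≫ X.E g ◁ (a.s g').hom ▷ b.f ⊗≫
          ((a.s g).hom ▷ (Y.E g' ≫ b.f) ≫ (a.f ≫ Y.E g) ◁ (b.s g').hom) ⊗≫
          a.f ◁ (b.s g).hom ▷ Z.E g' ⊗≫ a.f ◁ b.f ◁ (Z.φ g' g).hom ⊗≫ 𝟙 _ := by
        rw [b.s_φ]; bicategory
      _ = _ := by
        rw [← whisker_exchange]; bicategory
  s_F {g g'} γ := by
    simp only [compS_hom]
    rw [NatEnd.nat_comp]
    calc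
      _ = 𝟙 _ ⊗≫ ((X.F γ).hom ▷ a.f ≫ (α_ _ _ _).hom ≫
            (SpinStat.act T γ).ap X.pt ◁ (a.s g').hom) ▷ b.f ⊗≫
          (SpinStat.act T γ).ap X.pt ◁ a.f ◁ (b.s g').hom ⊗≫ 𝟙 _ := by
        bicategory
      _ = 𝟙 _ ⊗≫ (a.s g).hom ▷ b.f ⊗≫ a.f ◁ (Y.F γ).hom ▷ b.f ⊗≫
          (((SpinStat.act T γ).nat a.f).hom ▷ (Y.E g' ≫ b.f) ≫
            ((SpinStat.act T γ).ap X.pt ≫ a.f) ◁ (b.s g').hom) ⊗≫ 𝟙 _ := by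
        rw [a.s_F]; bicategory
      _ = 𝟙 _ ⊗≫ (a.s g).hom ▷ b.f ⊗≫ a.f ◁ ((Y.F γ).hom ▷ b.f ≫ (α_ _ _ _).hom ≫
            (SpinStat.act T γ).ap Y.pt ◁ (b.s g').hom) ⊗≫
          ((SpinStat.act T γ).nat a.f).hom ▷ (b.f ≫ Z.E g') ⊗≫ 𝟙 _ := by
        rw [← whisker_exchange]; bicategory
      _ = _ := by
        rw [b.s_F]; bicategory

instance (X Y : HFP T) : Category (Hom X Y) where
  Hom := Hom₂
  id a := ⟨𝟙 a.f, fun g => by simp⟩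
  comp p q := ⟨p.m ≫ q.m, fun g => by
    rw [whiskerLeft_comp, Category.assoc, q.comm, p.comm_assoc, comp_whiskerRight]⟩
  id_comp _ := by ext; simp
  comp_id _ := by ext; simp
  assoc _ _ _ := by ext; simp

@[ext] theorem hom₂_ext {X Y : HFP T} {a b : Hom X Y} {p q : a ⟶ b} (h : p.m = q.m) : p = q := Hom₂.ext h
@[simp] theorem comp_m {X Y : HFP T} {a b c : Hom X Y} (p : a ⟶ b) (q : b ⟶ c) : (p ≫ q).m = p.m ≫ q.m := rfl
@[simp] theorem id_m {X Y : HFP T} (a : Hom X Y) : Hom₂.m (𝟙 a) = 𝟙 a.f := rfl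

def isoMk {X Y : HFP T} {a b : Hom X Y} (e : a.f ≅ b.f)
    (h : ∀ g, X.E g ◁ e.hom ≫ (b.s g).hom = (a.s g).hom ≫ e.hom ▷ Y.E g) : a ≅ b where
  hom := ⟨e.hom, h⟩
  inv := ⟨e.inv, fun g => by
    rw [← cancel_epi (X.E g ◁ e.hom), ← cancel_mono (e.hom ▷ Y.E g)]
    simp [h]⟩
  hom_inv_id := by ext; simp
  inv_hom_id := by ext; simp

@[simp] theorem isoMk_hom_m {X Y : HFP T} {a b : Hom X Y} (e : a.f ≅ b.f) (h) : (isoMk e h).hom.m = e.hom := rfl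
@[simp] theorem isoMk_inv_m {X Y : HFP T} {a b : Hom X Y} (e : a.f ≅ b.f) (h) : (isoMk e h).inv.m = e.inv := rfl

@[simp] theorem comp_f {X Y Z : HFP T} (a : Hom X Y) (b : Hom Y Z) : (a.comp b).f = a.f ≫ b.f := rfl
@[simp] theorem comp_s {X Y Z : HFP T} (a : Hom X Y) (b : Hom Y Z) (g : SpinStat) :
    ((a.comp b).s g).hom = (α_ _ _ _).inv ≫ (a.s g).hom ▷ b.f ≫ (α_ _ _ _).hom ≫
      a.f ◁ (b.s g).hom ≫ (α_ _ _ _).inv := rfl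
@[simp] theorem id_f (X : HFP T) : (Hom.id X).f = 𝟙 X.pt := rfl
@[simp] theorem id_s (X : HFP T) (g : SpinStat) :
    ((Hom.id X).s g).hom = (ρ_ (X.E g)).hom ≫ (λ_ (X.E g)).inv := rfl

def wl {X Y Z : HFP T} (a : Hom X Y) {b b' : Hom Y Z} (p : b ⟶ b') : a.comp b ⟶ a.comp b' where
  m := a.f ◁ p.m
  comm g := by
    have h := p.comm g
    change X.E g ◁ (a.f ◁ p.m) ≫ (compS a b' g).hom = (compS a b g).hom ≫ (a.f ◁ p.m) ▷ Z.E g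
    rw [compS_hom, compS_hom]
    calc
      _ = 𝟙 _ ⊗≫ ((X.E g ≫ a.f) ◁ p.m ≫ (a.s g).hom ▷ b'.f) ⊗≫ a.f ◁ (b'.s g).hom ⊗≫ 𝟙 _ := by
        bicategory
      _ = 𝟙 _ ⊗≫ (a.s g).hom ▷ b.f ⊗≫ a.f ◁ (Y.E g ◁ p.m ≫ (b'.s g).hom) ⊗≫ 𝟙 _ := by
        rw [whisker_exchange]; bicategory
      _ = _ := by
        rw [h]; bicategory

def wr {X Y Z : HFP T} {a a' : Hom X Y} (p : a ⟶ a') (b : Hom Y Z) : a.comp b ⟶ a'.comp b where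
  m := p.m ▷ b.f
  comm g := by
    have h := p.comm g
    change X.E g ◁ (p.m ▷ b.f) ≫ (compS a' b g).hom = (compS a b g).hom ≫ (p.m ▷ b.f) ▷ Z.E g
    rw [compS_hom, compS_hom]
    calc
      _ = 𝟙 _ ⊗≫ (X.E g ◁ p.m ≫ (a'.s g).hom) ▷ b.f ⊗≫ a'.f ◁ (b.s g).hom ⊗≫ 𝟙 _ := by
        bicategory
      _ = 𝟙 _ ⊗≫ (a.s g).hom ▷ b.f ⊗≫ (p.m ▷ (Y.E g ≫ b.f) ≫ a'.f ◁ (b.s g).hom) ⊗≫ 𝟙 _ := by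
        rw [h]; bicategory
      _ = _ := by
        rw [← whisker_exchange]; bicategory

@[simp] theorem wl_m {X Y Z : HFP T} (a : Hom X Y) {b b' : Hom Y Z} (p : b ⟶ b') :
    (wl a p).m = a.f ◁ p.m := rfl
@[simp] theorem wr_m {X Y Z : HFP T} {a a' : Hom X Y} (p : a ⟶ a') (b : Hom Y Z) :
    (wr p b).m = p.m ▷ b.f := rfl

def as {W X Y Z : HFP T} (a : Hom W X) (b : Hom X Y) (c : Hom Y Z) :
    (a.comp b).comp c ≅ a.comp (b.comp c) :=
  isoMk (α_ a.f b.f c.f) fun g => by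
    simp only [comp_s]
    simp
def lu {X Y : HFP T} (a : Hom X Y) : (Hom.id X).comp a ≅ a :=
  isoMk (λ_ a.f) fun g => by simp
def ru {X Y : HFP T} (a : Hom X Y) : a.comp (Hom.id Y) ≅ a :=
  isoMk (ρ_ a.f) fun g => by simp

@[simp] theorem as_hom {W X Y Z : HFP T} (a : Hom W X) (b : Hom X Y) (c : Hom Y Z) :
  (as a b c).hom.m = (α_ a.f b.f c.f).hom := rfl
@[simp] theorem as_inv {W X Y Z : HFP T} (a : Hom W X) (b : Hom X Y) (c : Hom Y Z) :
  (as a b c).inv.m = (α_ a.f b.f c.f).inv := rfl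
@[simp] theorem lu_hom {X Y : HFP T} (a : Hom X Y) : (lu a).hom.m = (λ_ a.f).hom := rfl
@[simp] theorem lu_inv {X Y : HFP T} (a : Hom X Y) : (lu a).inv.m = (λ_ a.f).inv := rfl
@[simp] theorem ru_hom {X Y : HFP T} (a : Hom X Y) : (ru a).hom.m = (ρ_ a.f).hom := rfl
@[simp] theorem ru_inv {X Y : HFP T} (a : Hom X Y) : (ru a).inv.m = (ρ_ a.f).inv := rfl

instance : Bicategory (HFP T) where
  Hom := Hom
  id := Hom.id
  comp := Hom.comp
  whiskerLeft a _ _ p := wl a p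
  whiskerRight p a := wr p a
  associator a b c := as a b c
  leftUnitor a := lu a
  rightUnitor a := ru a
  whiskerLeft_id _ _ := by apply hom₂_ext; simp
  whiskerLeft_comp _ _ _ _ _ _ := by apply hom₂_ext; simp
  id_whiskerLeft _ := by apply hom₂_ext; simp
  comp_whiskerLeft _ _ _ _ _ := by apply hom₂_ext; simp
  id_whiskerRight _ _ := by apply hom₂_ext; simp
  comp_whiskerRight _ _ _ := by apply hom₂_ext; simp
  whiskerRight_id _ := by apply hom₂_ext; simp
  whiskerRight_comp _ _ _ := by apply hom₂_ext; simp
  whisker_assoc _ _ _ _ _ := by apply hom₂_ext; simp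
  whisker_exchange _ _ := by apply hom₂_ext; simp [whisker_exchange]
  pentagon _ _ _ _ := by apply hom₂_ext; simp
  triangle _ _ := by apply hom₂_ext; simp

end HFP
end HFP
end

section
open CategoryTheory
open scoped Bicategory Pseudofunctor.StrongTrans
open Bicategory
universe w v u w' v' u'

/-- Equivalence of bicategories: a pseudofunctor that is an equivalence on Hom-categories and
essentially surjective on objects up to equivalence. -/
def BicategoriesEquivalent (𝓑 : Type u) [Bicategory.{w, v} 𝓑] (𝓒 : Type u') [Bicategory.{w', v'} 𝓒] : Prop :=
  ∃ F : Pseudofunctor 𝓑 𝓒, (∀ a b : 𝓑, (F.mapFunctor a b).IsEquivalence) ∧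
    ∀ c : 𝓒, ∃ a : 𝓑, Nonempty (Bicategory.Equivalence (F.obj a) c)

/-- Invertible 1-morphisms of a bicategory. -/
def IsInvertible {𝓑 : Type u} [Bicategory.{w, v} 𝓑] {a b : 𝓑} (f : a ⟶ b) : Prop :=
  ∃ g : b ⟶ a, Nonempty (f ≫ g ≅ 𝟙 a) ∧ Nonempty (g ≫ f ≅ 𝟙 b)

theorem IsInvertible.id {𝓑 : Type u} [Bicategory.{w, v} 𝓑] (a : 𝓑) : IsInvertible (𝟙 a) :=
  ⟨𝟙 a, ⟨λ_ _⟩, ⟨λ_ _⟩⟩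

theorem IsInvertible.comp {𝓑 : Type u} [Bicategory.{w, v} 𝓑] {a b c : 𝓑} {f : a ⟶ b} {g : b ⟶ c}
    (hf : IsInvertible f) (hg : IsInvertible g) : IsInvertible (f ≫ g) := by
  obtain ⟨f', ⟨i⟩, ⟨j⟩⟩ := hf
  obtain ⟨g', ⟨k⟩, ⟨l⟩⟩ := hg
  refine ⟨g' ≫ f', ⟨?_⟩, ⟨?_⟩⟩
  · exact α_ _ _ _ ≪≫ whiskerLeftIso f ((α_ _ _ _).symm ≪≫ whiskerRightIso k f' ≪≫ λ_ _) ≪≫ i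
  · exact α_ _ _ _ ≪≫ whiskerLeftIso g' ((α_ _ _ _).symm ≪≫ whiskerRightIso j g ≪≫ λ_ _) ≪≫ l

/-- The locally full sub-bicategory with given objects and given 1-morphisms. -/
structure SubBicat {𝓑 : Type u} [Bicategory.{w, v} 𝓑] {X : Type u'} (F : X → 𝓑)
    (_Q : ∀ x y, (F x ⟶ F y) → Prop) : Type u' where
  obj : X

namespace SubBicat
variable {𝓑 : Type u} [Bicategory.{w, v} 𝓑] {X : Type u'} (F : X → 𝓑) (Q : ∀ x y, (F x ⟶ F y) → Prop)

/-- The 1-morphisms are closed under composition and contain the identities. -/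
class Closed : Prop where
  id_mem : ∀ x, Q x x (𝟙 (F x))
  comp_mem : ∀ x y z (f : F x ⟶ F y) (g : F y ⟶ F z), Q x y f → Q y z g → Q x z (f ≫ g)

variable {F Q}
structure Hom (a b : SubBicat F Q) where
  f : F a.obj ⟶ F b.obj
  mem : Q _ _ f

@[ext]
structure Hom₂ {a b : SubBicat F Q} (f g : Hom a b) where
  m : f.f ⟶ g.f

instance {a b : SubBicat F Q} : Category (Hom a b) where
  Hom := Hom₂
  id f := ⟨𝟙 f.f⟩
  comp p q := ⟨p.m ≫ q.m⟩
  id_comp _ := by ext; simp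
  comp_id _ := by ext; simp
  assoc _ _ _ := by ext; simp

section
variable {a b : SubBicat F Q} {f g h : Hom a b}
@[ext] theorem hom₂_ext {p q : f ⟶ g} (h : p.m = q.m) : p = q := Hom₂.ext h
@[simp] theorem comp_m (p : f ⟶ g) (q : g ⟶ h) : (p ≫ q).m = p.m ≫ q.m := rfl
@[simp] theorem id_m (f : Hom a b) : Hom₂.m (𝟙 f) = 𝟙 f.f := rfl

def isoMk (e : f.f ≅ g.f) : f ≅ g where
  hom := ⟨e.hom⟩
  inv := ⟨e.inv⟩
  hom_inv_id := by ext; simp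
  inv_hom_id := by ext; simp

@[simp] theorem isoMk_hom_m (e : f.f ≅ g.f) : (isoMk e).hom.m = e.hom := rfl
@[simp] theorem isoMk_inv_m (e : f.f ≅ g.f) : (isoMk e).inv.m = e.inv := rfl
end

variable [Closed F Q]

def Hom.id (a : SubBicat F Q) : Hom a a := ⟨𝟙 _, Closed.id_mem _⟩
def Hom.comp {a b c : SubBicat F Q} (f : Hom a b) (g : Hom b c) : Hom a c :=
  ⟨f.f ≫ g.f, Closed.comp_mem _ _ _ _ _ f.mem g.mem⟩

@[simp] theorem id_f (a : SubBicat F Q) : (Hom.id a).f = 𝟙 (F a.obj) := rfl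
@[simp] theorem comp_f {a b c : SubBicat F Q} (f : Hom a b) (g : Hom b c) :
    (f.comp g).f = f.f ≫ g.f := rfl

def wl {a b c : SubBicat F Q} (f : Hom a b) {g g' : Hom b c} (p : g ⟶ g') :
    f.comp g ⟶ f.comp g' := ⟨f.f ◁ p.m⟩
def wr {a b c : SubBicat F Q} {f f' : Hom a b} (p : f ⟶ f') (g : Hom b c) :
    f.comp g ⟶ f'.comp g := ⟨p.m ▷ g.f⟩
@[simp] theorem wl_m {a b c : SubBicat F Q} (f : Hom a b) {g g' : Hom b c} (p : g ⟶ g') :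
    (wl f p).m = f.f ◁ p.m := rfl
@[simp] theorem wr_m {a b c : SubBicat F Q} {f f' : Hom a b} (p : f ⟶ f') (g : Hom b c) :
    (wr p g).m = p.m ▷ g.f := rfl

def as {a b c d : SubBicat F Q} (f : Hom a b) (g : Hom b c) (h : Hom c d) :
    (f.comp g).comp h ≅ f.comp (g.comp h) := isoMk (α_ f.f g.f h.f)
def lu {a b : SubBicat F Q} (f : Hom a b) : (Hom.id a).comp f ≅ f := isoMk (λ_ f.f)
def ru {a b : SubBicat F Q} (f : Hom a b) : f.comp (Hom.id b) ≅ f := isoMk (ρ_ f.f)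

section
variable {a b c d : SubBicat F Q} (f : Hom a b) (g : Hom b c) (h : Hom c d)
@[simp] theorem as_hom : (as f g h).hom.m = (α_ f.f g.f h.f).hom := rfl
@[simp] theorem as_inv : (as f g h).inv.m = (α_ f.f g.f h.f).inv := rfl
@[simp] theorem lu_hom : (lu f).hom.m = (λ_ f.f).hom := rfl
@[simp] theorem lu_inv : (lu f).inv.m = (λ_ f.f).inv := rfl
@[simp] theorem ru_hom : (ru f).hom.m = (ρ_ f.f).hom := rfl
@[simp] theorem ru_inv : (ru f).inv.m = (ρ_ f.f).inv := rfl
end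

instance : Bicategory (SubBicat F Q) where
  Hom := Hom
  id := Hom.id
  comp := Hom.comp
  whiskerLeft f _ _ p := wl f p
  whiskerRight p f := wr p f
  associator f g h := as f g h
  leftUnitor f := lu f
  rightUnitor f := ru f
  whiskerLeft_id _ _ := by apply hom₂_ext; simp
  whiskerLeft_comp _ _ _ _ _ _ := by apply hom₂_ext; simp
  id_whiskerLeft _ := by apply hom₂_ext; simp
  comp_whiskerLeft _ _ _ _ _ := by apply hom₂_ext; simp
  id_whiskerRight _ _ := by apply hom₂_ext; simp
  comp_whiskerRight _ _ _ := by apply hom₂_ext; simp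
  whiskerRight_id _ := by apply hom₂_ext; simp
  whiskerRight_comp _ _ _ := by apply hom₂_ext; simp
  whisker_assoc _ _ _ _ _ := by apply hom₂_ext; simp
  whisker_exchange _ _ := by apply hom₂_ext; simp [whisker_exchange]
  pentagon _ _ _ _ := by apply hom₂_ext; simp
  triangle _ _ := by apply hom₂_ext; simp

instance [IsLocallyGroupoid 𝓑] : IsLocallyGroupoid (SubBicat F Q) := fun a b =>
  ⟨fun {f g} p => by
    have : p = (isoMk (asIso p.m)).hom := rfl
    rw [this]; infer_instance⟩

end SubBicat

/-! ### The bicategory `sAlg^fd` -/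

/-- Finite-dimensional semisimple superalgebras. -/
structure FdSuperAlg where
  alg : SuperAlg.{u}
  finite : FiniteDimensional ℂ alg
  semisimple : IsSemisimpleRing alg

namespace SAlgFd
abbrev F (A : FdSuperAlg.{u}) : Pith SuperAlg.{u} := ⟨A.alg⟩
abbrev Q (A B : FdSuperAlg.{u}) (M : F A ⟶ F B) : Prop := IsInvertible M.of
instance : SubBicat.Closed F Q where
  id_mem _ := IsInvertible.id _
  comp_mem _ _ _ _ _ := IsInvertible.comp
end SAlgFd

/-- Finite-dimensional semisimple superalgebras, invertible bimodules and isomorphisms of bimodules. -/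
abbrev SAlgFd := SubBicat SAlgFd.F.{u} SAlgFd.Q.{u}

namespace SAlgFd
/-- The bimodule underlying a 1-morphism. -/
abbrev bim {A B : SAlgFd.{u}} (M : A ⟶ B) : SBimod B.obj.alg A.obj.alg := M.f.of

def mkHom {A B : SAlgFd.{u}} (M : SBimod B.obj.alg A.obj.alg)
    (h : IsInvertible (𝓑 := SuperAlg) (a := A.obj.alg) (b := B.obj.alg) M) : A ⟶ B := ⟨⟨M⟩, h⟩

def mkIso {A B : SAlgFd.{u}} {M N : A ⟶ B} (e : bim M ≅ bim N) : M ≅ N :=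
  SubBicat.isoMk ⟨⟨e⟩, ⟨e.symm⟩, by ext; simp, by ext; simp⟩
end SAlgFd
end

section
open CategoryTheory
open scoped Bicategory Pseudofunctor.StrongTrans
open Bicategory
universe w v u w' v' u'

namespace SBimod
variable {A B C : SuperAlg.{u}}

/-! ### The transformation `(-1)^F` -/

/-- `A` with the right action twisted by `(-1)^F`. -/
def twist (A : SuperAlg.{u}) : SBimod A A where
  carrier := A
  l := LinearMap.mul ℂ A
  r := (LinearMap.mul ℂ A).flip ∘ₗ A.par.toLinearMap
  par := A.par.toLinearMap
  l_one := by simp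
  l_mul := by simp [mul_assoc]
  r_one := by simp
  r_mul := by simp [mul_assoc]
  l_r := by simp [mul_assoc]
  par_par := by simp
  par_l := by simp
  par_r := by simp

/-- The identification of `A` with its twist. -/
def toTwist (A : SuperAlg.{u}) : A ≃ₗ[ℂ] twist A := LinearEquiv.refl ℂ A

@[simp] theorem twist_l (a b : A) : (twist A).l a (toTwist A b) = toTwist A (a * b) := rfl
@[simp] theorem twist_r (a b : A) : (twist A).r a (toTwist A b) = toTwist A (b * A.par a) := rfl
@[simp] theorem twist_par (a : A) : (twist A).par (toTwist A a) = toTwist A (A.par a) := rfl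

theorem toTwist_ind {p : twist A → Prop} (h : ∀ a : A, p (toTwist A a)) (x : twist A) : p x := h x

/-- The naturality of `(-1)^F`: `b F ⊗ m ↦ (-1)^{|m|} b m ⊗ F`. -/
def twistNatHom (M : SBimod B A) : comp (twist B) M ⟶ comp M (twist A) :=
  homLift (LinearMap.mk₂ ℂ (fun x m => t M (twist A) (M.l ((toTwist B).symm x) (M.par m)) (toTwist A 1))
      (by simp) (by simp) (by simp) (by simp))
    (fun x b m => by
      induction x using toTwist_ind; simp [M.l_mul])
    (fun b x m => by
      induction x using toTwist_ind; simp [M.l_mul])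
    (fun a x m => by
      induction x using toTwist_ind; simp [M.l_r, t_bal])
    (fun x m => by
      induction x using toTwist_ind; simp)

def twistNatInv (M : SBimod B A) : comp M (twist A) ⟶ comp (twist B) M :=
  homLift (LinearMap.mk₂ ℂ (fun m x => t (twist B) M (toTwist B 1) (M.par (M.r ((toTwist A).symm x) m)))
      (by simp) (by simp) (by simp) (by simp))
    (fun m a x => by
      induction x using toTwist_ind; simp [M.r_mul])
    (fun b m x => by
      induction x using toTwist_ind; simp [← M.l_r, ← t_bal])
    (fun a m x => by
      induction x using toTwist_ind; simp [M.r_mul])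
    (fun m x => by
      induction x using toTwist_ind; simp)

@[simp] theorem twistNatHom_t (M : SBimod B A) (b : B) (m : M) :
    (twistNatHom M).map (t _ M (toTwist B b) m) = t M (twist A) (M.l b (M.par m)) (toTwist A 1) := by
  simp [twistNatHom]
@[simp] theorem twistNatInv_t (M : SBimod B A) (a : A) (m : M) :
    (twistNatInv M).map (t M _ m (toTwist A a)) = t (twist B) M (toTwist B 1) (M.par (M.r a m)) := by
  simp [twistNatInv]

def twistNat (M : SBimod B A) : comp (twist B) M ≅ comp M (twist A) where
  hom := twistNatHom M
  inv := twistNatInv M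
  hom_inv_id := comp_hom_ext fun x m => by
    induction x using toTwist_ind; simp [← t_bal]
  inv_hom_id := comp_hom_ext fun m x => by
    induction x using toTwist_ind; simp [t_bal]

theorem t_twist {N : SBimod B A} (n : N) (a : A) :
    t N (twist A) n (toTwist A a) = t N (twist A) (N.r a n) (toTwist A 1) := by
  simp [t_bal]

def twistSqHom (A : SuperAlg.{u}) : comp (twist A) (twist A) ⟶ reg A :=
  homLift (LinearMap.mk₂ ℂ (fun x y => toReg A ((toTwist A).symm x * A.par ((toTwist A).symm y)))
      (by simp [add_mul]) (by simp) (by simp [mul_add]) (by simp))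
    (fun x a y => by
      induction x using toTwist_ind; induction y using toTwist_ind; simp [mul_assoc])
    (fun a x y => by
      induction x using toTwist_ind; induction y using toTwist_ind; simp [mul_assoc])
    (fun a x y => by
      induction x using toTwist_ind; induction y using toTwist_ind; simp [mul_assoc])
    (fun x y => by
      induction x using toTwist_ind; induction y using toTwist_ind; simp)

@[simp] theorem twistSqHom_t (a b : A) :
    (twistSqHom A).map (t _ _ (toTwist A a) (toTwist A b)) = toReg A (a * A.par b) := by
  simp [twistSqHom]

/-- `x F ⊗ y F ↦ (-1)^{|y|} x y`. -/
def twistSq (A : SuperAlg.{u}) : comp (twist A) (twist A) ≅ reg A where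
  hom := twistSqHom A
  inv :=
    { map := (t (twist A) (twist A)).flip (toTwist A 1) ∘ₗ (toTwist A).toLinearMap ∘ₗ (toReg A).symm.toLinearMap
      map_l := fun a x => by
        obtain ⟨x, rfl⟩ := (toReg A).surjective x; simp
      map_r := fun a x => by
        obtain ⟨x, rfl⟩ := (toReg A).surjective x
        simp [t_twist _ (A.par a)]
      map_par := fun x => by
        obtain ⟨x, rfl⟩ := (toReg A).surjective x; simp }
  hom_inv_id := comp_hom_ext fun x y => by
    induction x using toTwist_ind; induction y using toTwist_ind
    rw [t_twist]; simp
  inv_hom_id := by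
    ext x
    obtain ⟨x, rfl⟩ := (toReg A).surjective x; simp

theorem twistNat_nat {M N : SBimod B A} (p : M ⟶ N) :
    homMap (𝟙 (twist B)) p ≫ (twistNat N).hom = (twistNat M).hom ≫ homMap p (𝟙 _) := by
  apply comp_hom_ext
  intro x m
  induction x using toTwist_ind
  simp [twistNat]

theorem twistNat_id (A : SuperAlg.{u}) :
    (twistNat (reg A)).hom = (unitR (twist A)).hom ≫ (unitL (twist A)).inv := by
  apply comp_hom_ext
  intro x m
  induction x using toTwist_ind with | h x
  obtain ⟨m, rfl⟩ := (toReg A).surjective m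
  have h := t_twist (toReg A 1) (x * A.par m)
  simp [twistNat] at h ⊢
  exact h.symm

theorem twistNat_comp (N : SBimod C B) (M : SBimod B A) : (twistNat (comp N M)).hom =
    (assoc (twist C) N M).hom ≫ homMap (twistNat N).hom (𝟙 M) ≫ (assoc N (twist B) M).inv ≫
      homMap (𝟙 N) (twistNat M).hom ≫ (assoc N M (twist A)).hom := by
  apply comp_hom_ext
  intro x m
  induction x using toTwist_ind
  induction m using ind with
  | h0 => simp
  | ha x y hx hy => simp only [map_add, hx, hy]
  | ht n m => simp [twistNat]

theorem twistSq_nat (M : SBimod B A) :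
    homMap (twistSq B).hom (𝟙 M) ≫ (unitL M).hom ≫ (unitR M).inv =
    (assoc (twist B) (twist B) M).inv ≫ homMap (𝟙 (twist B)) (twistNat M).hom ≫
      (assoc (twist B) M (twist A)).hom ≫ homMap (twistNat M).hom (𝟙 _) ≫
      (assoc M (twist A) (twist A)).inv ≫ homMap (𝟙 M) (twistSq A).hom := by
  apply comp_hom_ext
  intro x m
  induction x using ind with
  | h0 => simp
  | ha x y hx hy => simp only [map_add, LinearMap.add_apply, hx, hy]
  | ht x y =>
    induction x using toTwist_ind
    induction y using toTwist_ind
    simp [twistNat, twistSq, M.l_mul]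

theorem twistSq_twist (A : SuperAlg.{u}) :
    homMap (𝟙 (twist A)) (twistSq A).hom ≫ (unitR (twist A)).hom =
    (assoc (twist A) (twist A) (twist A)).hom ≫ homMap (twistSq A).hom (𝟙 (twist A)) ≫
      (unitL (twist A)).hom := by
  apply comp_hom_ext
  intro x y
  induction x using toTwist_ind
  induction y using ind with
  | h0 => simp
  | ha x y hx hy => simp only [map_add, hx, hy]
  | ht y z =>
    induction y using toTwist_ind
    induction z using toTwist_ind
    simp [twistSq, mul_assoc]

end SBimod

namespace SAlgFd
section
variable {A B C D : SAlgFd.{u}} {M N P : A ⟶ B} {M' N' : B ⟶ C} {M'' : C ⟶ D}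

/-- The bimodule map underlying a 2-morphism. -/
def mp (p : M ⟶ N) : bim M ⟶ bim N := p.m.iso.hom

theorem hom₂_ext {p q : M ⟶ N} (h : mp p = mp q) : p = q :=
  SubBicat.hom₂_ext (Pith.hom₂_ext _ h)

@[simp] theorem mp_comp (p : M ⟶ N) (q : N ⟶ P) : mp (p ≫ q) = mp p ≫ mp q := rfl
@[simp] theorem mp_id : mp (𝟙 M) = 𝟙 (bim M) := rfl
@[simp] theorem mp_whiskerLeft (p : M' ⟶ N') : mp (M ◁ p) = SBimod.homMap (mp p) (𝟙 (bim M)) := rfl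
@[simp] theorem mp_whiskerRight (p : M ⟶ N) : mp (p ▷ M') = SBimod.homMap (𝟙 (bim M')) (mp p) := rfl
@[simp] theorem mp_mkIso_hom (e : bim M ≅ bim N) : mp (mkIso e).hom = e.hom := rfl
@[simp] theorem mp_mkIso_inv (e : bim M ≅ bim N) : mp (mkIso e).inv = e.inv := rfl
@[simp] theorem mp_assoc_hom : mp (α_ M M' M'').hom = (SBimod.assoc (bim M'') (bim M') (bim M)).hom := rfl
@[simp] theorem mp_assoc_inv : mp (α_ M M' M'').inv = (SBimod.assoc (bim M'') (bim M') (bim M)).inv := rfl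
@[simp] theorem mp_lu_hom : mp (λ_ M).hom = (SBimod.unitR (bim M)).hom := rfl
@[simp] theorem mp_lu_inv : mp (λ_ M).inv = (SBimod.unitR (bim M)).inv := rfl
@[simp] theorem mp_ru_hom : mp (ρ_ M).hom = (SBimod.unitL (bim M)).hom := rfl
@[simp] theorem mp_ru_inv : mp (ρ_ M).inv = (SBimod.unitL (bim M)).inv := rfl
end

theorem twist_invertible (A : SuperAlg.{u}) :
    IsInvertible (𝓑 := SuperAlg.{u}) (a := A) (b := A) (SBimod.twist A) :=
  ⟨SBimod.twist A, ⟨SBimod.twistSq A⟩, ⟨SBimod.twistSq A⟩⟩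

def twist (A : SAlgFd.{u}) : A ⟶ A := mkHom (SBimod.twist A.obj.alg) (twist_invertible _)

/-- The pseudonatural automorphism `(-1)^F`. -/
def parity : NatEnd SAlgFd.{u} := NatEnd.mk twist
  (fun M => mkIso (SBimod.twistNat (bim M)))
  (fun p => hom₂_ext (SBimod.twistNat_nat (mp p)))
  (fun A => hom₂_ext (SBimod.twistNat_id A.obj.alg))
  (fun M N => hom₂_ext (SBimod.twistNat_comp (bim N) (bim M)))

/-- The modification `(-1)^F ∘ (-1)^F ≅ id`. -/
def paritySq : parity.{u} ≫ parity ≅ 𝟙 (Pseudofunctor.id SAlgFd.{u}) :=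
  NatEnd.isoMk (fun A => mkIso (M := twist A ≫ twist A) (N := 𝟙 A) (SBimod.twistSq A.obj.alg)) fun M => by
    apply hom₂_ext
    exact SBimod.twistSq_nat (bim M)

theorem paritySq_comm : paritySq.{u}.hom ▷ parity ≫ (λ_ parity).hom =
    (α_ parity parity parity).hom ≫ parity ◁ paritySq.hom ≫ (ρ_ parity).hom :=
  NatEnd.hom_ext fun A => hom₂_ext (SBimod.twistSq_twist A.obj.alg)
end SAlgFd
end

section
open CategoryTheory
open scoped Bicategory Pseudofunctor.StrongTrans
open Bicategory
universe w v u w' v' u'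

namespace SBimod
variable {A B C : SuperAlg.{u}}

/-! ### The dual bimodule and the Serre automorphism -/

/-- The bimodule `A^*` of linear functionals, with `(f a)(b) = f (a b)` and `(a f)(b) = (-1)^{|a|} f (b a)`. -/
def dual (A : SuperAlg.{u}) : SBimod A A where
  carrier := A →ₗ[ℂ] ℂ
  l := LinearMap.mk₂ ℂ (fun a f => f ∘ₗ LinearMap.mulRight ℂ (A.par a))
    (by intros; ext; simp [mul_add]) (by intros; ext; simp) (by intros; ext; simp)
    (by intros; ext; simp)
  r := LinearMap.mk₂ ℂ (fun a f => f ∘ₗ LinearMap.mulLeft ℂ a)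
    (by intros; ext; simp [add_mul]) (by intros; ext; simp) (by intros; ext; simp)
    (by intros; ext; simp)
  par := LinearMap.lcomp ℂ ℂ A.par.toLinearMap
  l_one := by intros; ext; simp
  l_mul := by intros; ext; simp [mul_assoc]
  r_one := by intros; ext; simp
  r_mul := by intros; ext; simp [mul_assoc]
  l_r := by intros; ext; simp [mul_assoc]
  par_par := by intros; ext; simp
  par_l := by intros; ext; simp
  par_r := by intros; ext; simp

/-- The identification of the underlying space of `A^*` with the space of functionals. -/
def ev (A : SuperAlg.{u}) : dual A ≃ₗ[ℂ] (A →ₗ[ℂ] ℂ) := LinearEquiv.refl ℂ _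

@[simp] theorem ev_l (a b : A) (f : dual A) : ev A ((dual A).l a f) b = ev A f (b * A.par a) := rfl
@[simp] theorem ev_r (a b : A) (f : dual A) : ev A ((dual A).r a f) b = ev A f (a * b) := rfl
@[simp] theorem ev_par (b : A) (f : dual A) : ev A ((dual A).par f) b = ev A f (A.par b) := rfl
theorem dual_ext {f g : dual A} (h : ∀ b, ev A f b = ev A g b) : f = g :=
  (ev A).injective (LinearMap.ext h)

/-- The bimodule map given by a linear inverse. -/
def invHom {M N : SBimod B A} (f : M ⟶ N) (g : N →ₗ[ℂ] M) (h : ∀ x, g (f.map x) = x)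
    (h' : ∀ x, f.map (g x) = x) : N ⟶ M where
  map := g
  map_l b x := by rw [← h (M.l b (g x)), f.map_l, h']
  map_r b x := by rw [← h (M.r b (g x)), f.map_r, h']
  map_par x := by rw [← h (M.par (g x)), f.map_par, h']

/-- An inverse `N` of the bimodule `M`, with isomorphisms `N ⊗_B M ≅ A` and `M ⊗_A N ≅ B` satisfying
`m (n m') = (m n) m'`. -/
structure Ctx (M : SBimod B A) where
  N : SBimod A B
  hI : comp N M ≅ reg A
  eI : comp M N ≅ reg B
  snake : ∀ m n m', M.r ((toReg A).symm (hI.hom.map (t N M n m'))) m =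
    M.l ((toReg B).symm (eI.hom.map (t M N m n))) m'

namespace Ctx

theorem exists_of {M : SBimod B A} {N : SBimod A B} (i : comp N M ≅ reg A) (j : comp M N ≅ reg B)
    (h : homMap (𝟙 M) i.inv ≫ (assoc M N M).hom ≫ homMap j.hom (𝟙 M) =
      (unitR M).hom ≫ (unitL M).inv) : Nonempty (Ctx M) := by
  refine ⟨⟨N, i, j, fun m n m' => ?_⟩⟩
  have h' := congrArg (fun k => (unitL M).hom.map (Hom.map k (t M (reg A) m (i.hom.map (t N M n m'))))) h
  simpa using h'.symm

theorem exists_of_isInvertible {M : SBimod B A} (h : IsInvertible (𝓑 := SuperAlg.{u}) (a := A) (b := B) M) :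
    Nonempty (Ctx M) := by
  obtain ⟨N, ⟨i⟩, ⟨j⟩⟩ := h
  let e := Bicategory.Equivalence.mkOfAdjointifyCounit i.symm j
  have h : homMap (𝟙 M) (show comp N M ≅ reg A from i).inv ≫ (assoc M N M).hom ≫
      homMap (show comp M N ≅ reg B from e.counit).hom (𝟙 M) = (unitR M).hom ≫ (unitL M).inv := by
    have := e.left_triangle_hom
    simp only [leftZigzag, bicategoricalComp] at this
    simp at this
    exact this
  refine exists_of (show comp N M ≅ reg A from i) (show comp M N ≅ reg B from e.counit) h

variable {M : SBimod B A} (c : Ctx M)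

/-- The contraction `N ⊗_B M ⟶ A`. -/
def eta : c.N →ₗ[ℂ] M →ₗ[ℂ] A :=
  (t c.N M).compr₂ ((toReg A).symm.toLinearMap ∘ₗ c.hI.hom.map)
/-- The contraction `M ⊗_A N ⟶ B`. -/
def eps : M →ₗ[ℂ] c.N →ₗ[ℂ] B :=
  (t M c.N).compr₂ ((toReg B).symm.toLinearMap ∘ₗ c.eI.hom.map)
/-- The element of `M ⊗ N` corresponding to `1`. -/
def u : comp M c.N := c.eI.inv.map (toReg B 1)
def v : comp c.N M := c.hI.inv.map (toReg A 1)
def epsT : comp M c.N →ₗ[ℂ] B := (toReg B).symm.toLinearMap ∘ₗ c.eI.hom.map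
def etaT : comp c.N M →ₗ[ℂ] A := (toReg A).symm.toLinearMap ∘ₗ c.hI.hom.map

@[simp] theorem epsT_t (m : M) (n : c.N) : c.epsT (t M c.N m n) = c.eps m n := rfl
@[simp] theorem etaT_t (m : M) (n : c.N) : c.etaT (t c.N M n m) = c.eta n m := rfl
@[simp] theorem epsT_u : c.epsT c.u = 1 := by simp [epsT, u]
@[simp] theorem etaT_v : c.etaT c.v = 1 := by simp [etaT, v]

theorem regsymm_l (a : A) (x : reg A) : (toReg A).symm ((reg A).l a x) = a * (toReg A).symm x := rfl
theorem regsymm_r (a : A) (x : reg A) : (toReg A).symm ((reg A).r a x) = (toReg A).symm x * a := rfl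
theorem regsymm_par (x : reg A) : (toReg A).symm ((reg A).par x) = A.par ((toReg A).symm x) := rfl

@[simp] theorem eps_l (b : B) (m : M) (n : c.N) : c.eps (M.l b m) n = b * c.eps m n := by
  simp [eps, ← comp_l, regsymm_l]
@[simp] theorem eps_r (b : B) (m : M) (n : c.N) : c.eps m (c.N.r b n) = c.eps m n * b := by
  simp [eps, ← comp_r, regsymm_r]
@[simp] theorem eps_par (m : M) (n : c.N) : c.eps (M.par m) (c.N.par n) = B.par (c.eps m n) := by
  simp [eps, ← comp_par, regsymm_par]
theorem eps_bal (a : A) (m : M) (n : c.N) : c.eps (M.r a m) n = c.eps m (c.N.l a n) := by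
  simp [eps, t_bal]
@[simp] theorem eta_l (a : A) (m : M) (n : c.N) : c.eta (c.N.l a n) m = a * c.eta n m := by
  simp [eta, ← comp_l, regsymm_l]
@[simp] theorem eta_r (a : A) (m : M) (n : c.N) : c.eta n (M.r a m) = c.eta n m * a := by
  simp [eta, ← comp_r, regsymm_r]
@[simp] theorem eta_par (m : M) (n : c.N) : c.eta (c.N.par n) (M.par m) = A.par (c.eta n m) := by
  simp [eta, ← comp_par, regsymm_par]
theorem eta_bal (b : B) (m : M) (n : c.N) : c.eta (c.N.r b n) m = c.eta n (M.l b m) := by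
  simp [eta, t_bal]
theorem snake' (m : M) (n : c.N) (m' : M) : M.r (c.eta n m') m = M.l (c.eps m n) m' := c.snake m n m'

theorem u_comm (b : B) : (comp M c.N).l b c.u = (comp M c.N).r b c.u := by
  rw [u, ← Hom.map_l, ← Hom.map_r]; simp
theorem u_par : (comp M c.N).par c.u = c.u := by
  rw [u, ← Hom.map_par]; simp

/-- `(n f m)(a) = (-1)^{|n|} f (eps (m a ⊗ n))`. This is the sign `(-1)^{|n| (|f| + |m| + |a|)}`, since `f` is
nonzero only on elements of degree `|f|`. -/
def nfm (n : c.N) (f : dual B) (m : M) : dual A :=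
  (ev A).symm (ev B f ∘ₗ c.eps.flip (c.N.par n) ∘ₗ M.r.flip m)

@[simp] theorem ev_nfm (n : c.N) (f : dual B) (m : M) (a : A) :
    ev A (c.nfm n f m) a = ev B f (c.eps (M.r a m) (c.N.par n)) := by simp [nfm]

/-- `x ⊗ n ↦ x ⊗ n f m`. -/
def ζ (f : dual B) (m : M) : comp M c.N →ₗ[ℂ] comp M (dual A) :=
  clift (LinearMap.mk₂ ℂ (fun x n => t M (dual A) x (c.nfm n f m))
    (by simp) (by simp)
    (fun x n n' => by
      have : c.nfm (n + n') f m = c.nfm n f m + c.nfm n' f m := dual_ext fun b => by simp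
      simp [this])
    (fun z x n => by
      have : c.nfm (z • n) f m = z • c.nfm n f m := dual_ext fun b => by simp
      simp [this]))
    (fun x a n => by
      have : c.nfm (c.N.l a n) f m = (dual A).l a (c.nfm n f m) := dual_ext fun b => by
        simp [← eps_bal, M.r_mul]
      simp [this, t_bal])

@[simp] theorem ζ_t (f : dual B) (m x : M) (n : c.N) :
    c.ζ f m (t M c.N x n) = t M (dual A) x (c.nfm n f m) := by simp [ζ]


theorem nfm_add (n : c.N) (f f' : dual B) (m : M) : c.nfm n (f + f') m = c.nfm n f m + c.nfm n f' m :=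
  dual_ext fun a => by simp
theorem nfm_smul (n : c.N) (z : ℂ) (f : dual B) (m : M) : c.nfm n (z • f) m = z • c.nfm n f m :=
  dual_ext fun a => by simp
theorem nfm_add' (n : c.N) (f : dual B) (m m' : M) : c.nfm n f (m + m') = c.nfm n f m + c.nfm n f m' :=
  dual_ext fun a => by simp
theorem nfm_smul' (n : c.N) (z : ℂ) (f : dual B) (m : M) : c.nfm n f (z • m) = z • c.nfm n f m :=
  dual_ext fun a => by simp
theorem nfm_bal (n : c.N) (b : B) (f : dual B) (m : M) :
    c.nfm n ((dual B).r b f) m = c.nfm n f (M.l b m) :=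
  dual_ext fun a => by simp [← M.l_r]
theorem nfm_r (n : c.N) (a : A) (f : dual B) (m : M) :
    c.nfm n f (M.r a m) = (dual A).r a (c.nfm n f m) :=
  dual_ext fun a => by simp [M.r_mul]
theorem nfm_l (n : c.N) (b : B) (f : dual B) (m : M) :
    c.nfm n ((dual B).l b f) m = c.nfm (c.N.r b n) f m :=
  dual_ext fun a => by simp
theorem nfm_par (n : c.N) (f : dual B) (m : M) :
    c.nfm (c.N.par n) ((dual B).par f) (M.par m) = (dual A).par (c.nfm n f m) :=
  dual_ext fun a => by
    have h := c.eps_par (M.r (A.par a) m) (c.N.par n)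
    simp at h
    simp [h]

section
variable (f f' : dual B) (m m' : M) (y : comp M c.N) (z : ℂ)
theorem ζ_add : c.ζ (f + f') m y = c.ζ f m y + c.ζ f' m y := by
  induction y using ind with
  | h0 => simp
  | ha x y hx hy => simp only [map_add, hx, hy]; abel
  | ht x n => simp [nfm_add]
theorem ζ_smul : c.ζ (z • f) m y = z • c.ζ f m y := by
  induction y using ind with
  | h0 => simp
  | ha x y hx hy => simp only [map_add, hx, hy, smul_add]
  | ht x n => simp [nfm_smul]
theorem ζ_add' : c.ζ f (m + m') y = c.ζ f m y + c.ζ f m' y := by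
  induction y using ind with
  | h0 => simp
  | ha x y hx hy => simp only [map_add, hx, hy]; abel
  | ht x n => simp [nfm_add']
theorem ζ_smul' : c.ζ f (z • m) y = z • c.ζ f m y := by
  induction y using ind with
  | h0 => simp
  | ha x y hx hy => simp only [map_add, hx, hy, smul_add]
  | ht x n => simp [nfm_smul']
theorem ζ_bal (b : B) : c.ζ ((dual B).r b f) m y = c.ζ f (M.l b m) y := by
  induction y using ind with
  | h0 => simp
  | ha x y hx hy => simp only [map_add, hx, hy]
  | ht x n => simp [nfm_bal]
theorem ζ_r (a : A) : c.ζ f (M.r a m) y = (comp M (dual A)).r a (c.ζ f m y) := by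
  induction y using ind with
  | h0 => simp
  | ha x y hx hy => simp only [map_add, hx, hy]
  | ht x n => simp [nfm_r]
theorem ζ_l (b : B) : c.ζ ((dual B).l b f) m y = c.ζ f m ((comp M c.N).r b y) := by
  induction y using ind with
  | h0 => simp
  | ha x y hx hy => simp only [map_add, hx, hy]
  | ht x n => simp [nfm_l]
theorem ζ_l' (b : B) : c.ζ f m ((comp M c.N).l b y) = (comp M (dual A)).l b (c.ζ f m y) := by
  induction y using ind with
  | h0 => simp
  | ha x y hx hy => simp only [map_add, hx, hy]
  | ht x n => simp
theorem ζ_par : c.ζ ((dual B).par f) (M.par m) ((comp M c.N).par y) =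
    (comp M (dual A)).par (c.ζ f m y) := by
  induction y using ind with
  | h0 => simp
  | ha x y hx hy => simp only [map_add, hx, hy]
  | ht x n => simp [nfm_par]
end

/-- The map `S_M (f ⊗ m) = ∑ m_j ⊗ n_j f m`, where `∑ m_j ⊗ n_j` is the element of `M ⊗_A N` that the contraction
maps to `1`. -/
def serreHom : comp (dual B) M ⟶ comp M (dual A) :=
  homLift (LinearMap.mk₂ ℂ (fun f m => c.ζ f m c.u) (fun _ _ _ => c.ζ_add ..) (fun _ _ _ => c.ζ_smul ..)
    (fun _ _ _ => c.ζ_add' ..) (fun _ _ _ => c.ζ_smul' ..))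
    (fun f b m => c.ζ_bal f m c.u b)
    (fun b f m => by
      show c.ζ _ m c.u = _
      rw [ζ_l, ← u_comm, ζ_l']; rfl)
    (fun a f m => c.ζ_r f m c.u a)
    (fun f m => by
      have := c.ζ_par f m c.u
      rwa [u_par] at this)

@[simp] theorem serreHom_t (f : dual B) (m : M) : c.serreHom.map (t _ M f m) = c.ζ f m c.u :=
  homLift_t (X := comp M (dual A)) (LinearMap.mk₂ ℂ (fun f m => c.ζ f m c.u) _ _ _ _) _ _ _ _ f m

/-! The inverse. -/

/-- `(x g n)(b) = (-1)^{|x|} g (eta (n ⊗ b x))`. -/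
def xgn (x : M) (g : dual A) (n : c.N) : dual B :=
  (ev B).symm (ev A g ∘ₗ c.eta n ∘ₗ M.l.flip (M.par x))

@[simp] theorem ev_xgn (x : M) (g : dual A) (n : c.N) (b : B) :
    ev B (c.xgn x g n) b = ev A g (c.eta n (M.l b (M.par x))) := by simp [xgn]

def ζ' (x : M) (g : dual A) : comp c.N M →ₗ[ℂ] comp (dual B) M :=
  clift (LinearMap.mk₂ ℂ (fun n m => t (dual B) M (c.xgn x g n) m)
    (fun n n' m => by
      have : c.xgn x g (n + n') = c.xgn x g n + c.xgn x g n' := dual_ext fun b => by simp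
      simp [this])
    (fun z n m => by
      have : c.xgn x g (z • n) = z • c.xgn x g n := dual_ext fun b => by simp
      simp [this])
    (by simp) (by simp))
    (fun n b m => by
      have : c.xgn x g (c.N.r b n) = (dual B).r b (c.xgn x g n) := dual_ext fun b => by
        simp [eta_bal, M.l_mul]
      simp [this, t_bal])

@[simp] theorem ζ'_t (x m : M) (g : dual A) (n : c.N) :
    c.ζ' x g (t c.N M n m) = t (dual B) M (c.xgn x g n) m :=
  clift_t (LinearMap.mk₂ ℂ (fun n m => t (dual B) M (c.xgn x g n) m) _ _ _ _) _ n m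

def serreInv : comp M (dual A) →ₗ[ℂ] comp (dual B) M :=
  clift (LinearMap.mk₂ ℂ (fun x g => c.ζ' x g c.v)
    (fun x x' g => by
      induction c.v using ind with
      | h0 => simp
      | ha x y hx hy => simp only [map_add, hx, hy]; abel
      | ht n m =>
        have : c.xgn (x + x') g n = c.xgn x g n + c.xgn x' g n := dual_ext fun b => by simp
        simp [this])
    (fun z x g => by
      induction c.v using ind with
      | h0 => simp
      | ha x y hx hy => simp only [map_add, hx, hy, smul_add]
      | ht n m =>
        have : c.xgn (z • x) g n = z • c.xgn x g n := dual_ext fun b => by simp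
        simp [this])
    (fun x g g' => by
      induction c.v using ind with
      | h0 => simp
      | ha x y hx hy => simp only [map_add, hx, hy]; abel
      | ht n m =>
        have : c.xgn x (g + g') n = c.xgn x g n + c.xgn x g' n := dual_ext fun b => by simp
        simp [this])
    (fun z x g => by
      induction c.v using ind with
      | h0 => simp
      | ha x y hx hy => simp only [map_add, hx, hy, smul_add]
      | ht n m =>
        have : c.xgn x (z • g) n = z • c.xgn x g n := dual_ext fun b => by simp
        simp [this]))
    (fun x a g => by
      show c.ζ' (M.r a x) g c.v = c.ζ' x ((dual A).l a g) c.v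
      induction c.v using ind with
      | h0 => simp
      | ha x y hx hy => simp only [map_add, hx, hy]
      | ht n m =>
        have : c.xgn (M.r a x) g n = c.xgn x ((dual A).l a g) n := dual_ext fun b => by
          simp [M.l_r]
        simp [this])

@[simp] theorem serreInv_t (x : M) (g : dual A) : c.serreInv (t _ _ x g) = c.ζ' x g c.v := by
  simp [serreInv]

theorem ζ_xgn (x m : M) (g : dual A) (n : c.N) (y : comp M c.N) :
    c.ζ (c.xgn x g n) m y = t M (dual A) (M.l (c.epsT y) x) ((dual A).r (c.eta n m) g) := by
  induction y using ind with
  | h0 => simp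
  | ha x y hx hy => simp only [map_add, hx, hy, LinearMap.add_apply]
  | ht p n' =>
    have : c.nfm n' (c.xgn x g n) m = (dual A).l (c.eta n' x) ((dual A).r (c.eta n m) g) :=
      dual_ext fun a => by
        simp [← snake', mul_assoc]
    rw [ζ_t, this, ← t_bal, snake', epsT_t]

theorem serre_ζ' (x : M) (g : dual A) (y : comp c.N M) :
    c.serreHom.map (c.ζ' x g y) = t M (dual A) x ((dual A).r (c.etaT y) g) := by
  induction y using ind with
  | h0 => simp
  | ha x y hx hy => simp only [map_add, hx, hy, LinearMap.add_apply]
  | ht n m => simp [ζ_xgn]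

theorem ζ'_nfm (f : dual B) (m x : M) (n : c.N) (y : comp c.N M) :
    c.ζ' x (c.nfm n f m) y = (comp (dual B) M).l (c.eps x n) (t _ M f (M.r (c.etaT y) m)) := by
  induction y using ind with
  | h0 => simp
  | ha x y hx hy => simp only [map_add, hx, hy, LinearMap.add_apply]
  | ht n' m' =>
    have : c.xgn x (c.nfm n f m) n' = (dual B).r (c.eps m n') ((dual B).l (c.eps x n) f) :=
      dual_ext fun b => by
        simp [snake', mul_assoc]
    rw [ζ'_t, this, t_bal, ← snake', etaT_t, comp_l]

theorem serreInv_ζ (f : dual B) (m : M) (y : comp M c.N) :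
    c.serreInv (c.ζ f m y) = (comp (dual B) M).l (c.epsT y) (t _ M f m) := by
  induction y using ind with
  | h0 => simp
  | ha x y hx hy => simp only [map_add, hx, hy, LinearMap.add_apply]
  | ht x n => rw [ζ_t, serreInv_t, ζ'_nfm]; simp

def serreIso : comp (dual B) M ≅ comp M (dual A) where
  hom := c.serreHom
  inv := invHom c.serreHom c.serreInv
    (fun x => by
      induction x using ind with
      | h0 => simp
      | ha x y hx hy => simp only [map_add, hx, hy]
      | ht f m => rw [serreHom_t, serreInv_ζ]; simp)
    (fun x => by
      induction x using ind with
      | h0 => simp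
      | ha x y hx hy => simp only [map_add, hx, hy]
      | ht x g => rw [serreInv_t, serre_ζ']; simp)
  hom_inv_id := by
    ext x
    show c.serreInv (c.serreHom.map x) = x
    induction x using ind with
      | h0 => simp
      | ha x y hx hy => simp only [map_add, hx, hy]
      | ht f m => rw [serreHom_t, serreInv_ζ]; simp
  inv_hom_id := by
    ext x
    show c.serreHom.map (c.serreInv x) = x
    induction x using ind with
      | h0 => simp
      | ha x y hx hy => simp only [map_add, hx, hy]
      | ht x g => rw [serreInv_t, serre_ζ']; simp

/-! Coherence. -/

theorem ζ_zero (m : M) (y : comp M c.N) : c.ζ 0 m y = 0 := by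
  simpa using c.ζ_smul 0 m y 0

theorem ζ_nat {M' : SBimod B A} (c' : Ctx M') (φ : M ≅ M') (f : dual B) (m : M) (y : comp M c.N)
    (y' : comp M' c'.N) :
    (homMap φ.hom (𝟙 (dual A))).map (c.ζ f m ((comp M c.N).l (c'.epsT y') y)) =
      c'.ζ ((dual B).l (c.epsT y) f) (φ.hom.map m) y' := by
  induction y using ind with
  | h0 => simp [ζ_zero]
  | ha x y hx hy => simp only [map_add, hx, hy, LinearMap.add_apply, ζ_add]
  | ht x n =>
    induction y' using ind with
    | h0 => simp
    | ha x y hx hy => simp only [map_add, hx, hy, LinearMap.add_apply]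
    | ht x' n' =>
      have : (dual A).l (c'.eta n' (φ.hom.map x)) (c.nfm n f m) =
          c'.nfm n' ((dual B).l (c.eps x n) f) (φ.hom.map m) := dual_ext fun a => by
        have h := congrArg φ.inv.map (c'.snake' (φ.hom.map (M.r a m)) (c'.N.par n') (φ.hom.map (M.par x)))
        rw [← Hom.map_r, ← Hom.map_l] at h
        simp only [hom_inv_map] at h
        rw [ev_l, ev_nfm, ← c'.eta_par, ← Hom.map_par, M.r_mul, h, ev_nfm, ev_l, eps_l, ← c.eps_par,
          Hom.map_r]
      rw [ζ_t, epsT_t, epsT_t, comp_l, ζ_t, homMap_t, Hom.map_l, ← snake', t_bal, id_map, this]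

theorem serre_nat {M' : SBimod B A} (c' : Ctx M') (φ : M ≅ M') :
    homMap (𝟙 (dual B)) φ.hom ≫ c'.serreHom = c.serreHom ≫ homMap φ.hom (𝟙 (dual A)) := by
  apply comp_hom_ext
  intro f m
  have h := c.ζ_nat c' φ f m c.u c'.u
  simp only [epsT_u, l_one] at h
  simp [h]

theorem ζ_reg (c : Ctx (reg A)) (f : dual A) (m : A) (y : comp (reg A) c.N) :
    c.ζ f (toReg A m) y = t (reg A) (dual A) (toReg A 1) ((dual A).l (c.epsT y) ((dual A).r m f)) := by
  induction y using ind with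
  | h0 => simp
  | ha x y hx hy => simp only [map_add, hx, hy, LinearMap.add_apply]
  | ht x n =>
    obtain ⟨x, rfl⟩ := (toReg A).surjective x
    have h : (dual A).l x (c.nfm n f (toReg A m)) =
        (dual A).l (c.eps (toReg A x) n) ((dual A).r m f) := dual_ext fun a => by
      have : toReg A (m * (a * A.par x)) = (reg A).l (m * a) ((reg A).par (toReg A x)) := by
        simp [mul_assoc]
      rw [ev_l, ev_nfm, reg_r, this, eps_l, eps_par, ev_l, ev_r, mul_assoc]
    rw [ζ_t, epsT_t, ← h, ← t_bal]
    simp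

theorem serre_id (c : Ctx (reg A)) :
    c.serreHom = (unitR (dual A)).hom ≫ (unitL (dual A)).inv := by
  apply comp_hom_ext
  intro f m
  obtain ⟨m, rfl⟩ := (toReg A).surjective m
  simp [ζ_reg]

section
variable {N : SBimod C B} (d : Ctx N) (e : Ctx (comp N M))

theorem ζ_comp (f : dual C) (n : N) (m x : M) (x' : N) (k : c.N) (k' : d.N) (y : comp (comp N M) e.N) :
    (comp (comp N M) (dual A)).l (e.epsT y) (t (comp N M) (dual A) (t N M x' x) (c.nfm k (d.nfm k' f n) m)) =
      e.ζ ((dual C).l (d.eps (N.r (c.eps x k) x') k') f) (t N M n m) y := by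
  induction y using ind with
  | h0 => simp
  | ha x y hx hy => simp only [map_add, hx, hy, LinearMap.add_apply]
  | ht q k'' =>
    have h : (dual A).l (e.eta k'' (t N M x' x)) (c.nfm k (d.nfm k' f n) m) =
        e.nfm k'' ((dual C).l (d.eps (N.r (c.eps x k) x') k') f) (t N M n m) := dual_ext fun a => by
      let K : comp N M →ₗ[ℂ] C := clift (LinearMap.mk₂ ℂ
        (fun n m => d.eps (N.r (c.eps m (c.N.par k)) n) (d.N.par k')) (by simp) (by simp) (by simp) (by simp))
        (by intros; simp [N.r_mul])
      have hK : ∀ n m, K (t N M n m) = d.eps (N.r (c.eps m (c.N.par k)) n) (d.N.par k') := fun n m =>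
        clift_t (LinearMap.mk₂ ℂ
          (fun n m => d.eps (N.r (c.eps m (c.N.par k)) n) (d.N.par k')) _ _ _ _) _ n m
      have h := congrArg K (e.snake' (t N M n (M.r a m)) (e.N.par k'') (t N M (N.par x') (M.par x)))
      rw [comp_r, comp_l, hK, hK, ← N.l_r, eps_l] at h
      rw [ev_l, ev_nfm, ev_nfm, ← e.eta_par, comp_par, M.r_mul]
      rw [h, ev_nfm, ev_l, ← d.eps_par, N.par_r, ← c.eps_par, comp_r]
    rw [ζ_t, epsT_t, comp_l, ← snake', t_bal, h]

theorem serre_comp : e.serreHom =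
    (assoc (dual C) N M).hom ≫ homMap d.serreHom (𝟙 M) ≫ (assoc N (dual B) M).inv ≫
      homMap (𝟙 N) c.serreHom ≫ (assoc N M (dual A)).hom := by
  apply comp_hom_ext
  intro f y
  induction y using ind with
  | h0 => simp
  | ha x y hx hy => simp only [map_add, hx, hy]
  | ht n m =>
    have key : ∀ y : comp N d.N, (assoc N M (dual A)).hom.map ((homMap (𝟙 N) c.serreHom).map
        ((assoc N (dual B) M).inv.map (t _ M (d.ζ f n y) m))) =
        e.ζ ((dual C).l (d.epsT y) f) (t N M n m) e.u := fun y => by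
      induction y using ind with
      | h0 => simp [ζ_zero]
      | ha x y hx hy => simp only [map_add, hx, hy, LinearMap.add_apply, ζ_add]
      | ht x' k' =>
        rw [ζ_t, assoc_inv, homMap_t, serreHom_t, epsT_t, id_map]
        have key' : ∀ y : comp M c.N, (assoc N M (dual A)).hom.map
            (t N (comp M (dual A)) x' (c.ζ (d.nfm k' f n) m y)) =
            e.ζ ((dual C).l (d.eps (N.r (c.epsT y) x') k') f) (t N M n m) e.u := fun y => by
          induction y using ind with
          | h0 => simp [ζ_zero]
          | ha x y hx hy => simp only [map_add, hx, hy, LinearMap.add_apply, ζ_add]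
          | ht x k =>
            rw [ζ_t, assoc_hom, epsT_t, ← ζ_comp, epsT_u, l_one]
        simpa using key' c.u
    have := key d.u
    simp at this
    simp [this]
end

end Ctx
end SBimod
end

section
open CategoryTheory
open scoped Bicategory Pseudofunctor.StrongTrans
open Bicategory
universe w v u w' v' u'

theorem IsInvertible.of_iso {𝓑 : Type u} [Bicategory.{w, v} 𝓑] {a b : 𝓑} {f f' : a ⟶ b}
    (hf : IsInvertible f) (e : f ≅ f') : IsInvertible f' := by
  obtain ⟨g, ⟨i⟩, ⟨j⟩⟩ := hf
  exact ⟨g, ⟨whiskerRightIso e.symm g ≪≫ i⟩, ⟨whiskerLeftIso g e.symm ≪≫ j⟩⟩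

namespace SuperAlg

/-- The trace of left multiplication. -/
noncomputable def regTrace (A : SuperAlg.{u}) : A →ₗ[ℂ] ℂ := LinearMap.trace ℂ A ∘ₗ LinearMap.mul ℂ A

theorem regTrace_mul_comm (A : SuperAlg.{u}) (a b : A) : A.regTrace (a * b) = A.regTrace (b * a) := by
  have h : ∀ a b : A, LinearMap.mul ℂ A (a * b) = LinearMap.mul ℂ A a * LinearMap.mul ℂ A b := fun a b => by
    ext x; simp [mul_assoc]
  simp only [regTrace, LinearMap.comp_apply]
  rw [h, h, LinearMap.trace_mul_comm]

def parEquiv (A : SuperAlg.{u}) : A ≃ₗ[ℂ] A :=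
  LinearEquiv.ofLinearMap A.par.toLinearMap A.par.toLinearMap (by ext; simp) (by ext; simp)

theorem regTrace_par (A : SuperAlg.{u}) (a : A) : A.regTrace (A.par a) = A.regTrace a := by
  have h : LinearMap.mul ℂ A (A.par a) = A.parEquiv.conj (LinearMap.mul ℂ A a) := by
    ext x
    simp [LinearEquiv.conj_apply, parEquiv]
  simp only [regTrace, LinearMap.comp_apply]
  rw [h, LinearMap.trace_conj']

theorem regTrace_nondegenerate (A : SuperAlg.{u}) [FiniteDimensional ℂ A] [IsSemisimpleRing A] (a : A)
    (ha : ∀ b, A.regTrace (b * a) = 0) : a = 0 := by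
  let I : Ideal A :=
    { carrier := {a | ∀ b, A.regTrace (b * a) = 0}
      add_mem' := fun hx hy b => by simp [mul_add, hx b, hy b]
      zero_mem' := by simp
      smul_mem' := fun c x hx b => by simpa [mul_assoc] using hx (b * c) }
  obtain ⟨e, he, hI⟩ := IsSemisimpleRing.ideal_eq_span_idempotent I
  have heI : e ∈ I := hI ▸ Ideal.subset_span rfl
  have h1 := heI 1
  rw [one_mul] at h1
  have h2 : IsIdempotentElem (LinearMap.mul ℂ A e) := by
    ext x
    simp [← mul_assoc, he.eq]
  have h3 := LinearMap.IsIdempotentElem.eq_zero_of_trace_eq_zero h2 h1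
  have h4 : e = 0 := by simpa using LinearMap.congr_fun h3 1
  have : a ∈ I := ha
  rw [hI, h4] at this
  simpa using this

end SuperAlg

namespace SBimod

noncomputable def twistToDual (A : SuperAlg.{u}) : twist A ⟶ dual A where
  map := (ev A).symm.toLinearMap ∘ₗ ((LinearMap.mul ℂ A).flip.compr₂ A.regTrace) ∘ₗ A.par.toLinearMap ∘ₗ
    (toTwist A).symm.toLinearMap
  map_l a x := by
    induction x using toTwist_ind
    apply dual_ext; intro b; simp [mul_assoc]
  map_r a x := by
    induction x using toTwist_ind
    apply dual_ext; intro b; simp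
    rw [← mul_assoc, SuperAlg.regTrace_mul_comm, mul_assoc]
  map_par x := by
    induction x using toTwist_ind
    apply dual_ext; intro b; simp
    rw [← SuperAlg.regTrace_par]; simp

theorem twistToDual_injective (A : SuperAlg.{u}) [FiniteDimensional ℂ A] [IsSemisimpleRing A] :
    Function.Injective (twistToDual A).map := by
  rw [injective_iff_map_eq_zero]
  intro x hx
  induction x using toTwist_ind with | h x
  have := A.regTrace_nondegenerate (A.par x) fun b => by
    have := congrArg (fun f => ev A f b) hx
    simpa [twistToDual] using this
  have := congrArg A.par this
  simp at this
  simp [this]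

theorem dual_invertible (A : SuperAlg.{u}) [FiniteDimensional ℂ A] [IsSemisimpleRing A] :
    IsInvertible (𝓑 := SuperAlg.{u}) (a := A) (b := A) (dual A) := by
  have hi := twistToDual_injective A
  have : FiniteDimensional ℂ (twist A) := LinearEquiv.finiteDimensional (toTwist A)
  have : FiniteDimensional ℂ (dual A) := LinearEquiv.finiteDimensional (ev A).symm
  have hd : Module.finrank ℂ (twist A) = Module.finrank ℂ (dual A) := by
    rw [← (toTwist A).finrank_eq, (ev A).finrank_eq]
    exact (Subspace.dual_finrank_eq (K := ℂ) (V := A)).symm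
  let e := LinearEquiv.ofInjectiveOfFinrankEq (twistToDual A).map hi hd
  have he : ∀ x, e x = (twistToDual A).map x := fun x => rfl
  refine (SAlgFd.twist_invertible A).of_iso (show twist A ≅ dual A from ?_)
  exact
    { hom := twistToDual A
      inv := invHom (twistToDual A) e.symm.toLinearMap (fun x => by simp [← he]) (fun x => by simp [← he])
      hom_inv_id := by ext x; change e.symm _ = x; simp [← he]
      inv_hom_id := by ext x; change (twistToDual A).map (e.symm _) = x; simp [← he] }

end SBimod

namespace SAlgFd

instance (A : SAlgFd.{u}) : FiniteDimensional ℂ A.obj.alg := A.obj.finite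
instance (A : SAlgFd.{u}) : IsSemisimpleRing A.obj.alg := A.obj.semisimple

/-- The bimodule `A^*` as a 1-automorphism of `A`. -/
def dual (A : SAlgFd.{u}) : A ⟶ A := mkHom (SBimod.dual A.obj.alg) (SBimod.dual_invertible _)

/-- A choice of inverse and contractions. The naturality of the Serre automorphism does not depend on it,
by `SBimod.Ctx.serre_nat` for the identity. -/
noncomputable def ctx {A B : SAlgFd.{u}} (M : A ⟶ B) : SBimod.Ctx (bim M) :=
  (SBimod.Ctx.exists_of_isInvertible M.mem).some

/-- The Serre automorphism, a pseudonatural automorphism with components `A^*`. -/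
noncomputable def serre : NatEnd SAlgFd.{u} := NatEnd.mk dual
  (fun M => mkIso (ctx M).serreIso)
  (fun {_ _ M N} p => hom₂_ext ((ctx M).serre_nat (ctx N) p.m.iso))
  (fun A => hom₂_ext (ctx (𝟙 A)).serre_id)
  (fun M N => hom₂_ext ((ctx M).serre_comp (ctx N) (ctx (M ≫ N))))

/-- The Serre naturality isomorphism `S_M : B^* ⊗_B M ⟶ M ⊗_A A^*`. -/
noncomputable def S {A B : SAlgFd.{u}} (M : A ⟶ B) :
    SBimod.comp (SBimod.dual B.obj.alg) (bim M) ⟶ SBimod.comp (bim M) (SBimod.dual A.obj.alg) :=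
  mp (serre.nat M).hom

end SAlgFd

namespace SAlgFd

/-- Every invertible bimodule is part of an adjoint equivalence. -/
noncomputable def equiv {A B : SAlgFd.{u}} (M : A ⟶ B) (N : SBimod A.obj.alg B.obj.alg)
    (i : SBimod.comp N (bim M) ≅ SBimod.reg A.obj.alg) (j : SBimod.comp (bim M) N ≅ SBimod.reg B.obj.alg) :
    Bicategory.Equivalence A B :=
  let N' : B ⟶ A := mkHom N ⟨bim M, ⟨j⟩, ⟨i⟩⟩
  Bicategory.Equivalence.mkOfAdjointifyCounit (f := M) (g := N') (mkIso (M := M ≫ N') (N := 𝟙 A) i).symm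
    (mkIso (M := N' ≫ M) (N := 𝟙 B) j)

/-- The inverse of the Serre automorphism. -/
noncomputable def serreInverse : NatEnd SAlgFd.{u} :=
  NatEnd.inverse serre (fun A => (equiv (dual A) _ (ctx (dual A)).hI (ctx (dual A)).eI).inv)
    fun A =>
      let e := equiv (dual A) _ (ctx (dual A)).hI (ctx (dual A)).eI
      ⟨e.unit.hom, e.counit.hom, e.left_triangle_hom, e.right_triangle_hom⟩

noncomputable def serreInverseIso : serre.{u} ≫ serreInverse ≅ 𝟙 (Pseudofunctor.id SAlgFd.{u}) :=
  NatEnd.inverseIso serre _ _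

end SAlgFd

section
open MonoidalCategory
theorem isEquivalence_tensorLeft {C : Type u} [Category.{v} C] [MonoidalCategory C] [BraidedCategory C]
    {X Y : C} (e : X ⊗ Y ≅ 𝟙_ C) : (MonoidalCategory.tensorLeft X).IsEquivalence :=
  (CategoryTheory.Equivalence.mk (MonoidalCategory.tensorLeft X) (MonoidalCategory.tensorLeft Y)
    (NatIso.ofComponents (fun Z => (λ_ Z).symm ≪≫ MonoidalCategory.whiskerRightIso ((β_ Y X) ≪≫ e).symm Z ≪≫ α_ Y X Z)
      (fun f => by
        simp only [Functor.id_map, Functor.comp_map, Functor.id_obj, Functor.comp_obj, Iso.trans_hom,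
          Iso.symm_hom, MonoidalCategory.whiskerRightIso_hom]
        rw [MonoidalCategory.leftUnitor_inv_naturality_assoc, MonoidalCategory.whisker_exchange_assoc]
        simp))
    (NatIso.ofComponents (fun Z => (α_ X Y Z).symm ≪≫ MonoidalCategory.whiskerRightIso e Z ≪≫ λ_ Z)
      (fun f => by
        simp only [Functor.id_map, Functor.comp_map, Functor.id_obj, Functor.comp_obj, Iso.trans_hom,
          Iso.symm_hom, MonoidalCategory.whiskerRightIso_hom]
        rw [Category.assoc, Category.assoc, ← MonoidalCategory.leftUnitor_naturality,
          ← MonoidalCategory.whisker_exchange_assoc]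
        simp))).isEquivalence_functor
end

/-! ### Spin-statistics field theories -/

namespace SAlgFd

noncomputable instance : (MonoidalCategory.tensorLeft serre.{u}).IsEquivalence :=
  isEquivalence_tensorLeft (Y := serreInverse) serreInverseIso

noncomputable instance : (SqPow.functor parity.{u}).Monoidal := SqPow.monoidal parity paritySq paritySq_comm

/-- The action on `sAlg^fd`: `(k, e)` acts by the `k`-th power of the Serre automorphism composed with the `e`-th
power of `(-1)^F`. -/
noncomputable def action : SpinStat.Lab ⥤ NatEnd SAlgFd.{u} :=
  ((ZPow.functor serre).prod (SqPow.functor parity)) ⋙ MonoidalCategory.tensor (NatEnd SAlgFd.{u})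

noncomputable instance : action.{u}.Monoidal :=
  inferInstanceAs (((ZPow.functor serre).prod (SqPow.functor parity)) ⋙
    MonoidalCategory.tensor (NatEnd SAlgFd.{u})).Monoidal

end SAlgFd

/-- The bicategory of two-dimensional spin field theories satisfying spin-statistics: the homotopy fixed points of
`Spin₂ ⋊ Bℤ₂^F` in `sAlg^fd`. -/
abbrev SpinStatTFT := HFP SAlgFd.action.{u}

/-- Finite-dimensional semisimple superalgebras with a functional that vanishes on odd elements, is symmetric in
the ungraded sense, and has nondegenerate pairing. -/
structure UngrFrobAlg where
  alg : FdSuperAlg.{u}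
  tr : alg.alg →ₗ[ℂ] ℂ
  tr_odd : ∀ a, alg.alg.par a = -a → tr a = 0
  nondegenerate : ∀ a, (∀ b, tr (a * b) = 0) → a = 0
  symm : ∀ a b, tr (a * b) = tr (b * a)

theorem SBimod.twisted_comp {A B C : SuperAlg.{u}} {N : SBimod C B} {M : SBimod B A}
    (s : comp (dual C) N ⟶ comp N (dual B)) (s' : comp (dual B) M ⟶ comp M (dual A))
    (f : dual A) (g : dual B) (h : dual C)
    (hs : ∀ n, s.map (t (dual C) N h n) = t N (dual B) (N.par n) g)
    (hs' : ∀ m, s'.map (t (dual B) M g m) = t M (dual A) (M.par m) f) (x : comp N M) :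
    ((assoc (dual C) N M).hom ≫ homMap s (𝟙 _) ≫ (assoc N (dual B) M).inv ≫ homMap (𝟙 _) s' ≫
      (assoc N M (dual A)).hom).map (t (dual C) (comp N M) h x) =
        t (comp N M) (dual A) ((comp N M).par x) f := by
  induction x using ind with
  | h0 => simp
  | ha x y hx hy => simp only [map_add, LinearMap.add_apply, hx, hy]
  | ht n m =>
    simp only [comp_map, assoc_hom, homMap_t, id_map, comp_par]
    rw [hs, assoc_inv, homMap_t, hs', assoc_hom, id_map]

namespace UngrFrob
abbrev F (A : UngrFrobAlg.{u}) : SAlgFd.{u} := ⟨A.alg⟩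

/-- The condition `S_M (λ' ⊗ m) = (-1)^{|m|} m ⊗ λ`. -/
def Q (A B : UngrFrobAlg.{u}) (M : F A ⟶ F B) : Prop :=
  ∀ m : SAlgFd.bim M,
    (SAlgFd.S M).map (SBimod.t (SBimod.dual B.alg.alg) (SAlgFd.bim M) ((SBimod.ev B.alg.alg).symm B.tr) m) =
      SBimod.t (SAlgFd.bim M) (SBimod.dual A.alg.alg) ((SAlgFd.bim M).par m) ((SBimod.ev A.alg.alg).symm A.tr)

instance : SubBicat.Closed F.{u} Q where
  id_mem A := by
    intro m
    obtain ⟨m, rfl⟩ := (SBimod.toReg A.alg.alg).surjective m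
    have h := congrArg SAlgFd.mp (NatEnd.nat_id SAlgFd.serre (F A))
    have h' : SAlgFd.S (𝟙 (F A)) = (SBimod.unitR (SBimod.dual A.alg.alg)).hom ≫
      (SBimod.unitL (SBimod.dual A.alg.alg)).inv := h
    rw [h']
    change _ = SBimod.t (SBimod.reg A.alg.alg) _ (SBimod.toReg _ (A.alg.alg.par m)) _
    have h2 : SBimod.toReg _ (A.alg.alg.par m) = (SBimod.reg A.alg.alg).r (A.alg.alg.par m)
      (SBimod.toReg _ 1) := by simp
    rw [h2, SBimod.t_bal]
    have h3 : (SBimod.dual A.alg.alg).l (A.alg.alg.par m) ((SBimod.ev A.alg.alg).symm A.tr) =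
        (SBimod.dual A.alg.alg).r m ((SBimod.ev A.alg.alg).symm A.tr) :=
      SBimod.dual_ext fun b => by simp [A.symm]
    rw [h3]
    exact congrArg (SBimod.unitL (SBimod.dual A.alg.alg)).inv.map
      (SBimod.unitR_hom (SBimod.dual A.alg.alg) (SBimod.toReg A.alg.alg m) ((SBimod.ev A.alg.alg).symm A.tr))
  comp_mem A B C M N hM hN := by
    intro m
    have h := congrArg SAlgFd.mp (NatEnd.nat_comp SAlgFd.serre M N)
    have h' : SAlgFd.S (M ≫ N) =
      (SBimod.assoc (SBimod.dual C.alg.alg) (SAlgFd.bim N) (SAlgFd.bim M)).hom ≫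
        SBimod.homMap (SAlgFd.S N) (𝟙 _) ≫
        (SBimod.assoc (SAlgFd.bim N) (SBimod.dual B.alg.alg) (SAlgFd.bim M)).inv ≫
        SBimod.homMap (𝟙 _) (SAlgFd.S M) ≫
        (SBimod.assoc (SAlgFd.bim N) (SAlgFd.bim M) (SBimod.dual A.alg.alg)).hom := h
    rw [h']
    exact SBimod.twisted_comp (SAlgFd.S N) (SAlgFd.S M) _ _ _ hN hM m
end UngrFrob

/-- The bicategory of ungraded-symmetric Frobenius algebras, invertible bimodules satisfying the above condition,
and all even isomorphisms of bimodules. -/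
abbrev UngrFrob := SubBicat UngrFrob.F.{u} UngrFrob.Q
end

universe u

-- A homotopy fixed point over an object `a` carries redundant data. Since `ι` identifies `E 1` with
-- the identity, the filler of `(0, 1) : c ⟶ 1` identifies `E c` with the component of `(-1)^F`; for
-- both objects this is `HFP.κ`. The fillers of `(k, k) : 1 ⟶ 1` become trivializations `HFP.τ k` of
-- the powers of `ν (-1)^F`. The parity constraint on labels makes every filler a product of some
-- `κ` and some `τ` (`HFP.Fr_κ`), `φ` is multiplication of labels in terms of `κ` (`HFP.φ_κ`), and
-- `τ` is multiplicative (`HFP.τ_ac`). What remains is `τ 1 : 𝟙 a ≅ R T (dg 1) a`.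
--
-- Morphisms reduce in the same way. The 2-isomorphisms `s g` are forced by `κ` and the naturality
-- of `(-1)^F` (`HFP.Hom.sq_κ`), so every 2-cell commutes with them (`HFP.hom₂Mk`), and a 1-morphism
-- `f` lifts exactly when `τ 1` is natural at `f` (`HFP.Hom.nat1`, `HFP.homMk`).
--
-- Conversely, a trivialization `t` extends to a fixed point (`HFP.std`) if it is natural at
-- `(-1)^F` and if multiplication of labels absorbs the half-braidings with `(-1)^F`. In `sAlg^fd`
-- the second condition holds because `(-1)^F` braids trivially with itself (`braiding_powers`,
-- `SAlgFd.nt_parity`), and the first is a computation with an explicit inverse of the twist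
-- (`SBimod.twistCtx_serre`).
--
-- The rest is algebra. A trivialization is an isomorphism from `A` to the tensor product of
-- `A_{(-1)^F}` and `A^*`, and it is determined by the image `F ⊗ λ` of `1`, where `F` is the
-- generator of the twist. The sign in the left action on `A^*` cancels the sign of the twist, so
-- compatibility with both actions says `λ(ab) = λ(ba)`, without signs. Evenness says that `λ`
-- vanishes on odd elements, and invertibility says that the pairing is nondegenerate. Naturality at
-- `M` becomes the condition on `S_M`, with `(-1)^{|m|}` coming from moving `F` past `m`
-- (`SAlgFd.nat1_iff`). The resulting pseudofunctor `SpinStatTFT.toUngrFrob` is bijective on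
-- 2-morphisms, hits every 1-morphism, and hits every object up to equality.

universe w v

section
open scoped Bicategory Pseudofunctor.StrongTrans
open Bicategory

/-! ### Transformations indexed by labels, and their multiplication. -/

namespace SpinStat
section powers
variable {𝓑 : Type u} [Bicategory.{w, v} 𝓑] (T : Lab ⥤ NatEnd 𝓑)

/-- The transformation with label `l`. -/
def pw (l : ℤ × ZMod 2) : NatEnd 𝓑 := T.obj (⟨l.1⟩, ⟨l.2⟩)

variable [T.Monoidal] {l l' l'' l₁ l₂ l₃ l₁₂ l₂₃ : ℤ × ZMod 2}

theorem tensor_lab (h : l + l' = l'') :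
    MonoidalCategoryStruct.tensorObj (C := Lab) (⟨l.1⟩, ⟨l.2⟩) (⟨l'.1⟩, ⟨l'.2⟩) = (⟨l''.1⟩, ⟨l''.2⟩) := by
  subst h; rfl

/-- Multiplication of labels, up to an equality. -/
def pwMul (h : l + l' = l'') : pw T l ≫ pw T l' ≅ pw T l'' :=
  Functor.Monoidal.μIso T (⟨l.1⟩, ⟨l.2⟩) (⟨l'.1⟩, ⟨l'.2⟩) ≪≫ T.mapIso (eqToIso (tensor_lab h))

def pwOne : 𝟙 (Pseudofunctor.id 𝓑) ≅ pw T 0 := Functor.Monoidal.εIso T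

theorem pwMul_rfl (l l' : ℤ × ZMod 2) :
    pwMul T (rfl : l + l' = _) = Functor.Monoidal.μIso T (⟨l.1⟩, ⟨l.2⟩) (⟨l'.1⟩, ⟨l'.2⟩) := by
  ext1
  exact (congrArg (_ ≫ ·) (T.map_id _)).trans (Category.comp_id _)

-- `Lab` is discrete, so the coherence isomorphisms of its tensor product can only act as transports
-- along equalities of labels.
omit [T.Monoidal] in
theorem map_lab {x y : Lab} (f : x ⟶ y) (h : x = y) : T.map f = eqToHom (by rw [h]) := by
  subst h
  rw [Subsingleton.elim f (𝟙 x), T.map_id]; rfl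

theorem pwMul_hom (h : l + l' = l'') : (pwMul T h).hom =
    Functor.LaxMonoidal.μ T (⟨l.1⟩, ⟨l.2⟩) (⟨l'.1⟩, ⟨l'.2⟩) ≫ eqToHom (by rw [tensor_lab h]; rfl) := by
  subst h
  rw [pwMul_rfl]; exact (Category.comp_id _).symm

/-- The sums of labels are variables constrained by equations, so both bracketings may share the
name `l`. The transport in the associativity constraint of `T` is thereby hidden inside `pwMul`. -/
theorem pwMul_assoc (h₁₂ : l₁ + l₂ = l₁₂) (h : l₁₂ + l₃ = l) (h₂₃ : l₂ + l₃ = l₂₃) (h' : l₁ + l₂₃ = l) :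
    (pwMul T h₁₂).hom ▷ pw T l₃ ≫ (pwMul T h).hom =
      (α_ _ _ _).hom ≫ pw T l₁ ◁ (pwMul T h₂₃).hom ≫ (pwMul T h').hom := by
  subst h₁₂ h₂₃ h
  rw [pwMul_rfl, pwMul_rfl, pwMul_rfl]
  have := Functor.LaxMonoidal.associativity T (⟨l₁.1⟩, ⟨l₁.2⟩) (⟨l₂.1⟩, ⟨l₂.2⟩) (⟨l₃.1⟩, ⟨l₃.2⟩)
  rw [map_lab T _ (congrArg (fun x : ℤ × ZMod 2 => ((⟨x.1⟩, ⟨x.2⟩) : Lab)) (add_assoc l₁ l₂ l₃)),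
    ← Category.assoc, comp_eqToHom_iff] at this
  refine this.trans ?_
  rw [pwMul_hom]
  simp only [Category.assoc]
  rfl

theorem pwOne_mul (h : 0 + l = l) : (pwOne T).hom ▷ pw T l ≫ (pwMul T h).hom = (λ_ (pw T l)).hom := by
  have := Functor.LaxMonoidal.left_unitality T (⟨l.1⟩, ⟨l.2⟩)
  rw [map_lab T _ (congrArg (fun x : ℤ × ZMod 2 => ((⟨x.1⟩, ⟨x.2⟩) : Lab)) (zero_add l))] at this
  rw [pwMul_hom]
  exact this.symm

theorem pwMul_one (h : l + 0 = l) : pw T l ◁ (pwOne T).hom ≫ (pwMul T h).hom = (ρ_ (pw T l)).hom := by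
  have := Functor.LaxMonoidal.right_unitality T (⟨l.1⟩, ⟨l.2⟩)
  rw [map_lab T _ (congrArg (fun x : ℤ × ZMod 2 => ((⟨x.1⟩, ⟨x.2⟩) : Lab)) (add_zero l))] at this
  rw [pwMul_hom]
  exact this.symm

/-! The components at an object. -/

def R (l : ℤ × ZMod 2) (a : 𝓑) : a ⟶ a := (pw T l).ap a
def m (h : l + l' = l'') (a : 𝓑) : R T l a ≫ R T l' a ≅ R T l'' a := NatEnd.isoAp (pwMul T h) a
def e (a : 𝓑) : 𝟙 a ≅ R T 0 a := NatEnd.isoAp (pwOne T) a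
def nt (l : ℤ × ZMod 2) {a b : 𝓑} (f : a ⟶ b) : f ≫ R T l b ≅ R T l a ≫ f := (pw T l).nat f

variable (a : 𝓑)

/-- With `e_mul` and `mul_e`, this makes the endomorphisms `R T l a` of a fixed object an algebra
graded by `ℤ × ℤ/2`, in which the calculations about fixed points take place. -/
theorem m_assoc (h₁₂ : l₁ + l₂ = l₁₂) (h : l₁₂ + l₃ = l) (h₂₃ : l₂ + l₃ = l₂₃) (h' : l₁ + l₂₃ = l) :
    (m T h₁₂ a).hom ▷ R T l₃ a ≫ (m T h a).hom =
      (α_ _ _ _).hom ≫ R T l₁ a ◁ (m T h₂₃ a).hom ≫ (m T h' a).hom :=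
  congrArg (NatEnd.mo · a) (pwMul_assoc T h₁₂ h h₂₃ h')

theorem e_mul (h : 0 + l = l) : (e T a).hom ▷ R T l a ≫ (m T h a).hom = (λ_ (R T l a)).hom :=
  congrArg (NatEnd.mo · a) (pwOne_mul T h)

theorem mul_e (h : l + 0 = l) : R T l a ◁ (e T a).hom ≫ (m T h a).hom = (ρ_ (R T l a)).hom :=
  congrArg (NatEnd.mo · a) (pwMul_one T h)

variable {a} {b : 𝓑} (f : a ⟶ b)

theorem m_nat (h : l + l' = l'') : f ◁ (m T h b).hom ≫ (nt T l'' f).hom =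
    (α_ _ _ _).inv ≫ (nt T l f).hom ▷ R T l' b ≫ (α_ _ _ _).hom ≫ R T l a ◁ (nt T l' f).hom ≫
     (α_ _ _ _).inv ≫ (m T h a).hom ▷ f := by
  have := NatEnd.mo_nat (pwMul T h).hom f
  rw [NatEnd.nat_tensor] at this
  refine this.trans ?_
  change (((α_ _ _ _).inv ≫ (nt T l f).hom ▷ R T l' b ≫ (α_ _ _ _).hom ≫ R T l a ◁ (nt T l' f).hom ≫
     (α_ _ _ _).inv) ≫ (m T h a).hom ▷ f) = _
  simp only [Category.assoc]

theorem e_nat : f ◁ (e T b).hom ≫ (nt T 0 f).hom = (ρ_ f).hom ≫ (λ_ f).inv ≫ (e T a).hom ▷ f := by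
  have := NatEnd.mo_nat (pwOne T).hom f
  rw [NatEnd.nat_one] at this
  exact this.trans (Category.assoc _ _ _)

omit [T.Monoidal] in
theorem nt_nat (l : ℤ × ZMod 2) {f g : a ⟶ b} (η : f ⟶ g) :
    η ▷ R T l b ≫ (nt T l g).hom = (nt T l f).hom ≫ R T l a ◁ η := NatEnd.nat_nat _ η

/-- For the literal label `(0, 0)` the transport along `e'` is an identity, and only the unit
constraint of `T` is left. -/
theorem isoAp_actZero {g h : SpinStat} (p) (e' : lab (⟨0, 0, p⟩ : g ⟶ h) = MonoidalCategoryStruct.tensorUnit Lab) :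
    NatEnd.isoAp (actZero T (⟨0, 0, p⟩ : g ⟶ h) e') a = (e T a).symm := by
  ext1
  have : (actZero T (⟨0, 0, p⟩ : g ⟶ h) e').hom = Functor.OplaxMonoidal.η T :=
    (congrArg (· ≫ _) (T.map_id _)).trans (Category.id_comp _)
  exact congrArg (fun z => NatEnd.mo z a) this

theorem isoAp_actComp {g h k : SpinStat} (γ : g ⟶ h) (γ' : h ⟶ k) :
    NatEnd.isoAp (actComp T γ γ') a = m T (l := (γ.k, γ.e)) (l' := (γ'.k, γ'.e)) rfl a := by
  rw [m, pwMul_rfl]; rfl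

end powers
end SpinStat

/-! ### Multiplication by sections, and naturality of sections. -/

namespace SpinStat
section translate
variable {𝓑 : Type u} [Bicategory.{w, v} 𝓑] {T : Lab ⥤ NatEnd 𝓑} [T.Monoidal]
  {l l' l'' l₁ l₂ l₃ l₁₂ l₂₃ : ℤ × ZMod 2} {a b : 𝓑}

/-- Right multiplication by a section of `R l'`. -/
def ac {p : a ⟶ a} (x : p ⟶ R T l a) (t : 𝟙 a ⟶ R T l' a) (h : l + l' = l'') : p ⟶ R T l'' a :=
  x ≫ (ρ_ _).inv ≫ R T l a ◁ t ≫ (m T h a).hom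

theorem comp_ac {p q : a ⟶ a} (y : q ⟶ p) (x : p ⟶ R T l a) (t : 𝟙 a ⟶ R T l' a) (h : l + l' = l'') :
    ac (y ≫ x) t h = y ≫ ac x t h := by
  simp [ac]

/-- Interchange moves `t'` in front of the multiplication of the first two factors; then `m_assoc`
applies. -/
theorem ac_assoc {p : a ⟶ a} (x : p ⟶ R T l₁ a) (t : 𝟙 a ⟶ R T l₂ a) (t' : 𝟙 a ⟶ R T l₃ a)
    (h₁₂ : l₁ + l₂ = l₁₂) (h : l₁₂ + l₃ = l) (h₂₃ : l₂ + l₃ = l₂₃) (h' : l₁ + l₂₃ = l) :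
    ac (ac x t h₁₂) t' h = ac x (ac t t' h₂₃) h' := by
  unfold ac
  calc
    _ = x ≫ (ρ_ _).inv ≫ R T l₁ a ◁ t ≫ (ρ_ _).inv ≫ ((m T h₁₂ a).hom ▷ 𝟙 a ≫ R T l₁₂ a ◁ t') ≫
        (m T h a).hom := by simp
    _ = x ≫ (ρ_ _).inv ≫ R T l₁ a ◁ t ≫ (ρ_ _).inv ≫ (R T l₁ a ≫ R T l₂ a) ◁ t' ≫
        ((m T h₁₂ a).hom ▷ R T l₃ a ≫ (m T h a).hom) := by rw [← whisker_exchange]; simp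
    _ = _ := by rw [m_assoc T a h₁₂ h h₂₃ h']; simp

theorem e_ac (t : 𝟙 a ⟶ R T l a) (h : 0 + l = l) : ac (e T a).hom t h = t := by
  unfold ac
  calc
    _ = (ρ_ _).inv ≫ ((e T a).hom ▷ 𝟙 a ≫ R T 0 a ◁ t) ≫ (m T h a).hom := by simp
    _ = (ρ_ _).inv ≫ 𝟙 a ◁ t ≫ ((e T a).hom ▷ R T l a ≫ (m T h a).hom) := by
      rw [← whisker_exchange]; simp
    _ = _ := by rw [e_mul]; simp

theorem ac_e {p : a ⟶ a} (x : p ⟶ R T l a) (h : l + 0 = l) : ac x (e T a).hom h = x := by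
  simp [ac, mul_e]

/-- The square formed by `x`, `y`, `s` and the naturality of the transformation with label `l` commutes. -/
def Sq (f : a ⟶ b) {p : a ⟶ a} {q : b ⟶ b} (s : p ≫ f ⟶ f ≫ q) (x : p ⟶ R T l a) (y : q ⟶ R T l b) : Prop :=
  s ≫ f ◁ y ≫ (nt T l f).hom = x ▷ f

/-- The sections `t` and `t'` are natural at `f`. -/
abbrev Nat1 (f : a ⟶ b) (t : 𝟙 a ⟶ R T l a) (t' : 𝟙 b ⟶ R T l b) : Prop :=
  Sq f ((λ_ f).hom ≫ (ρ_ f).inv) t t'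

variable {f : a ⟶ b} {p : a ⟶ a} {q : b ⟶ b} {s : p ≫ f ⟶ f ≫ q} {x : p ⟶ R T l a} {y : q ⟶ R T l b}

/-- Nothing is assumed about `t`: the square of `x` is used up, and the failure of `t` to be natural
is isolated under a whiskering. Both the product rule `Sq.ac` and the cancellation rule `Nat1.of_ac`
follow from this form. -/
theorem Sq.comp_ac (hs : Sq f s x y) (t : 𝟙 b ⟶ R T l' b) (h : l + l' = l'') :
    s ≫ f ◁ ac y t h ≫ (nt T l'' f).hom = x ▷ f ≫ R T l a ◁ ((ρ_ f).inv ≫ f ◁ t ≫ (nt T l' f).hom) ≫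
      (α_ _ _ _).inv ≫ (m T h a).hom ▷ f := by
  unfold ac
  calc
    _ = (s ≫ f ◁ y) ≫ f ◁ (ρ_ _).inv ≫ f ◁ R T l b ◁ t ≫ f ◁ (m T h b).hom ≫ (nt T l'' f).hom := by
      simp
    _ = s ≫ f ◁ y ≫ (ρ_ _).inv ≫ ((f ≫ R T l b) ◁ t ≫ (nt T l f).hom ▷ R T l' b) ≫ (α_ _ _ _).hom ≫
          R T l a ◁ (nt T l' f).hom ≫ (α_ _ _ _).inv ≫ (m T h a).hom ▷ f := by
      rw [m_nat]; simp
    _ = (s ≫ f ◁ y ≫ (nt T l f).hom) ≫ (ρ_ _).inv ≫ (R T l a ≫ f) ◁ t ≫ (α_ _ _ _).hom ≫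
          R T l a ◁ (nt T l' f).hom ≫ (α_ _ _ _).inv ≫ (m T h a).hom ▷ f := by
      rw [whisker_exchange]; simp
    _ = _ := by
      rw [hs]; simp

omit [T.Monoidal] in
theorem Nat1.iff (t : 𝟙 a ⟶ R T l a) (t' : 𝟙 b ⟶ R T l b) :
    Nat1 f t t' ↔ (ρ_ f).inv ≫ f ◁ t' ≫ (nt T l f).hom = (λ_ f).inv ≫ t ▷ f := by
  rw [← cancel_epi (λ_ f).hom]
  simp [Nat1, Sq]

theorem Sq.ac (hs : Sq f s x y) {t : 𝟙 a ⟶ R T l' a} {t' : 𝟙 b ⟶ R T l' b} (ht : Nat1 f t t')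
    (h : l + l' = l'') : Sq f s (ac x t h) (ac y t' h) := by
  rw [Sq, hs.comp_ac, (Nat1.iff _ _).1 ht]
  simp [SpinStat.ac]

theorem Nat1.of_ac {x : 𝟙 a ⟶ R T l a} {y : 𝟙 b ⟶ R T l b} [IsIso x] (hs : Nat1 f x y)
    {t : 𝟙 a ⟶ R T l' a} {t' : 𝟙 b ⟶ R T l' b} (h : l + l' = l'')
    (ht : Nat1 f (SpinStat.ac x t h) (SpinStat.ac y t' h)) : Nat1 f t t' := by
  rw [Nat1, Sq, Sq.comp_ac hs] at ht
  rw [Nat1.iff]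
  have h1 : (SpinStat.ac x t h) ▷ f = x ▷ f ≫ R T l a ◁ ((λ_ f).inv ≫ t ▷ f) ≫
      (α_ _ _ _).inv ≫ (m T h a).hom ▷ f := by
    simp [SpinStat.ac]
  rw [h1] at ht
  have h2 := (cancel_epi _).1 ht
  rw [← Category.assoc, ← Category.assoc (R T l a ◁ _), cancel_mono, cancel_mono] at h2
  -- The isomorphism `x` trades whiskering by `R T l a` for whiskering by the identity 1-morphism,
  -- which is faithful.
  have h3 := congrArg (x ▷ f ≫ ·) h2
  simp only [← whisker_exchange] at h3
  rw [cancel_mono] at h3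
  exact (whiskerLeft_iff _ _).1 h3

end translate
end SpinStat

/-! ### Arithmetic of the labels of morphisms. -/

namespace SpinStat

/-- The label of the `k`-th power of `ν (-1)^F`. -/
abbrev dg (k : ℤ) : ℤ × ZMod 2 := (k, k)
/-- The label of the `g`-th power of `(-1)^F`. -/
abbrev pl (g : SpinStat) : ℤ × ZMod 2 := (0, g.val)

theorem dg_add {k l n : ℤ} (h : k + l = n) : dg k + dg l = dg n := by
  subst h; simp

theorem add_self (x : ZMod 2) : x + x = 0 := CharTwo.add_self_eq_zero x

/-- The labels of the morphisms from `g` to `g'`. -/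
def Ad (g g' : SpinStat) (l : ℤ × ZMod 2) : Prop := (l.1 : ZMod 2) + l.2 = g'.val - g.val

theorem ad_dg (k : ℤ) : Ad ⟨0⟩ ⟨0⟩ (dg k) := by simp [Ad, add_self]
theorem ad_pl (g : SpinStat) : Ad g ⟨0⟩ (pl g) := by
  simp only [Ad, Int.cast_zero, zero_add, zero_sub]
  exact eq_neg_of_add_eq_zero_left (add_self g.val)
theorem Ad.add {g g' g'' : SpinStat} {l l' l'' : ℤ × ZMod 2} (p : Ad g g' l) (p' : Ad g' g'' l')
    (h : l + l' = l'') : Ad g g'' l'' := by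
  subst h
  simp only [Ad, Prod.fst_add, Prod.snd_add, Int.cast_add] at *
  linear_combination p + p'

/-- The integer label and the endpoints determine the `ℤ/2`-label. Hence a morphism `g ⟶ g'`
followed by a power of `(-1)^F` to `1` equals a power of `(-1)^F` to `1` followed by a power of `ν
(-1)^F`. This identity is what separates a fixed point into `κ` and `τ`. -/
theorem add_dg {g g' : SpinStat} {l : ℤ × ZMod 2} (p : Ad g g' l) : pl g + dg l.1 = l + pl g' := by
  ext <;> simp
  have h2 : g'.val = l.1 + l.2 + g.val := by rw [p]; ring
  rw [h2]
  linear_combination - add_self l.2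

section family
variable {𝓑 : Type u} [Bicategory.{w, v} 𝓑] {T : Lab ⥤ NatEnd 𝓑} [T.Monoidal] {a b : 𝓑} {f : a ⟶ b}

/-- Positive exponents come from products with the first power; zero and negative exponents come
from cancelling it. -/
theorem Nat1.all {t : ∀ k, 𝟙 a ⟶ R T (dg k) a} {t' : ∀ k, 𝟙 b ⟶ R T (dg k) b} [∀ k, IsIso (t k)]
    (h : ∀ k l n (h : k + l = n), ac (t k) (t l) (dg_add h) = t n)
    (h' : ∀ k l n (h : k + l = n), ac (t' k) (t' l) (dg_add h) = t' n)
    (h1 : Nat1 f (t 1) (t' 1)) (k : ℤ) : Nat1 f (t k) (t' k) := by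
  induction k using Int.induction_on with
  | zero =>
    refine Nat1.of_ac h1 (dg_add (add_zero (1 : ℤ))) ?_
    rwa [h 1 _ _ (by ring), h' 1 _ _ (by ring)]
  | succ i hi =>
    rw [← h i 1 _ rfl, ← h' i 1 _ rfl]
    exact Sq.ac hi h1 _
  | pred i hi =>
    refine Nat1.of_ac h1 (dg_add (show (1 : ℤ) + (-(i : ℤ) - 1) = -i by ring)) ?_
    rwa [h 1 _ _ (by ring), h' 1 _ _ (by ring)]
end family
end SpinStat

/-! ### The structure of a fixed point in terms of `κ` and `τ`. -/

namespace HFP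
open SpinStat
variable {𝓑 : Type u} [Bicategory.{w, v} 𝓑] {T : SpinStat.Lab ⥤ NatEnd 𝓑} [T.Monoidal] (X Y : HFP T)

/-- The filler of the triangle of the morphism with label `l`. -/
def Fr {g g' : SpinStat} {l : ℤ × ZMod 2} (p : Ad g g' l) : X.E g ≅ R T l X.pt ≫ X.E g' :=
  X.F (⟨l.1, l.2, p⟩ : g ⟶ g')

def u : 𝟙 X.pt ≅ X.E ⟨0⟩ := X.ι

theorem Fr_id {g g' : SpinStat} (p : Ad g g' 0) (h : g = g') : (X.Fr p).hom =
    (λ_ (X.E g)).inv ≫ (e T X.pt).hom ▷ X.E g ≫ eqToHom (by rw [h]) := by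
  subst h
  have := X.F_id g
  erw [isoAp_actZero] at this
  rw [eqToHom_refl, Category.comp_id]
  exact this

theorem Fr_comp {g g' g'' : SpinStat} {l l' l'' : ℤ × ZMod 2} (p : Ad g g' l) (p' : Ad g' g'' l')
    (p'' : Ad g g'' l'') (h : l + l' = l'') : (X.Fr p'').hom =
    (X.Fr p).hom ≫ R T l X.pt ◁ (X.Fr p').hom ≫ (α_ _ _ _).inv ≫ (m T h X.pt).hom ▷ X.E g'' := by
  subst h
  have := X.F_comp (⟨l.1, l.2, p⟩ : g ⟶ g') (⟨l'.1, l'.2, p'⟩ : g' ⟶ g'')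
  rw [isoAp_actComp] at this
  exact this

/-- The filler for a morphism `g ⟶ 1`. -/
def Fz {g : SpinStat} {l : ℤ × ZMod 2} (p : Ad g ⟨0⟩ l) : X.E g ≅ R T l X.pt :=
  X.Fr p ≪≫ whiskerLeftIso _ X.u.symm ≪≫ ρ_ _

variable {X} {g g' g'' : SpinStat} {l l' l'' : ℤ × ZMod 2}

theorem Fz_comp (p : Ad g g' l) (p' : Ad g' ⟨0⟩ l') (p'' : Ad g ⟨0⟩ l'') (h : l + l' = l'') :
    (X.Fz p'').hom = (X.Fr p).hom ≫ R T l X.pt ◁ (X.Fz p').hom ≫ (m T h X.pt).hom := by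
  simp only [Fz, Iso.trans_hom, X.Fr_comp p p' p'' h, Category.assoc, whiskerLeftIso_hom, Iso.symm_hom]
  rw [← whisker_exchange_assoc]
  simp

variable (X)
def κ (g : SpinStat) : X.E g ≅ R T (pl g) X.pt := X.Fz (ad_pl g)
def τ (k : ℤ) : 𝟙 X.pt ≅ R T (dg k) X.pt := X.u ≪≫ X.Fz (ad_dg k)
variable {X}

/-- Follow a morphism `g ⟶ 1` by `(k, k) : 1 ⟶ 1`. The identification `u` that ends the first filler
cancels the one that starts `τ k`. -/
theorem Fz_dg (p : Ad g ⟨0⟩ l) (p' : Ad g ⟨0⟩ l') (k : ℤ) (h : l + dg k = l') :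
    (X.Fz p').hom = ac (X.Fz p).hom (X.τ k).hom h := by
  rw [X.Fz_comp p (ad_dg k) p' h]
  simp only [ac, τ, Iso.trans_hom, Bicategory.whiskerLeft_comp]
  have : (X.Fz p).hom ≫ (ρ_ _).inv = (X.Fr p).hom ≫ R T l X.pt ◁ X.u.inv := by simp [Fz]
  rw [reassoc_of% this]
  simp

theorem τ_ac (k l n : ℤ) (h : k + l = n) : ac (X.τ k).hom (X.τ l).hom (dg_add h) = (X.τ n).hom := by
  have : (X.τ k).hom = X.u.hom ≫ (X.Fz (ad_dg k)).hom := rfl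
  rw [this, comp_ac, ← Fz_dg (ad_dg k) (ad_dg n) l (dg_add h)]
  rfl

/-- At `g = 1` the filler in `κ` has label zero, so it is the filler of an identity; interchange
then cancels `u` against its inverse. -/
theorem u_κ : X.u.hom ≫ (X.κ ⟨0⟩).hom = (e T X.pt).hom := by
  have h : (X.Fr (ad_pl ⟨0⟩)).hom = (λ_ (X.E _)).inv ≫ (e T X.pt).hom ▷ X.E _ ≫ eqToHom rfl := X.Fr_id _ rfl
  simp only [κ, Fz, Iso.trans_hom, h, whiskerLeftIso_hom, Iso.symm_hom, eqToHom_refl, Category.comp_id,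
    Category.assoc]
  have h2 : (e T X.pt).hom ▷ X.E ⟨0⟩ ≫ R T 0 X.pt ◁ X.u.inv = 𝟙 _ ◁ X.u.inv ≫ (e T X.pt).hom ▷ _ :=
    (whisker_exchange _ _).symm
  have h3 : X.u.hom ≫ (λ_ (X.E _)).inv ≫ ((e T X.pt).hom ▷ X.E ⟨0⟩ ≫ R T 0 X.pt ◁ X.u.inv) ≫ (ρ_ _).hom =
      (e T X.pt).hom := by
    rw [h2]; simp
  simp only [Category.assoc] at h3
  exact h3

/-- Both sides are the filler of the composite `g ⟶ g' ⟶ 1`, split in the two ways allowed by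
`add_dg`. Since `κ` and `m` are invertible, every filler is determined by `κ` and `τ`. -/
theorem Fr_κ (p : Ad g g' l) (h : l + pl g' = l')
    (h' : pl g + dg l.1 = l') : (X.Fr p).hom ≫ R T l X.pt ◁ (X.κ g').hom ≫ (m T h X.pt).hom =
      ac (X.κ g).hom (X.τ l.1).hom h' := by
  rw [κ, κ, ← X.Fz_comp p (ad_pl g') (p.add (ad_pl g') h) h]
  exact X.Fz_dg (ad_pl g) _ _ _

abbrev tens (g g' : SpinStat) : SpinStat := MonoidalCategoryStruct.tensorObj g g'

theorem ad_unit (g : SpinStat) : Ad (tens g ⟨0⟩) ⟨0⟩ (pl g) := by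
  have : Ad ⟨g.val + 0⟩ ⟨0⟩ (pl g) := by
    rw [add_zero]; exact ad_pl g
  exact this

/-- The axiom `unit_right` determines `φ g 1` up to the filler of the right unitor, a morphism of
label zero. Continuing along `(-1)^F` to `1` brings in `κ g`. -/
theorem Fz_unit (g : SpinStat) :
    X.u.hom ▷ X.E g ≫ (X.φ g ⟨0⟩).hom ≫ (X.Fz (ad_unit g)).hom = (λ_ _).hom ≫ (X.κ g).hom := by
  have p : Ad (tens g ⟨0⟩) g 0 := by
    change ((0 : ℤ) : ZMod 2) + 0 = g.val - (g.val + 0)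
    simp
  have h : X.u.hom ▷ X.E g ≫ (X.φ g ⟨0⟩).hom ≫ (X.Fr p).hom = (e T X.pt).hom ▷ X.E g := by
    have := X.unit_right g
    erw [isoAp_actZero] at this
    rw [← cancel_mono ((e T X.pt).inv ▷ X.E g), ← cancel_mono (λ_ _).hom]
    simp only [Category.assoc]
    refine this.trans ?_
    simp
  rw [X.Fz_comp p (ad_pl g) _ (zero_add _), reassoc_of% h]
  change _ = _ ≫ (X.Fz (ad_pl g)).hom
  have := (whisker_exchange_assoc (e T X.pt).hom (X.Fz (ad_pl g)).hom (m T (zero_add (pl g)) X.pt).hom).symm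
  refine this.trans ?_
  rw [e_mul]
  simp

/-- Compatibility of `φ` with the power of `(-1)^F` from `g` to `1` replaces the object `g` by the
unit, where `Fz_unit` gives the value. In the coordinates `κ`, the constraint `φ` is therefore
multiplication of labels. -/
theorem φ_κ (g g' : SpinStat) (h : pl g + pl g' = pl (tens g' g)) :
    (X.φ g' g).hom ≫ (X.κ (tens g' g)).hom =
      (X.κ g).hom ▷ X.E g' ≫ R T (pl g) X.pt ◁ (X.κ g').hom ≫ (m T h X.pt).hom := by
  have p : Ad (tens g' g) (tens g' ⟨0⟩) (pl g) := by
    change ((0 : ℤ) : ZMod 2) + g.val = (g'.val + 0) - (g'.val + g.val)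
    linear_combination add_self g.val
  have h1 : (X.φ g' g).hom ≫ (X.Fr p).hom = (X.Fr (ad_pl g)).hom ▷ X.E g' ≫ (α_ _ _ _).hom ≫
      R T (pl g) X.pt ◁ (X.φ g' ⟨0⟩).hom := X.tensor_right g' (⟨0, g.val, ad_pl g⟩ : g ⟶ ⟨0⟩)
  have h2 : (X.φ g' ⟨0⟩).hom ≫ (X.Fz (ad_unit g')).hom = X.u.inv ▷ X.E g' ≫ (λ_ _).hom ≫ (X.κ g').hom := by
    rw [← X.Fz_unit g']; simp
  have h3 : (X.κ (tens g' g)).hom =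
      (X.Fr p).hom ≫ R T (pl g) X.pt ◁ (X.Fz (ad_unit g')).hom ≫ (m T h X.pt).hom := X.Fz_comp p _ _ h
  rw [h3, reassoc_of% h1, ← whiskerLeft_comp_assoc, h2]
  have h4 : (X.κ g).hom = (X.Fr (ad_pl g)).hom ≫ R T (pl g) X.pt ◁ X.u.inv ≫ (ρ_ _).hom := rfl
  rw [h4]
  simp

end HFP

/-! ### Morphisms of fixed points are determined by their underlying 1- and 2-morphisms. -/

namespace HFP
open SpinStat
variable {𝓑 : Type u} [Bicategory.{w, v} 𝓑] {T : SpinStat.Lab ⥤ NatEnd 𝓑} [T.Monoidal] {X Y : HFP T}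
  {g g' : SpinStat} {l : ℤ × ZMod 2}

theorem Hom.s_Fr (a : Hom X Y) (p : Ad g g' l) :
    (X.Fr p).hom ▷ a.f ≫ (α_ _ _ _).hom ≫ R T l X.pt ◁ (a.s g').hom =
    (a.s g).hom ≫ a.f ◁ (Y.Fr p).hom ≫ (α_ _ _ _).inv ≫ (nt T l a.f).hom ▷ Y.E g' ≫ (α_ _ _ _).hom :=
  a.s_F (⟨l.1, l.2, p⟩ : g ⟶ g')

theorem Hom.s_u (a : Hom X Y) : X.u.hom ▷ a.f ≫ (a.s ⟨0⟩).hom = (λ_ a.f).hom ≫ (ρ_ a.f).inv ≫ a.f ◁ Y.u.hom :=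
  a.s_unit

theorem Hom.s_u' (a : Hom X Y) : (a.s ⟨0⟩).hom ≫ a.f ◁ Y.u.inv = X.u.inv ▷ a.f ≫ (λ_ a.f).hom ≫ (ρ_ a.f).inv := by
  rw [← cancel_epi (X.u.hom ▷ a.f), ← Category.assoc, a.s_u]
  simp

/-- The axiom `s_F` gives this square with an extra factor `E 1`, which the unit axiom in the form
`s_u'` removes. For `l = pl g` the square expresses `s g` through `κ` and a naturality constraint.
-/
theorem Hom.sq (a : Hom X Y) (p : Ad g ⟨0⟩ l) : Sq a.f (a.s g).hom (X.Fz p).hom (Y.Fz p).hom := by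
  have h1 : (X.Fz p).hom ▷ a.f = ((X.Fr p).hom ▷ a.f ≫ (α_ _ _ _).hom ≫ R T l X.pt ◁ (a.s ⟨0⟩).hom) ≫
      R T l X.pt ◁ (a.f ◁ Y.u.inv ≫ (ρ_ _).hom) := by
    have := a.s_u' =≫ (ρ_ _).hom
    rw [Category.assoc] at this
    simp only [Category.assoc, ← whiskerLeft_comp, this]
    simp [Fz]
  rw [Sq, h1, a.s_Fr]
  have h2 := (whisker_exchange (nt T l a.f).hom Y.u.inv)
  simp only [Fz, Iso.trans_hom, whiskerLeftIso_hom, Iso.symm_hom]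
  calc
    _ = (a.s g).hom ≫ a.f ◁ (Y.Fr p).hom ≫ (α_ _ _ _).inv ≫ ((a.f ≫ R T l Y.pt) ◁ Y.u.inv ≫
        (nt T l a.f).hom ▷ 𝟙 _) ≫ (ρ_ _).hom := by simp
    _ = _ := by rw [h2]; simp

theorem Hom.sq_κ (a : Hom X Y) (g : SpinStat) : Sq a.f (a.s g).hom (X.κ g).hom (Y.κ g).hom := a.sq _

theorem Hom.nat1 (a : Hom X Y) (k : ℤ) : Nat1 a.f (X.τ k).hom (Y.τ k).hom := by
  have h1 : (X.τ k).hom = X.u.hom ≫ (X.Fz (ad_dg k)).hom := rfl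
  have h2 : (Y.τ k).hom = Y.u.hom ≫ (Y.Fz (ad_dg k)).hom := rfl
  have := a.sq (ad_dg k)
  rw [Sq] at this
  rw [Nat1, Sq, h1, h2, comp_whiskerRight, ← this, reassoc_of% a.s_u]
  simp

/-- Every 2-morphism of the underlying 1-morphisms is a 2-morphism of homotopy fixed points. -/
def hom₂Mk {a b : Hom X Y} (p : a.f ⟶ b.f) : a ⟶ b where
  m := p
  comm g := by
    -- Composing with the invertible `κ` and naturality constraint eliminates both `s g`; what
    -- remains is interchange and naturality of the power of `(-1)^F` in 2-cells.
    have ha := a.sq_κ g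
    have hb := b.sq_κ g
    rw [Sq] at ha hb
    rw [← cancel_mono (b.f ◁ (Y.κ g).hom), ← cancel_mono (nt T _ b.f).hom]
    simp only [Category.assoc, hb]
    rw [← whisker_exchange_assoc, nt_nat, reassoc_of% ha, whisker_exchange]

variable (X Y)
/-- The comparison of the components at `g` determined by a 1-morphism of the underlying objects. -/
def sOf (f : X.pt ⟶ Y.pt) (g : SpinStat) : X.E g ≫ f ≅ f ≫ Y.E g :=
  whiskerRightIso (X.κ g) f ≪≫ (nt T (pl g) f).symm ≪≫ whiskerLeftIso f (Y.κ g).symm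

variable {X Y}
theorem sq_sOf (f : X.pt ⟶ Y.pt) (g : SpinStat) : Sq f (sOf X Y f g).hom (X.κ g).hom (Y.κ g).hom := by
  simp [Sq, sOf]

theorem pl_add (g g' : SpinStat) : pl g + pl g' = pl (tens g' g) := by
  change ((0 : ℤ), g.val) + ((0 : ℤ), g'.val) = ((0 : ℤ), g'.val + g.val)
  simp [add_comm]

/-- A 1-morphism at which the trivializations of `ν (-1)^F` are natural is a 1-morphism of homotopy fixed
points. -/
def homMk (f : X.pt ⟶ Y.pt) (h : Nat1 f (X.τ 1).hom (Y.τ 1).hom) : Hom X Y where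
  f := f
  s := sOf X Y f
  s_unit := by
    have h1 := sq_sOf (X := X) (Y := Y) f ⟨0⟩
    rw [Sq] at h1
    change X.u.hom ▷ f ≫ (sOf X Y f ⟨0⟩).hom = (λ_ f).hom ≫ (ρ_ f).inv ≫ f ◁ Y.u.hom
    rw [← cancel_mono (f ◁ (Y.κ _).hom), ← cancel_mono (nt T _ f).hom]
    simp only [Category.assoc]
    rw [h1, ← comp_whiskerRight, ← whiskerLeft_comp_assoc, u_κ, u_κ]
    change _ = (λ_ f).hom ≫ (ρ_ f).inv ≫ f ◁ (e T Y.pt).hom ≫ (nt T 0 f).hom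
    rw [e_nat]; simp
  s_φ g' g := by
    have h1 := fun g => sq_sOf (X := X) (Y := Y) f g
    simp only [Sq] at h1
    change (X.φ g' g).hom ▷ f ≫ (sOf X Y f (tens g' g)).hom = _
    rw [← cancel_mono (f ◁ (Y.κ _).hom), ← cancel_mono (nt T _ f).hom]
    simp only [Category.assoc]
    rw [h1, ← comp_whiskerRight, ← whiskerLeft_comp_assoc, φ_κ _ _ (pl_add g g'), φ_κ _ _ (pl_add g g')]
    symm
    calc
      _ = (α_ _ _ _).hom ≫ X.E g ◁ (sOf X Y f g').hom ≫ (α_ _ _ _).inv ≫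
          ((sOf X Y f g).hom ≫ f ◁ (Y.κ g).hom) ▷ Y.E g' ≫ (α_ _ _ _).hom ≫
          f ◁ R T (pl g) Y.pt ◁ (Y.κ g').hom ≫ f ◁ (m T (pl_add g g') Y.pt).hom ≫ (nt T _ f).hom := by simp
      _ = (α_ _ _ _).hom ≫ X.E g ◁ (sOf X Y f g').hom ≫ (α_ _ _ _).inv ≫
          ((sOf X Y f g).hom ≫ f ◁ (Y.κ g).hom) ▷ Y.E g' ≫
          ((f ≫ R T (pl g) Y.pt) ◁ (Y.κ g').hom ≫ (nt T (pl g) f).hom ▷ _) ≫ (α_ _ _ _).hom ≫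
          R T (pl g) X.pt ◁ (nt T (pl g') f).hom ≫ (α_ _ _ _).inv ≫ (m T (pl_add g g') X.pt).hom ▷ f := by
        rw [m_nat]; simp
      _ = (α_ _ _ _).hom ≫ X.E g ◁ (sOf X Y f g').hom ≫ (α_ _ _ _).inv ≫
          ((sOf X Y f g).hom ≫ f ◁ (Y.κ g).hom ≫ (nt T (pl g) f).hom) ▷ Y.E g' ≫
          (R T (pl g) X.pt ≫ f) ◁ (Y.κ g').hom ≫ (α_ _ _ _).hom ≫
          R T (pl g) X.pt ◁ (nt T (pl g') f).hom ≫ (α_ _ _ _).inv ≫ (m T (pl_add g g') X.pt).hom ▷ f := by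
        rw [whisker_exchange]; simp
      _ = (α_ _ _ _).hom ≫ (X.E g ◁ (sOf X Y f g').hom ≫ (X.κ g).hom ▷ (f ≫ Y.E g')) ≫
          R T (pl g) X.pt ◁ (f ◁ (Y.κ g').hom ≫
            (nt T (pl g') f).hom) ≫ (α_ _ _ _).inv ≫ (m T (pl_add g g') X.pt).hom ▷ f := by
        rw [h1]; simp
      _ = (α_ _ _ _).hom ≫ (X.κ g).hom ▷ (X.E g' ≫ f) ≫
          R T (pl g) X.pt ◁ ((sOf X Y f g').hom ≫ f ◁ (Y.κ g').hom ≫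
            (nt T (pl g') f).hom) ≫ (α_ _ _ _).inv ≫ (m T (pl_add g g') X.pt).hom ▷ f := by
        rw [whisker_exchange]; simp
      _ = _ := by
        rw [h1]; simp
  s_F {g g'} γ := by
    have p : Ad g g' (γ.k, γ.e) := γ.prop
    -- The label of `γ` enters only through its integer part: by `Fr_κ` the product of `κ g` with `τ
    -- γ.k` is the filler of `γ` followed by `κ g'`, so naturality of `τ` at exponent `γ.k` is all
    -- that `s_F` needs.
    have hk := Nat1.all (fun k l n h => X.τ_ac k l n h) (fun k l n h => Y.τ_ac k l n h) h γ.k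
    have h1 := fun g => sq_sOf (X := X) (Y := Y) f g
    have h2 := (h1 g).ac hk (add_dg p)
    rw [← Fr_κ p rfl, ← Fr_κ p rfl] at h2
    have h3 := h1 g'
    rw [Sq] at h2 h3
    change (X.Fr p).hom ▷ f ≫ (α_ _ _ _).hom ≫ R T (γ.k, γ.e) X.pt ◁ (sOf X Y f g').hom =
      (sOf X Y f g).hom ≫ f ◁ (Y.Fr p).hom ≫ (α_ _ _ _).inv ≫ (nt T (γ.k, γ.e) f).hom ▷ Y.E g' ≫ (α_ _ _ _).hom
    rw [← cancel_mono (R T (γ.k, γ.e) X.pt ◁ (f ◁ (Y.κ g').hom ≫ (nt T _ f).hom)),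
      ← cancel_mono ((α_ _ _ _).inv ≫ (m T rfl X.pt).hom ▷ f)]
    calc
      _ = (X.Fr p).hom ▷ f ≫ (α_ _ _ _).hom ≫ R T (γ.k, γ.e) X.pt ◁ ((sOf X Y f g').hom ≫
          f ◁ (Y.κ g').hom ≫ (nt T _ f).hom) ≫ (α_ _ _ _).inv ≫ (m T rfl X.pt).hom ▷ f := by simp
      _ = ((X.Fr p).hom ≫ R T (γ.k, γ.e) X.pt ◁ (X.κ g').hom ≫ (m T rfl X.pt).hom) ▷ f := by
        rw [h3]; simp
      _ = (sOf X Y f g).hom ≫ f ◁ (Y.Fr p).hom ≫ (α_ _ _ _).inv ≫ ((f ≫ R T (γ.k, γ.e) Y.pt) ◁ (Y.κ g').hom ≫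
          (nt T _ f).hom ▷ _) ≫ (α_ _ _ _).hom ≫ R T (γ.k, γ.e) X.pt ◁ (nt T _ f).hom ≫
          (α_ _ _ _).inv ≫ (m T rfl X.pt).hom ▷ f := by
        rw [← h2, Bicategory.whiskerLeft_comp, Bicategory.whiskerLeft_comp]
        simp only [Category.assoc]
        rw [m_nat]; simp
      _ = _ := by
        rw [whisker_exchange]; simp

end HFP

/-! ### Powers of a trivialization of `ν (-1)^F`. -/

namespace SpinStat
section
variable {𝓑 : Type u} [Bicategory.{w, v} 𝓑] {T : Lab ⥤ NatEnd 𝓑} [T.Monoidal]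
  {l l' l'' l₁ l₂ l₃ l₁₂ l₂₃ : ℤ × ZMod 2} {a b : 𝓑}

/-- Left multiplication by `R T l₁ a` and right multiplication by a section commute, by
associativity and interchange. -/
theorem whisker_ac {p : a ⟶ a} (x : p ⟶ R T l₂ a) (t : 𝟙 a ⟶ R T l₃ a) (h₁₂ : l₁ + l₂ = l₁₂)
    (h : l₁₂ + l₃ = l) (h₂₃ : l₂ + l₃ = l₂₃) (h' : l₁ + l₂₃ = l) :
    R T l₁ a ◁ (ac x t h₂₃) ≫ (m T h' a).hom = ac (R T l₁ a ◁ x ≫ (m T h₁₂ a).hom) t h := by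
  unfold ac
  symm
  calc
    _ = R T l₁ a ◁ x ≫ (ρ_ _).inv ≫ ((m T h₁₂ a).hom ▷ 𝟙 a ≫ R T l₁₂ a ◁ t) ≫ (m T h a).hom := by simp
    _ = R T l₁ a ◁ x ≫ (ρ_ _).inv ≫ (R T l₁ a ≫ R T l₂ a) ◁ t ≫
        ((m T h₁₂ a).hom ▷ R T l₃ a ≫ (m T h a).hom) := by rw [← whisker_exchange]; simp
    _ = _ := by rw [m_assoc T a h₁₂ h h₂₃ h']; simp

theorem m_ac (t : 𝟙 a ⟶ R T l₃ a) (h₁₂ : l₁ + l₂ = l₁₂)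
    (h : l₁₂ + l₃ = l) (h₂₃ : l₂ + l₃ = l₂₃) (h' : l₁ + l₂₃ = l) :
    (m T h₁₂ a).hom ≫ ac (𝟙 _) t h = R T l₁ a ◁ (ac (𝟙 _) t h₂₃) ≫ (m T h' a).hom := by
  rw [whisker_ac _ _ h₁₂ h, ← comp_ac]; simp

theorem m_ac_e (h : l + l' = l'') (h' : l'' + 0 = l₁) (h'' : l + l' = l₁) :
    (m T h a).hom ≫ ac (𝟙 _) (e T a).hom h' = (m T h'' a).hom := by
  obtain rfl : l'' = l₁ := by simpa using h'
  rw [ac_e, Category.comp_id]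

-- Naturality depends only on the isomorphism class of `f`, so it may be tested on a convenient
-- representative.
omit [T.Monoidal] in
theorem Nat1.of_iso {f f' : a ⟶ b} (η : f ≅ f') {t : 𝟙 a ⟶ R T l a} {t' : 𝟙 b ⟶ R T l b}
    (h : Nat1 f t t') : Nat1 f' t t' := by
  rw [Nat1.iff] at h ⊢
  have h1 := congrArg (η.inv ≫ · ≫ R T l a ◁ η.hom) h
  simp only [Category.assoc] at h1
  rw [← nt_nat] at h1
  have h2 : η.inv ≫ (ρ_ f).inv ≫ f ◁ t' ≫ η.hom ▷ R T l b ≫ (nt T l f').hom =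
      (ρ_ f').inv ≫ f' ◁ t' ≫ (nt T l f').hom := by
    rw [whisker_exchange_assoc]; simp
  have h3 : η.inv ≫ (λ_ f).inv ≫ t ▷ f ≫ R T l a ◁ η.hom = (λ_ f').inv ≫ t ▷ f' := by
    rw [← whisker_exchange]; simp
  rw [← h2, ← h3, h1]

omit [T.Monoidal] in
theorem Nat1.id (t : 𝟙 a ⟶ R T l a) : Nat1 (𝟙 a) t t := by
  have : (nt T l (𝟙 a)).hom = (λ_ (R T l a)).hom ≫ (ρ_ (R T l a)).inv := NatEnd.nat_id _ _
  rw [Nat1.iff, this]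
  simp [unitors_inv_equal]

section powers
variable (t : 𝟙 a ≅ R T (dg 1) a)

/-- Right multiplication by `t`. -/
def step {k n : ℤ} (h : k + 1 = n) : R T (dg k) a ≅ R T (dg n) a :=
  (ρ_ _).symm ≪≫ whiskerLeftIso _ t ≪≫ m T (dg_add h) a

theorem comp_step {k n : ℤ} (h : k + 1 = n) (x : 𝟙 a ⟶ R T (dg k) a) :
    x ≫ (step t h).hom = ac x t.hom (dg_add h) := by
  simp [step, ac]

/-- The unit of the powers, with values in the transformation of a trivial label. -/
def eAt (h : l = 0) : 𝟙 a ≅ R T l a := e T a ≪≫ eqToIso (by rw [h])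

theorem ac_eAt {p : a ⟶ a} (x : p ⟶ R T l a) (hl : l' = 0) (h : l + l' = l'') (h' : l + 0 = l'') :
    ac x (eAt hl).hom h = ac x (e T a).hom h' := by
  subst hl
  simp [eAt]

theorem dg_zero : dg 0 = 0 := by ext <;> simp

def tzPos : ∀ n : ℕ, 𝟙 a ≅ R T (dg n) a
  | 0 => eAt dg_zero
  | n + 1 => tzPos n ≪≫ step t (by simp)

def tzNeg : ∀ n : ℕ, 𝟙 a ≅ R T (dg (.negSucc n)) a
  -- `Int.negSucc 0` is `-1`, so the negative powers start one step below the unit.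
  | 0 => eAt dg_zero ≪≫ (step t (k := -1) (n := 0) rfl).symm
  | n + 1 => tzNeg n ≪≫ (step t (by simp [Int.negSucc_eq])).symm

/-- The powers of `t`. -/
def tz : ∀ k : ℤ, 𝟙 a ≅ R T (dg k) a
  | .ofNat n => tzPos t n
  | .negSucc n => tzNeg t n

theorem tz_step (k n : ℤ) (h : k + 1 = n) : (tz t k).hom ≫ (step t h).hom = (tz t n).hom := by
  match k with
  | .ofNat k => subst h; rfl
  | .negSucc 0 =>
    obtain rfl : 0 = n := by simpa using h
    change ((eAt dg_zero).hom ≫ (step t (k := -1) (n := 0) rfl).inv) ≫ (step t (k := -1) (n := 0) rfl).hom =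
      (eAt dg_zero).hom
    simp
  | .negSucc (k + 1) =>
    obtain rfl : Int.negSucc k = n := by rw [← h]; simp [Int.negSucc_eq]
    change ((tzNeg t k).hom ≫ (step t h).inv) ≫ (step t h).hom = (tzNeg t k).hom
    simp

/-- Induction on the second exponent. Going down, both sides are compared after one more right
multiplication by `t`, which is invertible. -/
theorem tz_ac (k l n : ℤ) (h : k + l = n) : ac (tz t k).hom (tz t l).hom (dg_add h) = (tz t n).hom := by
  induction l using Int.induction_on generalizing n with
  | zero =>
    obtain rfl : k = n := by simpa using h
    exact (ac_eAt _ dg_zero _ (add_zero _)).trans (ac_e _ _)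
  | succ i hi =>
    subst h
    rw [← tz_step t i _ rfl, comp_step, ← ac_assoc _ _ _ (dg_add rfl) (dg_add (add_assoc k i 1)), hi _ rfl,
      ← comp_step, tz_step]
    ring
  | pred i hi =>
    have h1 : k + -(i : ℤ) = n + 1 := by rw [← h]; ring
    rw [← cancel_mono (step t (n := n + 1) rfl).hom, comp_step,
      ac_assoc _ _ _ _ _ (dg_add (show (-(i : ℤ) - 1) + 1 = -i by ring)) (dg_add h1), ← comp_step, tz_step, tz_step,
      hi _ h1]
    ring

theorem tz_one : tz t 1 = t := by
  ext1
  rw [← tz_step t 0 1 rfl, comp_step]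
  have : ∀ (l : ℤ × ZMod 2) (hl : l = 0) (h : l + dg 1 = dg 1), ac (eAt hl).hom t.hom h = t.hom := by
    rintro _ rfl h
    simp [eAt, e_ac]
  exact this _ dg_zero _

theorem Nat1.pl (hP : Nat1 (R T (0, 1) a) t.hom t.hom) (g : SpinStat) :
    Nat1 (R T (pl g) a) t.hom t.hom := by
  obtain ⟨(g : Fin 2)⟩ := g
  fin_cases g
  · exact (Nat1.id _).of_iso (SpinStat.e T a)
  · exact hP

/-- Naturality of the powers of `t` at `R T (pl g) a` lets them cross that factor at the price of a
half-braiding, and `hB` absorbs the half-braiding into multiplication. Right and left multiplication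
of `R T (pl g) a` by the powers therefore agree. -/
theorem tz_central (hP : Nat1 (R T (0, 1) a) t.hom t.hom)
    (hB : ∀ (g : SpinStat) (l l' : ℤ × ZMod 2) (h : SpinStat.pl g + l = l') (h' : l + SpinStat.pl g = l'),
      (nt T l (R T (SpinStat.pl g) a)).hom ≫ (m T h' a).hom = (m T h a).hom)
    (g : SpinStat) (k : ℤ) (h : SpinStat.pl g + dg k = l') (h' : dg k + SpinStat.pl g = l') :
    ac (𝟙 (R T (SpinStat.pl g) a)) (tz t k).hom h =
      (λ_ _).inv ≫ (tz t k).hom ▷ R T (SpinStat.pl g) a ≫ (m T h' a).hom := by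
  have h1 : Nat1 (R T (SpinStat.pl g) a) (tz t 1).hom (tz t 1).hom := by
    rw [tz_one]; exact Nat1.pl t hP g
  have h2 := Nat1.all (tz_ac t) (tz_ac t) h1 k
  rw [Nat1.iff] at h2
  rw [← Category.assoc, ← h2, Category.assoc, Category.assoc, hB g _ _ h h']
  simp [ac]
end powers
end
end SpinStat

/-! ### The fixed point built from a trivialization. -/

namespace HFP
open SpinStat
variable {𝓑 : Type u} [Bicategory.{w, v} 𝓑] {T : SpinStat.Lab ⥤ NatEnd 𝓑} [T.Monoidal] {a : 𝓑}
  (t : 𝟙 a ≅ R T (dg 1) a)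

/-- The fillers determined by `t`. -/
def fill {g g' : SpinStat} {l : ℤ × ZMod 2} (p : Ad g g' l) : R T (pl g) a ≅ R T l a ≫ R T (pl g') a :=
  (ρ_ _).symm ≪≫ whiskerLeftIso _ (tz t l.1) ≪≫ m T (add_dg p) a ≪≫ (m T rfl a).symm

variable {g g' g'' : SpinStat} {l l' l'' : ℤ × ZMod 2}

/-- This is the counterpart of `Fr_κ`. The multiplication is invertible, so the axioms on fillers
can be checked after composing with it, where they concern only powers of `t`. -/
theorem fill_m (p : Ad g g' l) (h : l + pl g' = l') (h' : pl g + dg l.1 = l') :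
    (fill t p).hom ≫ (m T h a).hom = ac (𝟙 _) (tz t l.1).hom h' := by
  subst h
  simp [fill, ac]

/-- The zeroth power of `t` is the unit. The fillers of identities, unitors and associators enter
the axioms of a fixed point in this form. -/
theorem fill_zero (p : Ad g g' 0) (h : pl g + 0 = pl g') :
    (fill t p).hom ≫ (e T a).inv ▷ _ ≫ (λ_ _).hom = ac (𝟙 _) (e T a).hom h := by
  have : (e T a).inv ▷ R T (pl g') a ≫ (λ_ _).hom = (m T (zero_add _) a).hom := by
    rw [← e_mul T a (zero_add _)]; simp
  rw [this]
  refine (fill_m t p _ (by simpa using h)).trans ?_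
  exact ac_eAt _ dg_zero _ _

theorem pl_tens_zero (h : g.val = g'.val) : pl g + 0 = pl g' := by
  simp [pl, h]

/-- The homotopy fixed point determined by a trivialization of `ν (-1)^F` that is natural at `(-1)^F`. -/
def std (hP : Nat1 (R T (0, 1) a) t.hom t.hom)
    (hB : ∀ (g : SpinStat) (l l' : ℤ × ZMod 2) (h : pl g + l = l') (h' : l + pl g = l'),
      (nt T l (R T (pl g) a)).hom ≫ (m T h' a).hom = (m T h a).hom) : HFP T where
  pt := a
  E g := R T (pl g) a
  φ g' g := m T (pl_add g g') a
  ι := e T a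
  F {g g'} γ := fill t (l := (γ.k, γ.e)) γ.prop
  F_id g := by
    erw [isoAp_actZero]
    have p : Ad g g 0 := by simp [Ad]
    have := fill_zero t p (add_zero _)
    rw [ac_e] at this
    change (fill t p).hom = (λ_ (R T (pl g) a)).inv ≫ (e T a).hom ▷ R T (pl g) a
    rw [← cancel_mono ((e T a).inv ▷ _), ← cancel_mono (λ_ _).hom]
    simp [this]
  F_comp {g g' g''} γ γ' := by
    rw [isoAp_actComp]
    have p : Ad g g' (γ.k, γ.e) := γ.prop
    have p' : Ad g' g'' (γ'.k, γ'.e) := γ'.prop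
    have p'' : Ad g g'' ((γ.k, γ.e) + (γ'.k, γ'.e)) := p.add p' rfl
    change (fill t p'').hom = (fill t p).hom ≫ R T (γ.k, γ.e) a ◁ (fill t p').hom ≫ (α_ _ _ _).inv ≫
      (m T rfl a).hom ▷ _
    -- After cancelling the multiplication, compatibility with composition is the multiplicativity
    -- `tz_ac` of the powers.
    rw [← cancel_mono (m T rfl a).hom, fill_m t p'' rfl (add_dg p'')]
    simp only [Category.assoc]
    rw [m_assoc T a rfl rfl rfl (add_assoc _ _ _).symm, Iso.inv_hom_id_assoc, ← whiskerLeft_comp_assoc,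
      fill_m t p' rfl (add_dg p')]
    rw [← m_ac _ rfl, ← Category.assoc, fill_m t p rfl (add_dg p), ← comp_ac, Category.comp_id,
      ac_assoc _ _ _ _ _ (dg_add rfl), tz_ac t _ _ _ rfl]
    · rfl
    · rw [add_assoc, add_dg p', add_assoc]
  unit_left g := by
    erw [isoAp_actZero]
    have p : Ad (tens ⟨0⟩ g) g 0 := by
      change ((0 : ℤ) : ZMod 2) + 0 = g.val - (0 + g.val)
      simp
    have h0 : pl g + 0 = pl (tens ⟨0⟩ g) := pl_add g ⟨0⟩
    have h := fill_zero t p (pl_tens_zero (zero_add g.val))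
    change R T (pl g) a ◁ (e T a).hom ≫ (m T h0 a).hom ≫ (fill t p).hom ≫ (e T a).inv ▷ R T (pl g) a ≫
      (λ_ (R T (pl g) a)).hom = (ρ_ (R T (pl g) a)).hom
    rw [h, m_ac_e _ _ (add_zero _), mul_e]
  unit_right g := by
    erw [isoAp_actZero]
    have p : Ad (tens g ⟨0⟩) g 0 := by
      change ((0 : ℤ) : ZMod 2) + 0 = g.val - (g.val + 0)
      simp
    have h0 : 0 + pl g = pl (tens g ⟨0⟩) := pl_add ⟨0⟩ g
    have h := fill_zero t p (pl_tens_zero (add_zero g.val))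
    change (e T a).hom ▷ R T (pl g) a ≫ (m T h0 a).hom ≫ (fill t p).hom ≫ (e T a).inv ▷ R T (pl g) a ≫
      (λ_ (R T (pl g) a)).hom = (λ_ (R T (pl g) a)).hom
    rw [h, m_ac_e _ _ (zero_add _), e_mul]
  assoc g'' g' g := by
    erw [isoAp_actZero]
    have p : Ad (tens g'' (tens g' g)) (tens (tens g'' g') g) 0 := by
      change ((0 : ℤ) : ZMod 2) + 0 = (g''.val + g'.val + g.val) - (g''.val + (g'.val + g.val))
      simp [add_assoc]
    have h0 : pl (tens g'' (tens g' g)) + 0 = pl (tens (tens g'' g') g) :=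
      pl_tens_zero (add_assoc _ _ _).symm
    have h := fill_zero t p h0
    change R T (pl g) a ◁ (m T (pl_add g' g'') a).hom ≫ (m T (pl_add g (tens g'' g')) a).hom =
      (α_ _ _ _).inv ≫ (m T (pl_add g g') a).hom ▷ R T (pl g'') a ≫ (m T (pl_add (tens g' g) g'') a).hom ≫
        (fill t p).hom ≫ (e T a).inv ▷ _ ≫ (λ_ _).hom
    have h1 := pl_add (tens g' g) g''
    rw [h, m_ac_e _ _ (by rw [h1, ← h0, add_zero]), m_assoc T a _ _ (pl_add g' g'') (pl_add g (tens g'' g'))]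
    simp
  tensor_right g₂ g₁ g₁' γ := by
    have p : Ad g₁ g₁' (γ.k, γ.e) := γ.prop
    have p' : Ad (tens g₂ g₁) (tens g₂ g₁') (γ.k, γ.e) := (MonoidalCategoryStruct.whiskerLeft g₂ γ).prop
    change (m T (pl_add g₁ g₂) a).hom ≫ (fill t p').hom = (fill t p).hom ▷ R T (pl g₂) a ≫ (α_ _ _ _).hom ≫
      R T (γ.k, γ.e) a ◁ (m T (pl_add g₁' g₂) a).hom
    rw [← cancel_mono (m T rfl a).hom]
    simp only [Category.assoc]
    have h1 : (γ.k, γ.e) + pl g₁' + pl g₂ = (γ.k, γ.e) + pl (tens g₂ g₁') := by rw [add_assoc, pl_add]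
    have h2 : pl (tens g₂ g₁) + dg γ.k = (γ.k, γ.e) + pl (tens g₂ g₁') := add_dg p'
    have h3 : pl g₁ + (pl g₂ + dg γ.k) = (γ.k, γ.e) + pl (tens g₂ g₁') := by
      rw [← h2, ← pl_add g₁ g₂, add_assoc]
    have h4 : pl g₁ + dg γ.k = (γ.k, γ.e) + pl g₁' := add_dg p
    -- On the left the power of `t` stands to the right of the factor for `g₂`, on the right between
    -- the factors for `g₁` and `g₂`. Centrality moves it across.
    rw [fill_m t p' rfl h2, ← m_assoc T a rfl h1, m_ac _ _ _ rfl h3, tz_central t hP hB g₂ _ rfl (add_comm _ _),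
      ← comp_whiskerRight_assoc, fill_m t p rfl h4]
    unfold ac
    simp only [comp_whiskerRight, Category.assoc]
    rw [m_assoc T a h4 h1 (add_comm _ _) h3]
    simp
  tensor_left {g₂ g₂'} γ g₁ := by
    have p : Ad g₂ g₂' (γ.k, γ.e) := γ.prop
    have p' : Ad (tens g₂ g₁) (tens g₂' g₁) (γ.k, γ.e) := (MonoidalCategoryStruct.whiskerRight γ g₁).prop
    change (m T (pl_add g₁ g₂) a).hom ≫ (fill t p').hom = R T (pl g₁) a ◁ (fill t p).hom ≫ (α_ _ _ _).inv ≫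
      (nt T (γ.k, γ.e) (R T (pl g₁) a)).hom ▷ _ ≫ (α_ _ _ _).hom ≫
      R T (γ.k, γ.e) a ◁ (m T (pl_add g₁ g₂') a).hom
    rw [← cancel_mono (m T rfl a).hom]
    simp only [Category.assoc]
    have h1 : (γ.k, γ.e) + pl g₁ + pl g₂' = (γ.k, γ.e) + pl (tens g₂' g₁) := by rw [add_assoc, pl_add]
    have h2 : pl (tens g₂ g₁) + dg γ.k = (γ.k, γ.e) + pl (tens g₂' g₁) := add_dg p'
    have h3 : pl g₁ + (pl g₂ + dg γ.k) = (γ.k, γ.e) + pl (tens g₂' g₁) := by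
      rw [← h2, ← pl_add g₁ g₂, add_assoc]
    have h4 : pl g₂ + dg γ.k = (γ.k, γ.e) + pl g₂' := add_dg p
    have h5 : pl g₁ + ((γ.k, γ.e) + pl g₂') = (γ.k, γ.e) + pl (tens g₂' g₁) := by
      rw [← h4, h3]
    -- Here the power of `t` is rightmost on both sides. Only the transformation with the label of
    -- `γ` has to cross the factor for `g₁`, and `hB` absorbs this crossing.
    rw [fill_m t p' rfl h2, ← m_assoc T a rfl h1, m_ac _ _ _ rfl h3, ← comp_whiskerRight_assoc,
      hB g₁ _ _ (add_comm _ _) rfl, m_assoc T a _ _ rfl h5, Iso.inv_hom_id_assoc, ← whiskerLeft_comp_assoc,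
      fill_m t p rfl h4]
    -- The two sides now differ only in the name of the intermediate label, which is generalized so
    -- that it can be substituted.
    have : ∀ (l : ℤ × ZMod 2) (hl : pl g₂ + dg γ.k = l) (h : pl g₁ + l = (γ.k, γ.e) + pl (tens g₂' g₁)),
      R T (pl g₁) a ◁ ac (𝟙 (R T (pl g₂) a)) (tz t γ.k).hom rfl ≫ (m T h3 a).hom =
        R T (pl g₁) a ◁ ac (𝟙 (R T (pl g₂) a)) (tz t γ.k).hom hl ≫ (m T h a).hom := by
      rintro _ rfl h; rfl
    exact this _ h4 h5

/-- The filler of `(1, 1) : 1 ⟶ 1` is multiplication by the first power of `t`, so restricting it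
along the unit returns `t`. Thus every admissible trivialization arises from a fixed point. -/
theorem std_τ (hP : Nat1 (R T (0, 1) a) t.hom t.hom)
    (hB : ∀ (g : SpinStat) (l l' : ℤ × ZMod 2) (h : pl g + l = l') (h' : l + pl g = l'),
      (nt T l (R T (pl g) a)).hom ≫ (m T h' a).hom = (m T h a).hom) : (std t hP hB).τ 1 = t := by
  ext1
  have h1 : R T (dg 1) a ◁ (e T a).inv ≫ (ρ_ _).hom = (m T (add_zero _) a).hom := by
    rw [← mul_e T a (add_zero _)]; simp
  change (e T a).hom ≫ ((fill t (ad_dg 1)).hom ≫ R T (dg 1) a ◁ (e T a).inv ≫ (ρ_ _).hom) = t.hom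
  rw [h1]
  have h2 := fill_m t (ad_dg 1) (add_zero _) (zero_add _)
  refine (congrArg ((e T a).hom ≫ ·) h2).trans ?_
  have h3 : ac (𝟙 (R T 0 a)) (tz t 1).hom (zero_add _) = (e T a).inv ≫ t.hom := by
    rw [tz_one, ← cancel_epi (e T a).hom, ← comp_ac, Category.comp_id, e_ac]; simp
  refine (congrArg ((e T a).hom ≫ ·) h3).trans ?_
  simp

end HFP

end

/-! ### The braiding of powers of `(-1)^F` with all labels. -/

section
open MonoidalCategory
variable {C : Type u} [Category.{v} C] [MonoidalCategory C] [BraidedCategory C]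

/-- `tensorμ` crosses its two middle factors. With a trivial first factor only the crossing of `G`
and `A` survives. -/
theorem tensorμ_leftUnitor (A E G : C) :
    tensorμ (𝟙_ C) G A E ≫ (λ_ A).hom ▷ (G ⊗ E) =
      (λ_ G).hom ▷ (A ⊗ E) ≫ (α_ G A E).inv ≫ (β_ G A).hom ▷ E ≫ (α_ A G E).hom := by
  simp only [tensorμ, Category.assoc]
  monoidal

theorem tensorμ_rightUnitor (A E G : C) :
    (A ⊗ E) ◁ (λ_ G).inv ≫ tensorμ A E (𝟙_ C) G ≫ (ρ_ A).hom ▷ (E ⊗ G) = (α_ A E G).hom := by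
  simp only [tensorμ, Category.assoc, braiding_tensorUnit_right]
  monoidal

/-- By the hexagon, `G` crosses `A ⊗ E` by crossing first `A` and then `E`. The crossing with `A` is
already part of the `tensorμ` on the right, so the two sides differ by the crossing of `G` and `E`
alone. -/
theorem braiding_tensorμ (A E G : C) :
    (β_ (𝟙_ C ⊗ G) (A ⊗ E)).hom ≫ tensorμ A E (𝟙_ C) G ≫ (ρ_ A).hom ▷ (E ⊗ G) =
      tensorμ (𝟙_ C) G A E ≫ (λ_ A).hom ▷ (G ⊗ E) ≫ A ◁ (β_ G E).hom := by
  have h1 : (β_ (𝟙_ C ⊗ G) (A ⊗ E)).hom = (λ_ G).hom ▷ _ ≫ (β_ G (A ⊗ E)).hom ≫ _ ◁ (λ_ G).inv := by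
    have := BraidedCategory.braiding_naturality_left (λ_ G).hom (A ⊗ E)
    rw [reassoc_of% this]; simp
  rw [h1, Category.assoc, Category.assoc, tensorμ_rightUnitor, reassoc_of% tensorμ_leftUnitor]
  simp

namespace SpinStat
variable (X F : C) [(MonoidalCategory.tensorLeft X).IsEquivalence] (i : F ⊗ F ≅ 𝟙_ C)
  (hi : i.hom ▷ F ≫ (λ_ F).hom = (α_ F F F).hom ≫ F ◁ i.hom ≫ (ρ_ F).hom)

/-- Unit coherence settles every case except that of two factors `F`, where `hF` is needed. -/
theorem SqPow_mul_comm (hF : (β_ F F).hom = 𝟙 _) (g e : ZMod 2) :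
    (β_ (SqPow.pow F g) (SqPow.pow F e)).hom ≫ (SqPow.mul F i e g).hom =
      (SqPow.mul F i g e).hom ≫ eqToHom (by rw [add_comm]) := by
  obtain ⟨g, hg⟩ : ∃ g' : Fin 2, g = g' := ⟨g, rfl⟩
  obtain ⟨e, he⟩ : ∃ g' : Fin 2, e = g' := ⟨e, rfl⟩
  subst hg he
  fin_cases g <;> fin_cases e
  · change (β_ (𝟙_ C) (𝟙_ C)).hom ≫ (λ_ (𝟙_ C)).hom = (λ_ (𝟙_ C)).hom ≫ 𝟙 _
    simp [← unitors_equal]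
  · change (β_ (𝟙_ C) F).hom ≫ (ρ_ F).hom = (λ_ F).hom ≫ 𝟙 _
    simp
  · change (β_ F (𝟙_ C)).hom ≫ (λ_ F).hom = (ρ_ F).hom ≫ 𝟙 _
    simp
  · change (β_ F F).hom ≫ i.hom = i.hom ≫ 𝟙 _
    simp [hF]

omit [BraidedCategory C] in
theorem pow_eqToHom {m m' : ℤ} {n n' : ZMod 2} (hm : m = m') (hn : n = n')
    (h : ZPow.pow X m ⊗ SqPow.pow F n = ZPow.pow X m' ⊗ SqPow.pow F n') :
    eqToHom h = (ZPow.pcast X hm).hom ▷ _ ≫ _ ◁ eqToHom (by rw [hn]) := by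
  subst hm hn
  simp [ZPow.pcast_rfl]

/-- The combined powers of `X` and `F`. -/
noncomputable abbrev powers : Lab ⥤ C :=
  ((ZPow.functor X).prod (SqPow.functor F)) ⋙ MonoidalCategory.tensor C

/-- The crossing of `F` with powers of `X` is the one used to multiply labels, so no condition on it
arises; the remaining crossing of `F` with itself is trivial by `hF`. The condition `hB` of
`HFP.std` is this identity at the level of components. -/
theorem braiding_powers (hF : (β_ F F).hom = 𝟙 _) (g : ZMod 2) (l l' : ℤ × ZMod 2)
    (h : (0, g) + l = l') (h' : l + (0, g) = l') :
    letI : (SqPow.functor F).Monoidal := SqPow.monoidal F i hi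
    (β_ ((powers X F).obj (⟨0⟩, ⟨g⟩)) ((powers X F).obj (⟨l.1⟩, ⟨l.2⟩))).hom ≫
      Functor.LaxMonoidal.μ (powers X F) (⟨l.1⟩, ⟨l.2⟩) (⟨0⟩, ⟨g⟩) ≫
        eqToHom (congrArg (powers X F).obj (tensor_lab h')) =
      Functor.LaxMonoidal.μ (powers X F) (⟨0⟩, ⟨g⟩) (⟨l.1⟩, ⟨l.2⟩) ≫
        eqToHom (congrArg (powers X F).obj (tensor_lab h)) := by
  obtain ⟨k, e⟩ := l
  obtain ⟨k', e'⟩ := l'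
  have hk : k + 0 = k' := congrArg Prod.fst h'
  have hk' : 0 + k = k' := congrArg Prod.fst h
  have he : e + g = e' := congrArg Prod.snd h'
  have he' : g + e = e' := congrArg Prod.snd h
  obtain rfl : k = k' := by simpa using hk
  have h1 : (ZPow.mul X 0 k).hom ≫ (ZPow.pcast X (zero_add k)).hom = (λ_ (ZPow.pow X k)).hom :=
    (Category.assoc (λ_ (ZPow.pow X k)).hom (ZPow.pcast X (zero_add k).symm).hom (ZPow.pcast X (zero_add k)).hom).trans
      (by rw [ZPow.pcast_trans, ZPow.pcast_rfl]; exact Category.comp_id _)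
  have key : ∀ {P Q P' Q' P'' Q'' : C} (p : P ⟶ P') (q : Q ⟶ Q') (p' : P' ⟶ P'') (q' : Q' ⟶ Q''),
      (p ⊗ₘ q) ≫ p' ▷ Q' ≫ P'' ◁ q' = (p ≫ p') ▷ Q ≫ P'' ◁ (q ≫ q') := by
    intros
    rw [MonoidalCategory.tensorHom_def, Category.assoc, MonoidalCategory.whisker_exchange_assoc]
    simp
  have h2 : (β_ (SqPow.pow F g) (SqPow.pow F e)).hom ≫ (SqPow.mul F i e g).hom ≫ eqToHom (by rw [he]) =
      (SqPow.mul F i g e).hom ≫ eqToHom (by rw [he']) := by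
    rw [reassoc_of% SqPow_mul_comm F i hF g e]; simp
  have main : (β_ (ZPow.pow X 0 ⊗ SqPow.pow F g) (ZPow.pow X k ⊗ SqPow.pow F e)).hom ≫
    (tensorμ (ZPow.pow X k) (SqPow.pow F e) (ZPow.pow X 0) (SqPow.pow F g) ≫
      ((ZPow.mul X k 0).hom ⊗ₘ (SqPow.mul F i e g).hom)) ≫
        eqToHom (show _ = ZPow.pow X k ⊗ SqPow.pow F e' by rw [add_zero, he]) =
    (tensorμ (ZPow.pow X 0) (SqPow.pow F g) (ZPow.pow X k) (SqPow.pow F e) ≫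
      ((ZPow.mul X 0 k).hom ⊗ₘ (SqPow.mul F i g e).hom)) ≫
        eqToHom (show _ = ZPow.pow X k ⊗ SqPow.pow F e' by rw [zero_add, he']) := by
    rw [pow_eqToHom X F (add_zero k) he, pow_eqToHom X F (zero_add k) he', Category.assoc, Category.assoc, key, key,
      ← ZPow.mul_unit, h1, ← h2]
    refine ((reassoc_of% (braiding_tensorμ (ZPow.pow X k) (SqPow.pow F e) (SqPow.pow F g))) _).trans ?_
    rw [← MonoidalCategory.whiskerLeft_comp]
    rfl
  exact main
end SpinStat
end

/-! ### Bimodules tensored with the twist, and functionals as trivializations. -/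

section
open scoped Bicategory Pseudofunctor.StrongTrans
open Bicategory

namespace SBimod
variable {A B : SuperAlg.{u}}

/-- `a F ⊗ m ↦ (-1)^{|a|} a m`. -/
def untwist (M : SBimod B A) : comp (twist B) M →ₗ[ℂ] M :=
  clift (M.l ∘ₗ B.par.toLinearMap ∘ₗ (toTwist B).symm.toLinearMap) (by
    intro x b m
    induction x using toTwist_ind; simp [M.l_mul])

@[simp] theorem untwist_t (M : SBimod B A) (b : B) (m : M) :
    untwist M (t (twist B) M (toTwist B b) m) = M.l (B.par b) m := by
  simp [untwist]

/-- Writing `F` for the generator, `b F = F (-1)^{|b|} b`. Hence every element of the tensor product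
has the form `F ⊗ m`, and `untwist` reads off this `m`. -/
theorem twist_t (M : SBimod B A) (b : B) (m : M) :
    t (twist B) M (toTwist B b) m = t (twist B) M (toTwist B 1) (M.l (B.par b) m) := by
  rw [← t_bal]; simp

theorem t_untwist (M : SBimod B A) (x : comp (twist B) M) : t (twist B) M (toTwist B 1) (untwist M x) = x := by
  induction x using ind with
  | h0 => simp
  | ha x y hx hy => simp only [map_add, hx, hy]
  | ht b m =>
    induction b using toTwist_ind with | h b
    rw [untwist_t, ← twist_t]

theorem untwist_l (M : SBimod B A) (b : B) (x : comp (twist B) M) :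
    untwist M ((comp (twist B) M).l b x) = M.l (B.par b) (untwist M x) := by
  induction x using ind with
  | h0 => simp
  | ha x y hx hy => simp only [map_add, hx, hy]
  | ht b m =>
    induction b using toTwist_ind with | h b
    simp [M.l_mul]

theorem untwist_r (M : SBimod B A) (a : A) (x : comp (twist B) M) :
    untwist M ((comp (twist B) M).r a x) = M.r a (untwist M x) := by
  induction x using ind with
  | h0 => simp
  | ha x y hx hy => simp only [map_add, hx, hy]
  | ht b m =>
    induction b using toTwist_ind with | h b
    simp [M.l_r]

theorem untwist_par (M : SBimod B A) (x : comp (twist B) M) :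
    untwist M ((comp (twist B) M).par x) = M.par (untwist M x) := by
  induction x using ind with
  | h0 => simp
  | ha x y hx hy => simp only [map_add, hx, hy]
  | ht b m =>
    induction b using toTwist_ind with | h b
    simp

/-- Moving `(-1)^F` past `M`: `m ⊗ f ↦ (-1)^{|m|} m ⊗ (F ⊗ f)`. -/
def slide (M : SBimod B A) (P : SBimod A A) : comp M P →ₗ[ℂ] comp M (comp (twist A) P) :=
  ((assoc (twist B) M P).hom ≫ homMap (twistNat M).hom (𝟙 P) ≫ (assoc M (twist A) P).inv).map ∘ₗ
    t (twist B) (comp M P) (toTwist B 1)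

theorem slide_t (M : SBimod B A) (P : SBimod A A) (m : M) (f : P) :
    slide M P (t M P m f) = t M (comp (twist A) P) (M.par m) (t (twist A) P (toTwist A 1) f) := by
  simp [slide, twistNat]

/-- This left inverse makes `slide` injective, so that identities may be tested after `F` has been
moved past `M`. -/
def unslide (M : SBimod B A) (P : SBimod A A) : comp M (comp (twist A) P) →ₗ[ℂ] comp M P :=
  clift ((t M P).compl₁₂ M.par (untwist P)) (by
    intro m a x
    simp [untwist_l, t_bal])

theorem unslide_slide (M : SBimod B A) (P : SBimod A A) (x : comp M P) : unslide M P (slide M P x) = x := by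
  have : unslide M P ∘ₗ slide M P = LinearMap.id := lin_ext fun m f => by
    simp [slide_t, unslide]
  exact LinearMap.congr_fun this x

theorem slide_injective (M : SBimod B A) (P : SBimod A A) : Function.Injective (slide M P) :=
  Function.LeftInverse.injective (unslide_slide M P)

/-! Trivializations of `(-1)^F A^*` and functionals. -/

/-- The functional `f` such that the map sends `1` to `F ⊗ f`. -/
def functional (p : reg A ⟶ comp (twist A) (dual A)) : A →ₗ[ℂ] ℂ :=
  ev A (untwist (dual A) (p.map (toReg A 1)))

theorem functional_spec (p : reg A ⟶ comp (twist A) (dual A)) :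
    p.map (toReg A 1) = t (twist A) (dual A) (toTwist A 1) ((ev A).symm (functional p)) := by
  simp [functional, t_untwist]

/-- Right linearity: `p(a) = p(1) a`, that is, `F ⊗ λ(a ·)`. -/
theorem functional_mul (p : reg A ⟶ comp (twist A) (dual A)) (a b : A) :
    ev A (untwist (dual A) (p.map (toReg A a))) b = functional p (a * b) := by
  have : toReg A a = (reg A).r a (toReg A 1) := by simp
  rw [this, p.map_r, untwist_r, ev_r]; rfl

/-- Left linearity gives a second expression `p(a) = a p(1)`. Passing `a` through `F` produces the
same sign as the left action on `A^*`; the two cancel, which is why the symmetry is ungraded. -/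
theorem functional_symm (p : reg A ⟶ comp (twist A) (dual A)) (a b : A) :
    functional p (a * b) = functional p (b * a) := by
  rw [← functional_mul]
  have : toReg A a = (reg A).l a (toReg A 1) := by simp
  rw [this, p.map_l, untwist_l, ev_l, SuperAlg.par_par]; rfl

/-- Both `p` and the element `1` are even, so the image of `1` is even. -/
theorem functional_par (p : reg A ⟶ comp (twist A) (dual A)) (a : A) :
    functional p (A.par a) = functional p a := by
  have h := p.map_par (toReg A 1)
  rw [reg_par, map_one] at h
  have h2 := congrArg (fun x => ev A (untwist (dual A) x) a) h
  simp only [untwist_par, ev_par] at h2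
  exact h2.symm

theorem functional_odd (p : reg A ⟶ comp (twist A) (dual A)) (a : A) (ha : A.par a = -a) : functional p a = 0 := by
  have h := functional_par p a
  rw [ha, map_neg] at h
  exact self_eq_neg.1 h.symm

/-- Since `p(a) = F ⊗ λ(a ·)`, the left radical of the pairing is the kernel of `p`. -/
theorem functional_nondegenerate (p : reg A ≅ comp (twist A) (dual A)) (a : A)
    (h : ∀ b, functional p.hom (a * b) = 0) : a = 0 := by
  have h1 : untwist (dual A) (p.hom.map (toReg A a)) = 0 := dual_ext fun b => by
    rw [functional_mul, h]; simp
  have h2 : p.hom.map (toReg A a) = 0 := by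
    rw [← t_untwist _ (p.hom.map _), h1, map_zero]
  have h3 := congrArg p.inv.map h2
  simpa using h3

section
variable (f : A →ₗ[ℂ] ℂ) (hp : ∀ a, f (A.par a) = f a) (hs : ∀ a b, f (a * b) = f (b * a))

/-- `a ↦ F ⊗ f a`. -/
def ofFunctional : reg A ⟶ comp (twist A) (dual A) where
  map := t (twist A) (dual A) (toTwist A 1) ∘ₗ (dual A).r.flip ((ev A).symm f) ∘ₗ (toReg A).symm.toLinearMap
  map_l b a := by
    obtain ⟨a, rfl⟩ := (toReg A).surjective a
    simp only [LinearMap.comp_apply, reg_l, LinearEquiv.coe_coe, LinearEquiv.symm_apply_apply, LinearMap.flip_apply,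
      comp_l, twist_l, mul_one]
    rw [twist_t (dual A) b]
    congr 1
    apply dual_ext; intro x
    simp only [ev_r, ev_l, LinearEquiv.apply_symm_apply, SuperAlg.par_par]
    rw [mul_assoc, hs, mul_assoc]
  map_r b a := by
    obtain ⟨a, rfl⟩ := (toReg A).surjective a
    simp [(dual A).r_mul]
  map_par a := by
    obtain ⟨a, rfl⟩ := (toReg A).surjective a
    simp only [LinearMap.comp_apply, reg_par, LinearEquiv.coe_coe, LinearEquiv.symm_apply_apply, LinearMap.flip_apply,
      comp_par, twist_par, map_one]
    congr 1
    apply dual_ext; intro x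
    rw [ev_par, ev_r, ev_r, LinearEquiv.apply_symm_apply, ← hp, map_mul, SuperAlg.par_par]

theorem ofFunctional_map (a : A) : (ofFunctional f hp hs).map (toReg A a) =
    t (twist A) (dual A) (toTwist A 1) ((dual A).r a ((ev A).symm f)) := rfl

theorem functional_ofFunctional : functional (ofFunctional f hp hs) = f := by
  ext a
  rw [functional, ofFunctional_map]
  simp

variable [FiniteDimensional ℂ A] (hn : ∀ a, (∀ b, f (a * b) = 0) → a = 0)

/-- The isomorphism `A ⟶ (-1)^F ⊗ A^*` determined by a nondegenerate functional. -/
noncomputable def isoOfFunctional : reg A ≅ comp (twist A) (dual A) :=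
  let r : A →ₗ[ℂ] A →ₗ[ℂ] ℂ := (LinearMap.mul ℂ A).compr₂ f
  have hr : Function.Injective r := by
    rw [injective_iff_map_eq_zero]
    intro a ha
    exact hn a fun b => LinearMap.congr_fun ha b
  -- Nondegeneracy gives only injectivity of `a ↦ λ(a ·)`; surjectivity onto the dual is a dimension
  -- count.
  let i : A ≃ₗ[ℂ] (A →ₗ[ℂ] ℂ) := LinearEquiv.ofInjectiveOfFinrankEq r hr
    (Subspace.dual_finrank_eq (K := ℂ) (V := A)).symm
  have hi : ∀ a, (dual A).r a ((ev A).symm f) = (ev A).symm (i a) := fun a => rfl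
  let g : comp (twist A) (dual A) →ₗ[ℂ] reg A := (toReg A).toLinearMap ∘ₗ i.symm.toLinearMap ∘ₗ
    (ev A).toLinearMap ∘ₗ untwist (dual A)
  have h1 : ∀ x, g ((ofFunctional f hp hs).map x) = x := fun x => by
    obtain ⟨x, rfl⟩ := (toReg A).surjective x
    rw [ofFunctional_map, hi]
    simp [g]
  have h2 : ∀ x, (ofFunctional f hp hs).map (g x) = x := fun x => by
    change (ofFunctional f hp hs).map (toReg A (i.symm (ev A (untwist (dual A) x)))) = x
    rw [ofFunctional_map, hi]
    simp [t_untwist]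
  { hom := ofFunctional f hp hs
    inv := invHom (ofFunctional f hp hs) g h1 h2
    hom_inv_id := by ext x; exact h1 x
    inv_hom_id := by ext x; exact h2 x }
end

/-! The Serre naturality of the twist. -/

/-- Once all coefficients are moved to the left factor, the sign in the naturality of `(-1)^F` is
that of the generator `F`, which is even. -/
theorem twistNat_twist (A : SuperAlg.{u}) : (twistNat (twist A)).hom = 𝟙 _ := by
  apply comp_hom_ext
  intro x y
  induction x using toTwist_ind
  induction y using toTwist_ind with | h b
  rw [id_map, t_twist]
  simp [twistNat]

/-- The twist is its own inverse, and the element of the tensor square contracting to `1` is `F ⊗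
F`. This makes the Serre isomorphism at the twist explicit. -/
def twistCtx (A : SuperAlg.{u}) : Ctx (twist A) where
  N := twist A
  hI := twistSq A
  eI := twistSq A
  snake m n m' := by
    induction m using toTwist_ind
    induction n using toTwist_ind
    induction m' using toTwist_ind
    simp [twistSq, mul_assoc]

/-- At `m = x F` the functional `nfm` is `a ↦ f(x · par a)`. Invariance under parity and symmetry
rewrite it as `a ↦ f(a · par x)`, which is the left action of `x` on `f`. So an even symmetric
functional meets the condition on 1-morphisms at the twist automatically. -/
theorem twistCtx_serre (f : A →ₗ[ℂ] ℂ) (hp : ∀ a, f (A.par a) = f a) (hs : ∀ a b, f (a * b) = f (b * a))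
    (m : twist A) : (twistCtx A).serreHom.map (t (dual A) (twist A) ((ev A).symm f) m) =
      t (twist A) (dual A) ((twist A).par m) ((ev A).symm f) := by
  induction m using toTwist_ind with | h x
  have hu : (twistCtx A).u = t (twist A) (twist A) (toTwist A 1) (toTwist A 1) := rfl
  rw [Ctx.serreHom_t, hu]
  refine ((twistCtx A).ζ_t _ _ _ _).trans ?_
  rw [twist_par, twist_t (dual A) (A.par x), SuperAlg.par_par]
  congr 1
  apply dual_ext; intro a
  refine (Ctx.ev_nfm (twistCtx A) (toTwist A 1) ((ev A).symm f) (toTwist A x) a).trans ?_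
  have : (twistCtx A).eps ((twist A).r a (toTwist A x)) ((twistCtx A).N.par (toTwist A 1)) = x * A.par a := by
    have h2 : (twistCtx A).eps (toTwist A (x * A.par a)) (toTwist A (A.par 1)) = x * A.par a * A.par (A.par 1) :=
      congrArg (toReg A).symm (twistSqHom_t (x * A.par a) (A.par 1))
    exact h2.trans (by simp)
  rw [this, ev_l, LinearEquiv.apply_symm_apply, ← hp, map_mul, SuperAlg.par_par, hs]

/-- Naturality at the identity of `M` compares any two contexts. The arbitrary choice in
`SAlgFd.ctx` can thus be replaced by an explicit one. -/
theorem Ctx.serreHom_eq {M : SBimod B A} (c c' : Ctx M) : c.serreHom = c'.serreHom := by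
  have h := c.serre_nat c' (Iso.refl M)
  apply comp_hom_ext
  intro x y
  have := congrArg (fun k => Hom.map k (t (dual B) M x y)) h
  have hid : homMap (𝟙 M) (𝟙 (dual A)) = 𝟙 _ := comp_hom_ext fun x y => by simp
  simp only [Iso.refl_hom] at this
  rw [hid] at this
  simpa using this.symm

end SBimod

namespace SpinStat
-- This allows the transformation with label `l` to be replaced by an isomorphic model in which
-- elements can be computed.
theorem Nat1.iff_of_iso {𝓑 : Type u} [Bicategory.{w, v} 𝓑] {T : Lab ⥤ NatEnd 𝓑} {l : ℤ × ZMod 2} {a b : 𝓑}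
    {p : a ⟶ a} {q : b ⟶ b} (i : R T l a ≅ p) (j : R T l b ≅ q) (f : a ⟶ b) (k : f ≫ q ⟶ p ≫ f)
    (hk : f ◁ j.hom ≫ k = (nt T l f).hom ≫ i.hom ▷ f) (s : 𝟙 a ⟶ R T l a) (s' : 𝟙 b ⟶ R T l b) :
    Nat1 f s s' ↔ (ρ_ f).inv ≫ f ◁ (s' ≫ j.hom) ≫ k = (λ_ f).inv ≫ (s ≫ i.hom) ▷ f := by
  rw [Nat1.iff, Bicategory.whiskerLeft_comp, Category.assoc, hk, comp_whiskerRight, ← cancel_mono (i.hom ▷ f)]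
  simp only [Category.assoc]
end SpinStat

/-! ### The hypotheses of the general construction in `sAlg^fd`. -/

namespace SAlgFd
open SpinStat

theorem braiding_parity : (BraidedCategory.braiding parity.{u} parity).hom = 𝟙 _ :=
  NatEnd.hom_ext fun A => hom₂_ext (SBimod.twistNat_twist A.obj.alg)

/-- The braiding of `NatEnd` has the naturality constraints `nt` as its components, so this is
`braiding_powers` evaluated at `A`. -/
theorem nt_parity (A : SAlgFd.{u}) (g : SpinStat) (l l' : ℤ × ZMod 2) (h : pl g + l = l') (h' : l + pl g = l') :
    (nt action l (R action (pl g) A)).hom ≫ (m action h' A).hom = (m action h A).hom := by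
  have key := braiding_powers serre.{u} parity paritySq paritySq_comm braiding_parity g.val l l' h h'
  have h1 : (BraidedCategory.braiding (pw action (pl g)) (pw action l)).hom ≫ (pwMul action h').hom =
      (pwMul action h).hom := by
    rw [pwMul_hom, pwMul_hom]; exact key
  exact congrArg (NatEnd.mo · A) h1

/-- The transformation by which `ν (-1)^F` acts. -/
noncomputable def dgIso : pw action.{u} (dg 1) ≅ serre ≫ parity :=
  action.mapIso (eqToIso (show _ = ((⟨1⟩, ⟨1⟩) : Lab) by simp)) ≪≫
    -- The first power of `serre` is `serre ⊗ 𝟙` by construction, hence the unitor.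
    MonoidalCategory.whiskerRightIso (MonoidalCategory.rightUnitor serre) parity

noncomputable def dgAp (A : SAlgFd.{u}) : R action (dg 1) A ≅ dual A ≫ twist A := NatEnd.isoAp dgIso A

variable {A B : SAlgFd.{u}}

/-- The bimodule isomorphism underlying a trivialization of `ν (-1)^F`. -/
noncomputable def triv (t : 𝟙 A ≅ R action (dg 1) A) : SBimod.reg A.obj.alg ≅
    SBimod.comp (SBimod.twist A.obj.alg) (SBimod.dual A.obj.alg) where
  hom := mp (t ≪≫ dgAp A).hom
  inv := mp (t ≪≫ dgAp A).inv
  hom_inv_id := by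
    have := congrArg mp (t ≪≫ dgAp A).hom_inv_id
    exact this
  inv_hom_id := by
    have := congrArg mp (t ≪≫ dgAp A).inv_hom_id
    exact this

/-- Evaluated at `x`, one side of the naturality square is the image under `slide` of `S_M(λ' ⊗ x)`.
The other is `x ⊗ F ⊗ λ`, the image under `slide` of `(-1)^{|x|} x ⊗ λ`. Injectivity of `slide`
removes `F` and leaves its sign. -/
theorem nat1_iff (M : A ⟶ B) (t : 𝟙 A ≅ R action (dg 1) A) (t' : 𝟙 B ≅ R action (dg 1) B) :
    Nat1 M t.hom t'.hom ↔ ∀ x : bim M,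
      (S M).map (SBimod.t (SBimod.dual B.obj.alg) (bim M)
        ((SBimod.ev B.obj.alg).symm (SBimod.functional (triv t').hom)) x) =
      SBimod.t (bim M) (SBimod.dual A.obj.alg) ((bim M).par x)
        ((SBimod.ev A.obj.alg).symm (SBimod.functional (triv t).hom)) := by
  have h2 : Nat1 M t.hom t'.hom ↔ (ρ_ M).inv ≫ M ◁ (t' ≪≫ dgAp B).hom ≫ (NatEnd.nat (serre ≫ parity) M).hom =
      (λ_ M).inv ≫ (t ≪≫ dgAp A).hom ▷ M := 
        Nat1.iff_of_iso (dgAp A) (dgAp B) M _ (NatEnd.mo_nat dgIso.hom M) t.hom t'.hom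
  have h3 : ∀ x : bim M, (mp ((ρ_ M).inv ≫ M ◁ (t' ≪≫ dgAp B).hom ≫ (NatEnd.nat (serre ≫ parity) M).hom)).map x =
      SBimod.slide (bim M) (SBimod.dual A.obj.alg) ((S M).map (SBimod.t (SBimod.dual B.obj.alg) (bim M)
        ((SBimod.ev B.obj.alg).symm (SBimod.functional (triv t').hom)) x)) := fun x => by
    rw [NatEnd.nat_tensor]
    change (SBimod.assoc (bim M) (SBimod.twist A.obj.alg) (SBimod.dual A.obj.alg)).inv.map
      ((SBimod.homMap (SBimod.twistNat (bim M)).hom (𝟙 (SBimod.dual A.obj.alg))).map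
      ((SBimod.assoc (SBimod.twist B.obj.alg) (bim M) (SBimod.dual A.obj.alg)).hom.map
      ((SBimod.homMap (𝟙 (SBimod.twist B.obj.alg)) (S M)).map
      ((SBimod.assoc (SBimod.twist B.obj.alg) (SBimod.dual B.obj.alg) (bim M)).inv.map
      ((SBimod.homMap (triv t').hom (𝟙 (bim M))).map
      (SBimod.t (SBimod.reg B.obj.alg) (bim M) (SBimod.toReg B.obj.alg 1) x)))))) = _
    rw [SBimod.homMap_t, SBimod.functional_spec, SBimod.assoc_inv, SBimod.homMap_t]
    rfl
  have h4 : ∀ x : bim M, (mp ((λ_ M).inv ≫ (t ≪≫ dgAp A).hom ▷ M)).map x =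
      SBimod.slide (bim M) (SBimod.dual A.obj.alg) (SBimod.t (bim M) (SBimod.dual A.obj.alg) ((bim M).par x)
        ((SBimod.ev A.obj.alg).symm (SBimod.functional (triv t).hom))) := fun x => by
    change (SBimod.homMap (𝟙 (bim M)) (triv t).hom).map
      (SBimod.t (bim M) (SBimod.reg A.obj.alg) x (SBimod.toReg A.obj.alg 1)) = _
    rw [SBimod.homMap_t, SBimod.functional_spec, SBimod.slide_t, SBimod.par_par]
    rfl
  rw [h2]
  constructor
  · intro h x
    apply SBimod.slide_injective
    exact (h3 x).symm.trans ((congrArg (fun k => (mp k).map x) h).trans (h4 x))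
  · intro h
    apply hom₂_ext
    apply SBimod.hom_ext
    intro x
    exact (h3 x).trans ((congrArg _ (h x)).trans (h4 x).symm)

/-- The functional of a trivialization is even and symmetric, so `twistCtx_serre` applies. This
gives the condition `hP` of `HFP.std` for every `t`. -/
theorem nat1_parity (t : 𝟙 A ≅ R action (dg 1) A) : Nat1 (R action (0, 1) A) t.hom t.hom := by
  have h : Nat1 (twist A) t.hom t.hom := by
    rw [nat1_iff]
    intro x
    have : S (twist A) = (SBimod.twistCtx A.obj.alg).serreHom := SBimod.Ctx.serreHom_eq _ _
    rw [this]
    exact SBimod.twistCtx_serre _ (SBimod.functional_par _) (SBimod.functional_symm _) x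
  exact h.of_iso (λ_ (twist A)).symm

/-- The trivialization of `ν (-1)^F` with a given bimodule isomorphism. -/
noncomputable def ofTriv (p : SBimod.reg A.obj.alg ≅
    SBimod.comp (SBimod.twist A.obj.alg) (SBimod.dual A.obj.alg)) : 𝟙 A ≅ R action (dg 1) A :=
  mkIso (M := 𝟙 A) (N := dual A ≫ twist A) p ≪≫ (dgAp A).symm

theorem triv_ofTriv (p : SBimod.reg A.obj.alg ≅
    SBimod.comp (SBimod.twist A.obj.alg) (SBimod.dual A.obj.alg)) : (triv (ofTriv p)).hom = p.hom := by
  change mp (ofTriv p ≪≫ dgAp A).hom = mp (mkIso (M := 𝟙 A) (N := dual A ≫ twist A) p).hom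
  rw [ofTriv, Iso.trans_assoc, Iso.symm_self_id, Iso.trans_refl]
end SAlgFd

/-! ### The pseudofunctor to Frobenius algebras and its surjectivity on objects. -/

namespace SpinStatTFT
open SpinStat SAlgFd

/-- The Frobenius algebra of a field theory. -/
noncomputable def toFrob (X : SpinStatTFT.{u}) : UngrFrobAlg.{u} where
  alg := X.pt.obj
  tr := SBimod.functional (triv (X.τ 1)).hom
  tr_odd := SBimod.functional_odd _
  nondegenerate := SBimod.functional_nondegenerate _
  symm := SBimod.functional_symm _

theorem nat1_iff_Q {X Y : SpinStatTFT.{u}} (M : X.pt ⟶ Y.pt) :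
    Nat1 M (X.τ 1).hom (Y.τ 1).hom ↔ UngrFrob.Q (toFrob X) (toFrob Y) M := nat1_iff M _ _

/-- The bimodule of a 1-morphism of field theories. -/
noncomputable def toFrobHom {X Y : SpinStatTFT.{u}} (a : X ⟶ Y) : (⟨toFrob X⟩ : UngrFrob.{u}) ⟶ ⟨toFrob Y⟩ :=
  ⟨HFP.Hom.f a, (nat1_iff_Q _).1 (HFP.Hom.nat1 a 1)⟩

/-- The 2-functor that sends a field theory to its Frobenius algebra. -/
noncomputable def toUngrFrob : Pseudofunctor SpinStatTFT.{u} UngrFrob.{u} where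
  obj X := ⟨toFrob X⟩
  map a := toFrobHom a
  map₂ p := ⟨HFP.Hom₂.m p⟩
  map₂_id a := rfl
  map₂_comp p q := rfl
  mapId X := SubBicat.isoMk (Iso.refl _)
  mapComp a b := SubBicat.isoMk (Iso.refl _)
  map₂_whisker_left a b c p := SubBicat.hom₂_ext (by
    change HFP.Hom.f a ◁ HFP.Hom₂.m p = 𝟙 _ ≫ (HFP.Hom.f a ◁ HFP.Hom₂.m p) ≫ 𝟙 _
    simp)
  map₂_whisker_right p c := SubBicat.hom₂_ext (by
    change HFP.Hom₂.m p ▷ HFP.Hom.f c = 𝟙 _ ≫ (HFP.Hom₂.m p ▷ HFP.Hom.f c) ≫ 𝟙 _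
    simp)
  map₂_associator a b c := SubBicat.hom₂_ext (by
    change (α_ (HFP.Hom.f a) (HFP.Hom.f b) (HFP.Hom.f c)).hom = 𝟙 _ ≫ (𝟙 _ ▷ HFP.Hom.f c) ≫
      (α_ (HFP.Hom.f a) (HFP.Hom.f b) (HFP.Hom.f c)).hom ≫ (HFP.Hom.f a ◁ 𝟙 _) ≫ 𝟙 _
    simp)
  map₂_left_unitor a := SubBicat.hom₂_ext (by
    change (λ_ (HFP.Hom.f a)).hom = 𝟙 _ ≫ (𝟙 _ ▷ HFP.Hom.f a) ≫ (λ_ (HFP.Hom.f a)).hom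
    simp)
  map₂_right_unitor a := SubBicat.hom₂_ext (by
    change (ρ_ (HFP.Hom.f a)).hom = 𝟙 _ ≫ (HFP.Hom.f a ◁ 𝟙 _) ≫ (ρ_ (HFP.Hom.f a)).hom
    simp)

theorem exists_toFrob_eq (c : UngrFrobAlg.{u}) : ∃ X : SpinStatTFT.{u}, toFrob X = c := by
  have hp (a : c.alg.alg) : c.tr (c.alg.alg.par a) = c.tr a := by
    -- `par a - a` is odd, so vanishing on odd elements amounts to invariance under parity.
    have h := c.tr_odd (c.alg.alg.par a - a) (by simp)
    rwa [map_sub, sub_eq_zero] at h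
  have : FiniteDimensional ℂ c.alg.alg := c.alg.finite
  let t : 𝟙 (UngrFrob.F c) ≅ R action (dg 1) (UngrFrob.F c) :=
    ofTriv (SBimod.isoOfFunctional c.tr hp c.symm c.nondegenerate)
  have h : (triv t).hom = SBimod.ofFunctional c.tr hp c.symm := triv_ofTriv _
  refine ⟨HFP.std t (nat1_parity t) (nt_parity _), ?_⟩
  have h2 : SBimod.functional (triv ((HFP.std t (nat1_parity t) (nt_parity _)).τ 1)).hom = c.tr :=
    (congrArg (fun s => SBimod.functional (triv s).hom) (HFP.std_τ _ _ _)).trans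
      ((congrArg SBimod.functional h).trans (SBimod.functional_ofFunctional ..))
  obtain ⟨alg, tr, _, _, _⟩ := c
  unfold toFrob
  congr

end SpinStatTFT

end

/-- Two-dimensional field theories satisfying spin-statistics form a bicategory that is equivalent to the
bicategory of ungraded-symmetric Frobenius algebras. -/
theorem mainTheorem5 : BicategoriesEquivalent SpinStatTFT.{u} UngrFrob.{u} := by
  refine ⟨SpinStatTFT.toUngrFrob, fun X Y => ?_, fun c => ?_⟩
  · have : (SpinStatTFT.toUngrFrob.mapFunctor X Y).Full := ⟨fun {a b} p =>
      ⟨HFP.hom₂Mk (SubBicat.Hom₂.m p), rfl⟩⟩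
    have : (SpinStatTFT.toUngrFrob.mapFunctor X Y).Faithful := ⟨fun {a b} p q h =>
      HFP.hom₂_ext (congrArg SubBicat.Hom₂.m h)⟩
    -- By `nat1_iff_Q` the condition on a Frobenius bimodule is the naturality that `HFP.homMk`
    -- requires, and the lift has the same underlying bimodule.
    have : (SpinStatTFT.toUngrFrob.mapFunctor X Y).EssSurj := ⟨fun M =>
      ⟨HFP.homMk (X := X) (Y := Y) (SubBicat.Hom.f (F := UngrFrob.F) (Q := UngrFrob.Q)
        (a := ⟨SpinStatTFT.toFrob X⟩) (b := ⟨SpinStatTFT.toFrob Y⟩) M)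
        ((SpinStatTFT.nat1_iff_Q _).2 (SubBicat.Hom.mem M)), ⟨Iso.refl _⟩⟩⟩
    exact {}
  · obtain ⟨X, hX⟩ := SpinStatTFT.exists_toFrob_eq c.obj
    -- Objects are hit up to equality, so the required equivalence is a transported identity.
    have h : SpinStatTFT.toUngrFrob.obj X = c := congrArg SubBicat.mk hX
    exact ⟨X, ⟨h ▸ Bicategory.Equivalence.id _⟩⟩
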